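/- Let $n\ge 2$, let $\Omega\subset\mathbb R^n$ be a bounded open set, let $p>1$, and let $p^*=\frac{np}{n-p}$ if $p<n$, while $p^*>p$ is any fixed real number if $p\ge n$. Fix exponents $$0\le\alpha<1-\tfrac1{p^*},\quad 1\le r<p\big(1-\tfrac1{p^*}\big)+1,\quad 0\le\theta<p^*,\quad 1\le s<p^*,\quad s_1,s_3>\tfrac{p^*}{p^*-p}$$ (for $p<n$ the conditions on $r,s_1,s_3$ read $r<p+\frac pn$ and $s_1,s_3>\frac np$; lowering the critical exponents by $\varepsilon$, i.e. $\theta=s=p^*-\varepsilon$, $\alpha=1-\frac1{p^*}-\varepsilon$, $r=p+\frac pn-\varepsilon$, $s_3=\frac np+\varepsilon$ with $0<\varepsilon\le 1-\frac1{p^*}$, is a special case), constants $M\ge m>1$, $c_1,c_3,c_5,c_6,c_7,c_8>0$, $c_2,c_4,c_9\ge0$, and $B_1,B_3\in\mathbb R$. Put $$\gamma=\frac{p^*-p}{p^*-\max\big\{\frac1{1-\alpha};\ \frac p{p-r+1};\ \theta;\ s;\ \frac{p^*}{s_1};\ \frac{p^*}{s_3}+1\big\}} .$$ Then $\gamma>0$,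 and there is a constant $c>0$, depending only on $n$, $\Omega$ and the numbers above, such that the following holds. Let $f:\Omega\times\mathbb R\times\mathbb R^n\to[0,\infty)$, $f=f(x,u,\xi)$, be a Carathéodory function (measurable in $x$, continuous in $(u,\xi)$), convex and differentiable in $\xi$ with Carathéodory gradient $D_\xi f$, with $f(\cdot,0,0)\in L^1(\Omega)$ and, for a.e. $x$ and all $u,v\in\mathbb R$, $\xi\in\mathbb R^n$, $$m f(x,u,\xi)\le f(x,u,2\xi)\le M f(x,u,\xi),\qquad f(x,u,\xi)\ge c_5|\xi|^p,\qquad f(x,v,\xi)\le c_6 f(x,u,\xi)\ \text{ if } |v|\le|u| .$$ Let $a:\Omega\times\mathbb R\times\mathbb R^n\to\mathbb R^n$ be a Carathéodory map such that for a.e. $x$ and all $(u,\xi)$ $$(a(x,u,\xi),\xi)\ge c_1(D_\xi f(x,u,\xi),\xi)-c_2|u|^{\theta}-b_1(x),\qquad (a(x,u,\xi),\xi)\le c_3(D_\xi f(x,u,\xi),\xi)+c_4|u|^{p^*}+b_2(x)$$ for some $b_1\in L^{s_1}(\Omega)$ with $\|b_1\|_{L^{s_1}}\le B_1$ and $b_2\in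 L^1(\Omega)$. Let $b:\Omega\times\mathbb R\times\mathbb R^n\to\mathbb R$ be a Carathéodory function such that, for some nonnegative $b_3\in L^{s_3}(\Omega)$ with $\|b_3\|_{L^{s_3}}\le B_3$, for a.e. $x$ and all $(u,\xi)$, either $$\operatorname{sign}(u)\,b(x,u,\xi)\ge-c_7\big(f(x,u,\xi)^{\alpha}+|\xi|^{r-1}+|u|^{s-1}\big)-b_3(x),\qquad u\,b(x,u,\xi)\le c_8\big(f(x,u,\xi)+|u|^{p^*}\big)+b_4(x)$$ with some nonnegative $b_4\in L^1(\Omega)$, or $$|b(x,u,\xi)|\le c_9\big(f(x,u,\xi)^{\alpha}+|u|^{s-1}\big)+b_3(x).$$ Let $W^{1,F}(\Omega)$ be the set of $u\in W^{1,1}(\Omega)$ with $\int_\Omega f(x,u,Du)\,dx<\infty$, and $W^{1,F}_0(\Omega)=W^{1,F}(\Omega)\cap W^{1,p}_0(\Omega)$. Let $u_0\in L^\infty(\Omega)\cap W^{1,F}(\Omega)$, and let $u\in W^{1,F}(\Omega)$ with $u-u_0\in W^{1,F}_0(\Omega)$ be a weak solution of the Dirichlet problem $\operatorname{div}a(x,u,Du)=b(x,u,Du)$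 in $\Omega$, $u=u_0$ on $\partial\Omega$; that is, $\int_\Omega\{(a(x,u,Du),D\varphi)+b(x,u,Du)\varphi\}\,dx=0$ for every $\varphi\in W_0^{1,F}(\Omega)$ for which both $(a(x,u,Du),D\varphi)$ and $b(x,u,Du)\varphi$ are integrable on $\Omega$. Then $u\in L^\infty(\Omega)\cap L^{p^*}(\Omega)$ and $$\|u\|_{L^\infty(\Omega)}\le c\,\big(1+\|u_0\|_{L^\infty(\Omega)}\big)\big(1+\|u\|_{L^{p^*}(\Omega)}\big)^{\gamma};$$ in particular the same estimate holds with the exponent $\max\{1,\gamma\}\ge1$ in place of $\gamma$. -/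

import Mathlib

open MeasureTheory Filter Topology
open scoped ContDiff

noncomputable section

namespace DirichletBoundedness

/-- `Du` is the weak (distributional) gradient of `u` on the open set `Ω`. -/
def HasWeakGradient {n : ℕ} (Ω : Set (EuclideanSpace ℝ (Fin n)))
    (u : EuclideanSpace ℝ (Fin n) → ℝ)
    (Du : EuclideanSpace ℝ (Fin n) → EuclideanSpace ℝ (Fin n)) : Prop :=
  LocallyIntegrableOn u Ω ∧ LocallyIntegrableOn Du Ω ∧
  ∀ φ : EuclideanSpace ℝ (Fin n) → ℝ,
    ContDiff ℝ ∞ φ → HasCompactSupport φ → tsupport φ ⊆ Ω →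
    ∀ e : EuclideanSpace ℝ (Fin n),
      ∫ x in Ω, u x * fderiv ℝ φ x e = - ∫ x in Ω, inner ℝ (Du x) e * φ x

/-- `u ∈ W^{1,p}(Ω)` with weak gradient `Du`. -/
def MemW1 {n : ℕ} (Ω : Set (EuclideanSpace ℝ (Fin n))) (p : ℝ)
    (u : EuclideanSpace ℝ (Fin n) → ℝ)
    (Du : EuclideanSpace ℝ (Fin n) → EuclideanSpace ℝ (Fin n)) : Prop :=
  HasWeakGradient Ω u Du ∧
  MemLp u (ENNReal.ofReal p) (volume.restrict Ω) ∧
  MemLp Du (ENNReal.ofReal p) (volume.restrict Ω)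

/-- `u ∈ W_0^{1,p}(Ω)`, the closure of `C_c^∞(Ω)` in `W^{1,p}(Ω)`, with weak gradient `Du`. -/
def MemW1Zero {n : ℕ} (Ω : Set (EuclideanSpace ℝ (Fin n))) (p : ℝ)
    (u : EuclideanSpace ℝ (Fin n) → ℝ)
    (Du : EuclideanSpace ℝ (Fin n) → EuclideanSpace ℝ (Fin n)) : Prop :=
  MemW1 Ω p u Du ∧
  ∃ φ : ℕ → EuclideanSpace ℝ (Fin n) → ℝ,
    (∀ j, ContDiff ℝ ∞ (φ j) ∧ HasCompactSupport (φ j) ∧ tsupport (φ j) ⊆ Ω) ∧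
    Tendsto (fun j => eLpNorm (fun x => u x - φ j x) (ENNReal.ofReal p)
      (volume.restrict Ω)) atTop (𝓝 0) ∧
    Tendsto (fun j => eLpNorm (fun x => Du x - gradient (φ j) x) (ENNReal.ofReal p)
      (volume.restrict Ω)) atTop (𝓝 0)

/-- `u ∈ W^{1,F}(Ω)` with weak gradient `Du`: `u ∈ W^{1,1}(Ω)` and
`F(u) = ∫_Ω f(x, u, Du) dx < ∞`. -/
def MemW1F {n : ℕ} (Ω : Set (EuclideanSpace ℝ (Fin n)))
    (f : EuclideanSpace ℝ (Fin n) → ℝ → EuclideanSpace ℝ (Fin n) → ℝ)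
    (u : EuclideanSpace ℝ (Fin n) → ℝ)
    (Du : EuclideanSpace ℝ (Fin n) → EuclideanSpace ℝ (Fin n)) : Prop :=
  MemW1 Ω 1 u Du ∧ IntegrableOn (fun x => f x (u x) (Du x)) Ω

/-- `u ∈ W_0^{1,F}(Ω) = W^{1,F}(Ω) ∩ W_0^{1,p}(Ω)` with weak gradient `Du`. -/
def MemW1FZero {n : ℕ} (Ω : Set (EuclideanSpace ℝ (Fin n))) (p : ℝ)
    (f : EuclideanSpace ℝ (Fin n) → ℝ → EuclideanSpace ℝ (Fin n) → ℝ)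
    (u : EuclideanSpace ℝ (Fin n) → ℝ)
    (Du : EuclideanSpace ℝ (Fin n) → EuclideanSpace ℝ (Fin n)) : Prop :=
  MemW1F Ω f u Du ∧ MemW1Zero Ω p u Du

/-- Carathéodory maps on `Ω × ℝ × ℝⁿ`: measurable in `x`, continuous in `(u, ξ)`. -/
def IsCaratheodory {n : ℕ} {Y : Type*} [TopologicalSpace Y]
    (Ω : Set (EuclideanSpace ℝ (Fin n)))
    (g : EuclideanSpace ℝ (Fin n) → ℝ → EuclideanSpace ℝ (Fin n) → Y) : Prop :=
  (∀ (u : ℝ) (ξ : EuclideanSpace ℝ (Fin n)),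
    AEStronglyMeasurable (fun x => g x u ξ) (volume.restrict Ω)) ∧
  ∀ᵐ x ∂(volume.restrict Ω), Continuous (fun z : ℝ × EuclideanSpace ℝ (Fin n) => g x z.1 z.2)

/-- The numerical data: coercivity exponent `p`, Sobolev exponent `pStar`, the exponents in the
growth conditions, the structure constants, and bounds `B₁`, `B₃` for the norms of `b₁`, `b₃`. -/
structure Parameters where
  p : ℝ
  pStar : ℝ
  α : ℝ
  r : ℝ
  θ : ℝ
  s : ℝ
  s₁ : ℝ
  s₃ : ℝ
  m : ℝ
  M : ℝ
  c₁ : ℝ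
  c₂ : ℝ
  c₃ : ℝ
  c₄ : ℝ
  c₅ : ℝ
  c₆ : ℝ
  c₇ : ℝ
  c₈ : ℝ
  c₉ : ℝ
  B₁ : ℝ
  B₃ : ℝ

/-- Admissible numerical data in dimension `n`. If `p < n`, then `pStar = n p / (n - p)` and the
thresholds for `r` and for `s₁, s₃` read `p * (1 - 1 / pStar) + 1 = p + p / n` and
`pStar / (pStar - p) = n / p`. If `p ≥ n`, then `pStar > p` is any fixed number. -/
structure Parameters.Admissible (n : ℕ) (P : Parameters) : Prop where
  one_lt_p : 1 < P.p
  pStar_of_lt : P.p < n → P.pStar = n * P.p / (n - P.p)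
  pStar_of_ge : (n : ℝ) ≤ P.p → P.p < P.pStar
  α_nonneg : 0 ≤ P.α
  α_lt : P.α < 1 - 1 / P.pStar
  one_le_r : 1 ≤ P.r
  r_lt : P.r < P.p * (1 - 1 / P.pStar) + 1
  θ_nonneg : 0 ≤ P.θ
  θ_lt : P.θ < P.pStar
  one_le_s : 1 ≤ P.s
  s_lt : P.s < P.pStar
  s₁_gt : P.pStar / (P.pStar - P.p) < P.s₁
  s₃_gt : P.pStar / (P.pStar - P.p) < P.s₃
  one_lt_m : 1 < P.m
  m_le_M : P.m ≤ P.M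
  c₁_pos : 0 < P.c₁
  c₂_nonneg : 0 ≤ P.c₂
  c₃_pos : 0 < P.c₃
  c₄_nonneg : 0 ≤ P.c₄
  c₅_pos : 0 < P.c₅
  c₆_pos : 0 < P.c₆
  c₇_pos : 0 < P.c₇
  c₈_pos : 0 < P.c₈
  c₉_nonneg : 0 ≤ P.c₉

/-- The exponent `γ` of the quantitative estimate. -/
def Parameters.gamma (P : Parameters) : ℝ :=
  (P.pStar - P.p) /
    (P.pStar - max (1 / (1 - P.α)) (max (P.p / (P.p - P.r + 1)) (max P.θ (max P.s
      (max (P.pStar / P.s₁) (P.pStar / P.s₃ + 1))))))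

/-- The assumptions on the energy integrand `f`. -/
structure IsEnergyIntegrand {n : ℕ} (Ω : Set (EuclideanSpace ℝ (Fin n))) (P : Parameters)
    (f : EuclideanSpace ℝ (Fin n) → ℝ → EuclideanSpace ℝ (Fin n) → ℝ) : Prop where
  nonneg : ∀ᵐ x ∂(volume.restrict Ω), ∀ u ξ, 0 ≤ f x u ξ
  caratheodory : IsCaratheodory Ω f
  convex : ∀ᵐ x ∂(volume.restrict Ω), ∀ u, ConvexOn ℝ Set.univ (f x u)
  differentiable : ∀ᵐ x ∂(volume.restrict Ω), ∀ u, Differentiable ℝ (f x u)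
  gradient_caratheodory : IsCaratheodory Ω (fun x u ξ => gradient (f x u) ξ)
  delta_two : ∀ᵐ x ∂(volume.restrict Ω), ∀ u ξ,
    P.m * f x u ξ ≤ f x u ((2 : ℝ) • ξ) ∧ f x u ((2 : ℝ) • ξ) ≤ P.M * f x u ξ
  coercive : ∀ᵐ x ∂(volume.restrict Ω), ∀ u ξ, P.c₅ * ‖ξ‖ ^ P.p ≤ f x u ξ
  u_dependence : ∀ᵐ x ∂(volume.restrict Ω), ∀ u v ξ, |v| ≤ |u| → f x v ξ ≤ P.c₆ * f x u ξ
  summable_zero : IntegrableOn (fun x => f x 0 0) Ω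

/-- The comparison inequalities between the vector field `a` and `D_ξ f`. -/
def ComparisonInequalities {n : ℕ} (Ω : Set (EuclideanSpace ℝ (Fin n))) (P : Parameters)
    (f : EuclideanSpace ℝ (Fin n) → ℝ → EuclideanSpace ℝ (Fin n) → ℝ)
    (a : EuclideanSpace ℝ (Fin n) → ℝ → EuclideanSpace ℝ (Fin n) → EuclideanSpace ℝ (Fin n)) :
    Prop :=
  ∃ b₁ b₂ : EuclideanSpace ℝ (Fin n) → ℝ,
    MemLp b₁ (ENNReal.ofReal P.s₁) (volume.restrict Ω) ∧
    (eLpNorm b₁ (ENNReal.ofReal P.s₁) (volume.restrict Ω)).toReal ≤ P.B₁ ∧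
    IntegrableOn b₂ Ω ∧
    ∀ᵐ x ∂(volume.restrict Ω), ∀ (u : ℝ) (ξ : EuclideanSpace ℝ (Fin n)),
      P.c₁ * inner ℝ (gradient (f x u) ξ) ξ - P.c₂ * |u| ^ P.θ - b₁ x ≤ inner ℝ (a x u ξ) ξ ∧
      inner ℝ (a x u ξ) ξ ≤
        P.c₃ * inner ℝ (gradient (f x u) ξ) ξ + P.c₄ * |u| ^ P.pStar + b₂ x

/-- The unilateral growth conditions for the right-hand side `b`. -/
def UnilateralGrowth {n : ℕ} (Ω : Set (EuclideanSpace ℝ (Fin n))) (P : Parameters)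
    (f b : EuclideanSpace ℝ (Fin n) → ℝ → EuclideanSpace ℝ (Fin n) → ℝ) : Prop :=
  ∃ b₃ b₄ : EuclideanSpace ℝ (Fin n) → ℝ,
    (∀ᵐ x ∂(volume.restrict Ω), 0 ≤ b₃ x ∧ 0 ≤ b₄ x) ∧
    MemLp b₃ (ENNReal.ofReal P.s₃) (volume.restrict Ω) ∧
    (eLpNorm b₃ (ENNReal.ofReal P.s₃) (volume.restrict Ω)).toReal ≤ P.B₃ ∧
    IntegrableOn b₄ Ω ∧
    ∀ᵐ x ∂(volume.restrict Ω), ∀ (u : ℝ) (ξ : EuclideanSpace ℝ (Fin n)),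
      -(P.c₇ * (f x u ξ ^ P.α + ‖ξ‖ ^ (P.r - 1) + |u| ^ (P.s - 1))) - b₃ x
        ≤ Real.sign u * b x u ξ ∧
      u * b x u ξ ≤ P.c₈ * (f x u ξ + |u| ^ P.pStar) + b₄ x

/-- The growth condition for `|b|`. -/
def AbsoluteGrowth {n : ℕ} (Ω : Set (EuclideanSpace ℝ (Fin n))) (P : Parameters)
    (f b : EuclideanSpace ℝ (Fin n) → ℝ → EuclideanSpace ℝ (Fin n) → ℝ) : Prop :=
  ∃ b₃ : EuclideanSpace ℝ (Fin n) → ℝ,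
    (∀ᵐ x ∂(volume.restrict Ω), 0 ≤ b₃ x) ∧
    MemLp b₃ (ENNReal.ofReal P.s₃) (volume.restrict Ω) ∧
    (eLpNorm b₃ (ENNReal.ofReal P.s₃) (volume.restrict Ω)).toReal ≤ P.B₃ ∧
    ∀ᵐ x ∂(volume.restrict Ω), ∀ (u : ℝ) (ξ : EuclideanSpace ℝ (Fin n)),
      |b x u ξ| ≤ P.c₉ * (f x u ξ ^ P.α + |u| ^ (P.s - 1)) + b₃ x

/-- `u` is a finite-energy weak solution of `div a(x,u,Du) = b(x,u,Du)` in `Ω`, `u = u₀` on `∂Ω`: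
`u ∈ W^{1,F}(Ω)`, `u ∈ u₀ + W_0^{1,F}(Ω)`, and `∫_Ω (a(x,u,Du), Dφ) + b(x,u,Du) φ dx = 0` for all
`φ ∈ W_0^{1,F}(Ω)` for which both pairings are integrable. (No upper growth of `|a|` is assumed,
so the pairings need not be integrable for every `φ`; a solution for which they are is in
particular a solution in the present sense.) -/
def IsWeakSolution {n : ℕ} (Ω : Set (EuclideanSpace ℝ (Fin n))) (p : ℝ)
    (f : EuclideanSpace ℝ (Fin n) → ℝ → EuclideanSpace ℝ (Fin n) → ℝ)
    (a : EuclideanSpace ℝ (Fin n) → ℝ → EuclideanSpace ℝ (Fin n) → EuclideanSpace ℝ (Fin n))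
    (b : EuclideanSpace ℝ (Fin n) → ℝ → EuclideanSpace ℝ (Fin n) → ℝ)
    (u₀ u : EuclideanSpace ℝ (Fin n) → ℝ) : Prop :=
  ∃ Du : EuclideanSpace ℝ (Fin n) → EuclideanSpace ℝ (Fin n),
    MemW1F Ω f u Du ∧
    (∃ Dw, MemW1FZero Ω p f (fun x => u x - u₀ x) Dw) ∧
    ∀ (φ : EuclideanSpace ℝ (Fin n) → ℝ)
      (Dφ : EuclideanSpace ℝ (Fin n) → EuclideanSpace ℝ (Fin n)),
      MemW1FZero Ω p f φ Dφ →
      IntegrableOn (fun x => inner ℝ (a x (u x) (Du x)) (Dφ x)) Ω →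
      IntegrableOn (fun x => b x (u x) (Du x) * φ x) Ω →
      ∫ x in Ω, (inner ℝ (a x (u x) (Du x)) (Dφ x) + b x (u x) (Du x) * φ x) = 0

end DirichletBoundedness

end

/-! The solution is tested with its own excess. For a level k ≥ max(1, ‖u₀‖_∞) let z = sign(u)(|u| -
k)⁺, whose gradient is χ Du with χ the indicator of {|u| > k}. Where |u| > k the energy density of z
is at most c₆ f(x,u,Du), and elsewhere it vanishes, so z is admissible. In the equation a(x,u,Du) is
then paired only with Du, and the comparison inequalities bound this pairing from both sides; no
growth of |a| is needed. Since z has the sign of u, the estimate uses only a lower bound for sign(u)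
b; the upper bound for u b serves integrability.

Convexity and doubling place (D_ξ f, ξ) between f and (M-1) f. Young's inequality absorbs f^α and
|Du|^(r-1) into f, leaving powers of |u|. Write q = `pStar` and c = `P.critical`. With coercivity
this gives ∫_{|u|>k} |Du|^p ≤ K ∫_{|u|>k} (|u|^c + β₁ + β₃|u|), which is `exists_energy_estimate`.
The entries of the maximum defining c are the powers left over: 1/(1-α) and p/(p-r+1) from Young, θ
and s directly, q/s₁ and q/s₃ + 1 from Hölder's inequality for β₁ and β₃|u|.

The Sobolev inequality bounds (∫ |z|^q)^(p/q) by the same right-hand side, and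
`exists_const_ae_abs_le` runs De Giorgi's iteration over the levels k_i = K(2 - 2^(-i)). Above
k_{i+1}, |u| is at most 2^(i+3) times the excess over k_i, and |u|^(c-q) ≤ K^(c-q). Let U =
‖u‖_{L^q}, T = (1+U)^q, and let J_i be the integral of the q-th power of the excess over k_i. Then
(J_{i+1}/T)^(p/q) ≤ C K^(c-q) (1+U)^(q-p) 2^(qi) (J_i/T)^κ with κ = min(1 - 1/s₁, 1 - 1/s₃), and the
thresholds on s₁, s₃ say exactly that κ > p/q. As J_0/T ≤ 1, decay only requires K^(c-q)(1+U)^(q-p)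
to be small, that is K ≥ L(1+U)^((q-p)/(q-c)). This is the origin of γ, and the outcome is |u| ≤ 2K
almost everywhere.

The analytic groundwork starts from the definitions: mollification gives the chain rule and the
closedness of W_0^{1,p}, hence `MemW1Zero.excess_add`; the Sobolev inequality passes from test
functions to their closure in `exists_sobolev_const`. -/

noncomputable section

namespace DirichletBoundedness

open scoped ENNReal NNReal Convolution

/-! ### Mollification in L^q -/

section Mollification

/-- Bump functions centred at the origin with radii `1 / (j + 1)`. -/
def bump (E : Type*) [NormedAddCommGroup E] [NormedSpace ℝ E] [FiniteDimensional ℝ E] (j : ℕ) :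
    ContDiffBump (0 : E) :=
  ⟨1 / (2 * (j + 1)), 1 / (j + 1), by positivity, by
    rw [div_lt_div_iff₀ (by positivity) (by positivity)]; nlinarith [(Nat.cast_nonneg j : (0:ℝ) ≤ j)]⟩

theorem tendsto_rOut_bump (E : Type*) [NormedAddCommGroup E] [NormedSpace ℝ E]
    [FiniteDimensional ℝ E] : Tendsto (fun j => (bump E j).rOut) atTop (𝓝 0) :=
  tendsto_one_div_add_atTop_nhds_zero_nat


variable {E : Type*} [NormedAddCommGroup E] [NormedSpace ℝ E] [FiniteDimensional ℝ E]
  [MeasurableSpace E] [BorelSpace E] {F : Type*} [NormedAddCommGroup F] {μ : Measure E} [μ.IsAddHaarMeasure]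

/-- Translations act continuously on `L^q`, `1 ≤ q < ∞`. -/
theorem tendsto_eLpNorm_translate_sub {q : ℝ≥0∞} (hq : 1 ≤ q) (hq' : q ≠ ⊤) {g : E → F}
    (hg : MemLp g q μ) :
    Tendsto (fun y => eLpNorm (fun x => g (x - y) - g x) q μ) (𝓝 0) (𝓝 0) := by
  have : Fact (1 ≤ q) := ⟨hq⟩
  -- Currying makes the translation depend continuously on y in the compact-open topology, the form
  -- in which continuity of composition in L^q is available.
  let c : C(E, C(E, E)) := (ContinuousMap.mk (fun z : E × E => z.2 - z.1)
    (continuous_snd.sub continuous_fst)).curry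
  have hmp : ∀ y, MeasurePreserving (c y) μ μ := fun y => measurePreserving_sub_right μ y
  have h := (Tendsto.compMeasurePreservingLp (l := 𝓝 (0 : E)) (f := fun _ => hg.toLp g)
    (f₀ := hg.toLp g) (g := c) (g₀ := c 0) tendsto_const_nhds
    (c.continuous.tendsto 0) hmp (hmp 0) hq')
  rw [tendsto_iff_edist_tendsto_0] at h
  refine h.congr fun y => ?_
  rw [Lp.edist_def]
  apply eLpNorm_congr_ae
  have e1 := Lp.coeFn_compMeasurePreserving (hg.toLp g) (hmp y)
  have e2 := Lp.coeFn_compMeasurePreserving (hg.toLp g) (hmp 0)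
  have e3 := (hmp y).quasiMeasurePreserving.ae_eq_comp hg.coeFn_toLp
  have e4 := (hmp 0).quasiMeasurePreserving.ae_eq_comp hg.coeFn_toLp
  filter_upwards [e1, e2, e3, e4] with x h1 h2 h3 h4
  simp only [Pi.sub_apply]
  rw [h1, h2, h3, h4]
  simp [c]

variable [NormedSpace ℝ F] [CompleteSpace F]

/-- A mollification moves an `L^q` function at most as far as the translations involved do. -/
theorem eLpNorm_convolution_normed_sub_le {q : ℝ≥0∞} (hq : 1 ≤ q) (hq' : q ≠ ⊤) {g : E → F}
    (hg : MemLp g q μ) (φ : ContDiffBump (0 : E)) {δ : ℝ≥0∞}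
    (hδ : ∀ y ∈ Metric.ball (0 : E) φ.rOut, eLpNorm (fun x => g (x - y) - g x) q μ ≤ δ) :
    eLpNorm (fun x => (φ.normed μ ⋆[ContinuousLinearMap.lsmul ℝ ℝ, μ] g) x - g x) q μ ≤ δ := by
  have hq0 : q ≠ 0 := (one_pos.trans_le hq).ne'
  have hqr : 0 < q.toReal := ENNReal.toReal_pos hq0 hq'
  have hgl : LocallyIntegrable g μ := hg.locallyIntegrable hq
  set w : E → ℝ≥0∞ := fun t => ENNReal.ofReal (φ.normed μ t) with hw
  have hwm : Measurable w := (φ.continuous_normed.measurable).ennreal_ofReal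
  have hw1 : ∫⁻ t, w t ∂μ = 1 := by
    rw [hw, ← ofReal_integral_eq_lintegral_ofReal φ.integrable_normed
      (ae_of_all _ φ.nonneg_normed), φ.integral_normed, ENNReal.ofReal_one]
  -- The mollifier is a probability density, so Jensen's inequality bounds the q-th power of the
  -- averaged difference pointwise; Tonelli then exchanges the integrals.
  have : IsProbabilityMeasure (μ.withDensity w) :=
    ⟨by rw [withDensity_apply _ MeasurableSet.univ, Measure.restrict_univ, hw1]⟩
  have hmeas : AEStronglyMeasurable (fun z : E × E => g (z.1 - z.2) - g z.1) (μ.prod μ) :=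
    (hg.1.comp_quasiMeasurePreserving (quasiMeasurePreserving_sub μ μ)).sub hg.1.comp_fst
  have hpt : ∀ x, ‖(φ.normed μ ⋆[ContinuousLinearMap.lsmul ℝ ℝ, μ] g) x - g x‖ₑ ^ q.toReal
      ≤ ∫⁻ t, w t * ‖g (x - t) - g x‖ₑ ^ q.toReal ∂μ := by
    intro x
    have hx : AEStronglyMeasurable (fun t => g (x - t) - g x) μ :=
      (hg.1.comp_quasiMeasurePreserving (quasiMeasurePreserving_sub_left μ x)).sub
        aestronglyMeasurable_const
    have hex := HasCompactSupport.convolutionExists_left (μ := μ)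
      (ContinuousLinearMap.lsmul ℝ ℝ) (φ.hasCompactSupport_normed (μ := μ))
      φ.continuous_normed hgl x
    have e1 : (φ.normed μ ⋆[ContinuousLinearMap.lsmul ℝ ℝ, μ] g) x - g x
        = ∫ t, φ.normed μ t • (g (x - t) - g x) ∂μ := by
      rw [convolution_def]
      simp only [smul_sub]
      rw [integral_sub (by exact hex) (φ.integrable_normed.smul_const _),
        φ.integral_normed_smul μ (g x)]
      rfl
    have e2 : ‖(φ.normed μ ⋆[ContinuousLinearMap.lsmul ℝ ℝ, μ] g) x - g x‖ₑ
        ≤ ∫⁻ t, ‖g (x - t) - g x‖ₑ ∂(μ.withDensity w) := by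
      rw [e1, lintegral_withDensity_eq_lintegral_mul₀ hwm.aemeasurable hx.enorm]
      refine (enorm_integral_le_lintegral_enorm _).trans_eq (lintegral_congr fun t => ?_)
      rw [enorm_smul, Real.enorm_of_nonneg (φ.nonneg_normed t)]
      rfl
    have e3 : ∫⁻ t, ‖g (x - t) - g x‖ₑ ∂(μ.withDensity w)
        ≤ (∫⁻ t, ‖g (x - t) - g x‖ₑ ^ q.toReal ∂(μ.withDensity w)) ^ (1 / q.toReal) := by
      have := eLpNorm_le_eLpNorm_of_exponent_le (μ := μ.withDensity w) hq
        (hx.mono_ac (withDensity_absolutelyContinuous _ _))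
      rwa [eLpNorm_one_eq_lintegral_enorm, eLpNorm_eq_lintegral_rpow_enorm_toReal hq0 hq'] at this
    calc _ ≤ ((∫⁻ t, ‖g (x - t) - g x‖ₑ ^ q.toReal ∂(μ.withDensity w)) ^ (1 / q.toReal))
          ^ q.toReal := by gcongr; exact e2.trans e3
      _ = ∫⁻ t, ‖g (x - t) - g x‖ₑ ^ q.toReal ∂(μ.withDensity w) := by
          rw [← ENNReal.rpow_mul, one_div_mul_cancel hqr.ne', ENNReal.rpow_one]
      _ = _ := by
          rw [lintegral_withDensity_eq_lintegral_mul₀ hwm.aemeasurable (hx.enorm.pow_const _)]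
          rfl
  rw [eLpNorm_eq_lintegral_rpow_enorm_toReal hq0 hq', one_div,
    ENNReal.rpow_inv_le_iff hqr]
  calc _ ≤ ∫⁻ x, ∫⁻ t, w t * ‖g (x - t) - g x‖ₑ ^ q.toReal ∂μ ∂μ := lintegral_mono hpt
    _ = ∫⁻ t, ∫⁻ x, w t * ‖g (x - t) - g x‖ₑ ^ q.toReal ∂μ ∂μ :=
        lintegral_lintegral_swap
          ((hwm.comp measurable_snd).aemeasurable.mul (hmeas.enorm.pow_const _))
    _ ≤ ∫⁻ t, w t * δ ^ q.toReal ∂μ := by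
        refine lintegral_mono fun t => ?_
        by_cases ht : t ∈ Metric.ball (0 : E) φ.rOut
        · rw [lintegral_const_mul' _ _ ENNReal.ofReal_ne_top]
          gcongr
          have := hδ t ht
          rwa [eLpNorm_eq_lintegral_rpow_enorm_toReal hq0 hq', one_div,
            ENNReal.rpow_inv_le_iff hqr] at this
        · have : φ.normed μ t = 0 := by
            rw [← Function.notMem_support, φ.support_normed_eq]; exact ht
          simp [hw, this]
    _ = δ ^ q.toReal := by
        rw [lintegral_mul_const _ hwm, hw1, one_mul]

/-- Mollifications of an `L^q` function converge in `L^q`, `1 ≤ q < ∞`. -/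
theorem tendsto_eLpNorm_convolution_bump_sub {q : ℝ≥0∞} (hq : 1 ≤ q) (hq' : q ≠ ⊤) {g : E → F}
    (hg : MemLp g q μ) :
    Tendsto (fun j => eLpNorm (fun x =>
      ((bump E j).normed μ ⋆[ContinuousLinearMap.lsmul ℝ ℝ, μ] g) x - g x) q μ) atTop (𝓝 0) := by
  have h := tendsto_eLpNorm_translate_sub hq hq' hg
  rw [ENNReal.tendsto_nhds_zero] at h ⊢
  intro ε hε
  obtain ⟨r, hr, hball⟩ := Metric.eventually_nhds_iff_ball.1 (h ε hε)
  filter_upwards [(tendsto_rOut_bump E).eventually (gt_mem_nhds hr)] with j hj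
  exact eLpNorm_convolution_normed_sub_le hq hq' hg _
    fun y hy => hball y (Metric.ball_subset_ball hj.le hy)

end Mollification

/-! ### Cutoffs and smooth approximation of weakly differentiable functions -/

section WeakGradient

variable {n : ℕ} {Ω : Set (EuclideanSpace ℝ (Fin n))}

local notation "𝔼" => EuclideanSpace ℝ (Fin n)

theorem norm_gradient_eq_norm_fderiv {φ : 𝔼 → ℝ} (x : 𝔼) :
    ‖gradient φ x‖ = ‖fderiv ℝ φ x‖ := by
  rw [← toDual_gradient, LinearIsometryEquiv.norm_map]

theorem continuous_gradient {φ : 𝔼 → ℝ} (hφ : ContDiff ℝ 1 φ) : Continuous (gradient φ) :=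
  (InnerProductSpace.toDual ℝ 𝔼).symm.continuous.comp (hφ.continuous_fderiv one_ne_zero)

theorem gradient_eq_zero_of_notMem_tsupport {φ : 𝔼 → ℝ} {x : 𝔼} (hx : x ∉ tsupport φ) :
    gradient φ x = 0 := by
  rw [← norm_eq_zero, norm_gradient_eq_norm_fderiv, norm_eq_zero, ← Function.notMem_support]
  exact fun h => hx (support_fderiv_subset ℝ h)

/-- A locally integrable function on an open set times a continuous function with compact support
in that set is integrable. -/
theorem _root_.MeasureTheory.LocallyIntegrableOn.integrable_smul_of_tsupport_subset
    {G : Type*} [NormedAddCommGroup G] [NormedSpace ℝ G]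
    {u : 𝔼 → G} (hu : LocallyIntegrableOn u Ω) {χ : 𝔼 → ℝ} (hχ : Continuous χ)
    (hχc : HasCompactSupport χ) (hχΩ : tsupport χ ⊆ Ω) : Integrable (fun x => χ x • u x) := by
  have h1 : IntegrableOn (fun x => χ x • u x) (tsupport χ) :=
    (hu.integrableOn_compact_subset hχΩ hχc).continuousOn_smul hχ.continuousOn hχc
  refine (integrableOn_iff_integrable_of_support_subset fun x hx => ?_).1 h1
  by_contra h
  simp [image_eq_zero_of_notMem_tsupport h] at hx

/-- The same with a continuous vector field of compact support. -/
theorem _root_.MeasureTheory.LocallyIntegrableOn.integrable_smul_vector_of_tsupport_subset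
    {G : Type*} [NormedAddCommGroup G] [NormedSpace ℝ G] [SecondCountableTopology G]
    {u : 𝔼 → ℝ} (hu : LocallyIntegrableOn u Ω) {χ : 𝔼 → G} (hχ : Continuous χ)
    (hχc : HasCompactSupport χ) (hχΩ : tsupport χ ⊆ Ω) : Integrable (fun x => u x • χ x) := by
  have h1 : IntegrableOn (fun x => u x • χ x) (tsupport χ) :=
    (hu.integrableOn_compact_subset hχΩ hχc).smul_continuousOn hχ.continuousOn hχc
  refine (integrableOn_iff_integrable_of_support_subset fun x hx => ?_).1 h1
  by_contra h
  simp [image_eq_zero_of_notMem_tsupport h] at hx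

theorem hasCompactSupport_gradient {φ : 𝔼 → ℝ} (hφ : HasCompactSupport φ) :
    HasCompactSupport (gradient φ) :=
  hφ.of_isClosed_subset (isClosed_tsupport _) (closure_minimal (fun x hx => by
    by_contra h; exact hx (gradient_eq_zero_of_notMem_tsupport h)) (isClosed_tsupport _))

theorem tsupport_gradient_subset {φ : 𝔼 → ℝ} : tsupport (gradient φ) ⊆ tsupport φ :=
  closure_minimal (fun x hx => by
    by_contra h; exact hx (gradient_eq_zero_of_notMem_tsupport h)) (isClosed_tsupport _)

/-- Smooth cutoff functions: equal to `1` near a compact set, compactly supported in an open set. -/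
theorem exists_cutoff (hΩ : IsOpen Ω) {K : Set 𝔼} (hK : IsCompact K) (hKΩ : K ⊆ Ω) :
    ∃ χ : 𝔼 → ℝ, ContDiff ℝ ∞ χ ∧ HasCompactSupport χ ∧ tsupport χ ⊆ Ω ∧
      (∀ x, 0 ≤ χ x ∧ χ x ≤ 1) ∧ ∀ x ∈ K, χ =ᶠ[𝓝 x] 1 := by
  obtain ⟨δ, hδ, hδΩ⟩ := hK.exists_cthickening_subset_open hΩ hKΩ
  -- Requiring the value 1 on the whole δ/2-thickening makes χ constant near each point of K, so
  -- that its gradient vanishes there too.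
  obtain ⟨χ, hχ, hr, hs, h1⟩ := exists_contMDiff_support_eq_eq_one_iff
    (modelWithCornersSelf ℝ 𝔼) (n := (⊤ : ℕ∞)) (Metric.isOpen_thickening (δ := δ) (E := K))
    (Metric.isClosed_cthickening (δ := δ / 2) (E := K))
    (Metric.cthickening_subset_thickening' hδ (half_lt_self hδ) K)
  have hsub : tsupport χ ⊆ Metric.cthickening δ K :=
    closure_minimal (hs ▸ Metric.thickening_subset_cthickening δ K) Metric.isClosed_cthickening
  refine ⟨χ, hχ.contDiff, hK.cthickening.of_isClosed_subset (isClosed_tsupport _) hsub,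
    hsub.trans hδΩ, fun x => hr ⟨x, rfl⟩, fun x hx => ?_⟩
  filter_upwards [(Metric.isOpen_thickening (δ := δ / 2) (E := K)).mem_nhds
    (Metric.self_subset_thickening (half_pos hδ) K hx)] with y hy
  exact (h1 y).1 (Metric.thickening_subset_cthickening _ _ hy)

theorem setIntegral_eq_integral_of_tsupport_subset {χ : 𝔼 → ℝ} (hχΩ : tsupport χ ⊆ Ω)
    {G : Type*} [NormedAddCommGroup G] [NormedSpace ℝ G]
    {h : 𝔼 → G} (hh : ∀ x, x ∉ tsupport χ → h x = 0) :
    ∫ x in Ω, h x = ∫ x, h x :=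
  setIntegral_eq_integral_of_forall_compl_eq_zero fun x hx => hh x fun h' => hx (hχΩ h')

/-- The weak formulation is applied to χφ, and the product-rule term containing the derivative of χ
is moved to the right. Since χ supplies the compact support, φ is any smooth function; in particular
it can be a mollifier centred at any point of the space. -/
theorem HasWeakGradient.integral_cutoff {u : 𝔼 → ℝ} {Du : 𝔼 → 𝔼}
    (h : HasWeakGradient Ω u Du) {χ : 𝔼 → ℝ} (hχ : ContDiff ℝ ∞ χ)
    (hχc : HasCompactSupport χ) (hχΩ : tsupport χ ⊆ Ω) {φ : 𝔼 → ℝ} (hφ : ContDiff ℝ ∞ φ) (e : 𝔼) :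
    ∫ x, χ x * u x * fderiv ℝ φ x e
      = - ∫ x, inner ℝ (χ x • Du x + u x • gradient χ x) e * φ x := by
  have hd : Continuous fun x => fderiv ℝ χ x e :=
    (hχ.continuous_fderiv (by simp)).clm_apply continuous_const
  have hdφ : Continuous fun x => fderiv ℝ φ x e :=
    (hφ.continuous_fderiv (by simp)).clm_apply continuous_const
  have hχ0 : ∀ x, x ∉ tsupport χ → χ x = 0 := fun x => image_eq_zero_of_notMem_tsupport
  have hd0 : ∀ x, x ∉ tsupport χ → fderiv ℝ χ x e = 0 := fun x hx => by
    rw [← inner_gradient_left, gradient_eq_zero_of_notMem_tsupport hx, inner_zero_left]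
  have key := h.2.2 (fun x => χ x * φ x) (hχ.mul hφ) hχc.mul_right
    ((tsupport_mul_subset_left).trans hχΩ) e
  have hfd : ∀ x, fderiv ℝ (fun x => χ x * φ x) x e = χ x * fderiv ℝ φ x e
      + φ x * fderiv ℝ χ x e := fun x => by
    rw [fderiv_fun_mul (hχ.differentiable (by simp) x) (hφ.differentiable (by simp) x)]
    simp
  simp only [hfd] at key
  rw [setIntegral_eq_integral_of_tsupport_subset hχΩ (fun x hx => by simp [hχ0 x hx, hd0 x hx]),
    setIntegral_eq_integral_of_tsupport_subset hχΩ (fun x hx => by simp [hχ0 x hx])] at key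
  have i1 : Integrable fun x => χ x * u x * fderiv ℝ φ x e := by
    refine (h.1.integrable_smul_of_tsupport_subset (χ := fun x => χ x * fderiv ℝ φ x e)
      (hχ.continuous.mul hdφ) hχc.mul_right (tsupport_mul_subset_left.trans hχΩ)).congr
      (ae_of_all _ fun x => ?_)
    simp only [smul_eq_mul]; ring
  have i2 : Integrable fun x => u x * (φ x * fderiv ℝ χ x e) := by
    refine (h.1.integrable_smul_of_tsupport_subset (χ := fun x => fderiv ℝ χ x e * φ x) (hd.mul hφ.continuous) ?_ ?_).congr
      (ae_of_all _ fun x => ?_)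
    · exact ((hχc.fderiv_apply ℝ e)).mul_right
    · refine tsupport_mul_subset_left.trans (subset_trans ?_ hχΩ)
      exact closure_minimal (fun x hx => by by_contra h'; exact hx (hd0 x h')) (isClosed_tsupport _)
    · simp only [smul_eq_mul]; ring
  have i3 : Integrable fun x => inner ℝ (Du x) e * (χ x * φ x) := by
    refine ((h.2.1.integrable_smul_of_tsupport_subset (χ := fun x => χ x * φ x)
      (hχ.continuous.mul hφ.continuous) hχc.mul_right
      (tsupport_mul_subset_left.trans hχΩ)).inner_const (𝕜 := ℝ) e).congr
      (ae_of_all _ fun x => ?_)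
    simp only [inner_smul_left]; simp; ring
  have e1 : ∫ x, u x * (χ x * fderiv ℝ φ x e + φ x * fderiv ℝ χ x e)
      = (∫ x, χ x * u x * fderiv ℝ φ x e) + ∫ x, u x * (φ x * fderiv ℝ χ x e) := by
    rw [← integral_add i1 i2]; congr 1; ext x; ring
  have e2 : ∫ x, inner ℝ (χ x • Du x + u x • gradient χ x) e * φ x
      = (∫ x, inner ℝ (Du x) e * (χ x * φ x)) + ∫ x, u x * (φ x * fderiv ℝ χ x e) := by
    rw [← integral_add i3 i2]; congr 1; ext x
    simp only [inner_add_left, inner_smul_left, inner_gradient_left]; simp; ring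
  rw [e1] at key
  rw [e2]; linarith

/-- A function with a weak gradient, cut off, is a limit of test functions. -/
theorem HasWeakGradient.exists_smooth_approx (hΩ : IsOpen Ω) {u : 𝔼 → ℝ} {Du : 𝔼 → 𝔼}
    (h : HasWeakGradient Ω u Du) {χ : 𝔼 → ℝ} (hχ : ContDiff ℝ ∞ χ)
    (hχc : HasCompactSupport χ) (hχΩ : tsupport χ ⊆ Ω) {q : ℝ≥0∞} (hq : 1 ≤ q) (hq' : q ≠ ⊤)
    (hu : MemLp (fun x => χ x * u x) q)
    (hDu : MemLp (fun x => χ x • Du x + u x • gradient χ x) q) :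
    ∃ ψ : ℕ → 𝔼 → ℝ,
      (∀ j, ContDiff ℝ ∞ (ψ j) ∧ HasCompactSupport (ψ j) ∧ tsupport (ψ j) ⊆ Ω) ∧
      Tendsto (fun j => eLpNorm (fun x => ψ j x - χ x * u x) q volume) atTop (𝓝 0) ∧
      Tendsto (fun j => eLpNorm (fun x => gradient (ψ j) x -
        (χ x • Du x + u x • gradient χ x)) q volume) atTop (𝓝 0) := by
  set v : 𝔼 → ℝ := fun x => χ x * u x with hv
  set D : 𝔼 → 𝔼 := fun x => χ x • Du x + u x • gradient χ x with hD
  have hvl : LocallyIntegrable v := hu.locallyIntegrable hq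
  have hDl : LocallyIntegrable D := hDu.locallyIntegrable hq
  obtain ⟨δ, hδ, hδΩ⟩ := IsCompact.exists_cthickening_subset_open hχc hΩ hχΩ
  set η : ℕ → 𝔼 → ℝ := fun j => (bump 𝔼 j).normed volume with hη
  have hηs : ∀ j, ContDiff ℝ ∞ (η j) := fun j => (bump 𝔼 j).contDiff_normed
  have hηc : ∀ j, HasCompactSupport (η j) := fun j => (bump 𝔼 j).hasCompactSupport_normed
  set ψ : ℕ → 𝔼 → ℝ := fun j => η j ⋆[ContinuousLinearMap.lsmul ℝ ℝ, volume] v with hψ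
  -- Differentiation falls on the mollifier η_j(x - ·), and `integral_cutoff` with this φ moves it
  -- onto v.
  have hgrad : ∀ j x, gradient (ψ j) x
      = (η j ⋆[ContinuousLinearMap.lsmul ℝ ℝ, volume] D) x := by
    intro j x
    refine ext_inner_right ℝ fun e => ?_
    have hex := (hηc j).convolutionExists_left (μ := volume)
      (ContinuousLinearMap.lsmul ℝ ℝ : ℝ →L[ℝ] 𝔼 →L[ℝ] 𝔼) (hηs j).continuous hDl
    have hsub : ∀ t, fderiv ℝ (fun t => η j (x - t)) t e = - fderiv ℝ (η j) (x - t) e := by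
      intro t
      have := ((hηs j).differentiable (by simp) (x - t)).hasFDerivAt.comp t
        ((hasFDerivAt_id t).const_sub x)
      have h2 := this.fderiv
      simp only [Function.comp_def] at h2
      rw [h2]; simp
    have key := h.integral_cutoff hχ hχc hχΩ (φ := fun t => η j (x - t))
      ((hηs j).comp (contDiff_const.sub contDiff_id)) e
    simp only [hsub] at key
    rw [inner_gradient_left, hψ]
    simp only
    rw [← convolution_flip, ((hηc j).hasFDerivAt_convolution_right _ hvl
      ((hηs j).of_le (by simp)) x).fderiv, convolution_precompR_apply _ hvl
      ((hηc j).fderiv ℝ) ((hηs j).continuous_fderiv (by simp)), convolution_def]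
    rw [convolution_eq_swap]
    have hint : Integrable fun t => η j (x - t) • D t := by
      have := (convolutionExistsAt_iff_integrable_swap).1 (hex x)
      simpa using this
    have hin : inner ℝ (∫ t, (ContinuousLinearMap.lsmul ℝ ℝ (η j (x - t))) (D t)) e
        = ∫ t, inner ℝ (D t) e * η j (x - t) := by
      rw [real_inner_comm, ← integral_inner (by simpa using hint)]
      congr 1; ext t
      simp [inner_smul_right, real_inner_comm, mul_comm]
    rw [hin]
    have : ∫ t, v t * -(fderiv ℝ (η j) (x - t)) e = - ∫ t, v t * (fderiv ℝ (η j) (x - t)) e := by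
      rw [← integral_neg]; congr 1; ext t; ring
    rw [this, neg_inj] at key
    rw [← key]
    congr 1; ext t
    simp [mul_comm]
  have hev : ∀ᶠ j in atTop, tsupport (ψ j) ⊆ Ω := by
    filter_upwards [(tendsto_rOut_bump 𝔼).eventually (gt_mem_nhds hδ)] with j hj
    refine subset_trans ?_ hδΩ
    refine closure_minimal ((support_convolution_subset _).trans ?_) Metric.isClosed_cthickening
    rintro _ ⟨a, ha, b, hb, rfl⟩
    have ha' : a ∈ Metric.ball (0 : 𝔼) (bump 𝔼 j).rOut := by
      rw [← (bump 𝔼 j).support_normed_eq (μ := volume)]; exact ha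
    have hb' : b ∈ tsupport χ := by
      by_contra hb'
      exact hb (by simp [hv, image_eq_zero_of_notMem_tsupport hb'])
    refine Metric.mem_cthickening_of_dist_le _ b _ _ hb' ?_
    simpa [dist_eq_norm] using (mem_ball_zero_iff.1 ha').le.trans hj.le
  -- Only for small radii do the mollified supports stay inside Ω, so the first N terms are dropped.
  obtain ⟨N, hN⟩ := eventually_atTop.1 hev
  have hvc : HasCompactSupport v := hχc.mul_right
  refine ⟨fun j => ψ (j + N), fun j => ⟨(hηc _).contDiff_convolution_left _ (hηs _) hvl,
    HasCompactSupport.convolution _ (hηc _) hvc, hN _ (by omega)⟩, ?_, ?_⟩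
  · exact (tendsto_eLpNorm_convolution_bump_sub hq hq' hu).comp (tendsto_add_atTop_nat N)
  · simp only [hgrad]
    exact (tendsto_eLpNorm_convolution_bump_sub hq hq' hDu).comp (tendsto_add_atTop_nat N)

end WeakGradient

/-! ### Convergence in L^q -/

section Convergence

variable {α : Type*} [MeasurableSpace α] {μ : Measure α}
  {F : Type*} [NormedAddCommGroup F]

/-- Convergence in `L^q` yields an almost everywhere convergent subsequence. -/
theorem exists_subseq_tendsto_ae {q : ℝ≥0∞} (hq : q ≠ 0) {f : ℕ → α → F} {g : α → F}
    (hf : ∀ j, AEStronglyMeasurable (f j) μ) (hg : AEStronglyMeasurable g μ)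
    (h : Tendsto (fun j => eLpNorm (fun x => f j x - g x) q μ) atTop (𝓝 0)) :
    ∃ ns : ℕ → ℕ, StrictMono ns ∧ ∀ᵐ x ∂μ, Tendsto (fun i => f (ns i) x) atTop (𝓝 (g x)) :=
  (tendstoInMeasure_of_tendsto_eLpNorm hq hf hg h).exists_seq_tendsto_ae

/-- Dominated convergence for bounded multipliers of an `L^q` function. -/
theorem tendsto_eLpNorm_sub_smul [NormedSpace ℝ F] {q : ℝ≥0∞} (hq : q ≠ 0) (hq' : q ≠ ⊤) {L : ℝ}
    {g : ℕ → α → ℝ} {g₀ : α → ℝ} (hg : ∀ j, AEStronglyMeasurable (g j) μ)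
    (hL : ∀ j, ∀ᵐ x ∂μ, |g j x| ≤ L)
    (hlim : ∀ᵐ x ∂μ, Tendsto (fun j => g j x) atTop (𝓝 (g₀ x))) {f : α → F} (hf : MemLp f q μ) :
    Tendsto (fun j => eLpNorm (fun x => (g j x - g₀ x) • f x) q μ) atTop (𝓝 0) := by
  have hqr : 0 < q.toReal := ENNReal.toReal_pos hq hq'
  have hg₀ : AEStronglyMeasurable g₀ μ := aestronglyMeasurable_of_tendsto_ae _ hg hlim
  -- The bound L passes to the limit g₀, so 2L|f| dominates the differences.
  have hbound : ∀ j, ∀ᵐ x ∂μ, ‖(g j x - g₀ x) • f x‖ₑ ≤ ‖(2 * L) • f x‖ₑ := by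
    intro j
    filter_upwards [ae_all_iff.2 hL, hlim] with x hx hlx
    have h0 : |g₀ x| ≤ L := le_of_tendsto hlx.abs (Eventually.of_forall hx)
    rw [enorm_le_iff_norm_le, norm_smul, norm_smul]
    gcongr
    rw [Real.norm_eq_abs]
    exact (abs_sub _ _).trans ((add_le_add (hx j) h0).trans
      ((two_mul L).symm.le.trans (le_abs_self _)))
  have key : Tendsto (fun j => ∫⁻ x, ‖(g j x - g₀ x) • f x‖ₑ ^ q.toReal ∂μ) atTop
      (𝓝 (∫⁻ _, 0 ∂μ)) := by
    refine tendsto_lintegral_of_dominated_convergence'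
      (fun x => ‖(2 * L) • f x‖ₑ ^ q.toReal)
      (fun j => ((((hg j).sub hg₀).smul hf.1).enorm.pow_const _))
      (fun j => (hbound j).mono fun x hx => by dsimp only; gcongr) ?_ ?_
    · exact (lintegral_rpow_enorm_lt_top_of_eLpNorm_lt_top hq hq' (hf.const_smul (2 * L)).2).ne
    · filter_upwards [hlim] with x hx
      have : Tendsto (fun j => ‖(g j x - g₀ x) • f x‖ₑ) atTop (𝓝 0) := by
        have h1 : Tendsto (fun j => (g j x - g₀ x) • f x) atTop (𝓝 ((g₀ x - g₀ x) • f x)) :=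
          (hx.sub_const _).smul_const _
        simpa using h1.enorm
      have h2 := ((ENNReal.continuous_rpow_const (y := q.toReal)).tendsto 0).comp this
      rwa [ENNReal.zero_rpow_of_pos hqr] at h2
  rw [lintegral_zero] at key
  have := ((ENNReal.continuous_rpow_const (y := 1 / q.toReal)).tendsto 0).comp key
  rw [ENNReal.zero_rpow_of_pos (by positivity)] at this
  refine this.congr fun j => ?_
  rw [eLpNorm_eq_lintegral_rpow_enorm_toReal hq hq']
  rfl

/-- `L^q` norms of functions bounded by a multiple of a null sequence tend to zero. -/
theorem tendsto_eLpNorm_of_le_mul {q : ℝ≥0∞} {G : Type*} [NormedAddCommGroup G]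
    {f : ℕ → α → F} {g : ℕ → α → G} {L : ℝ} (h : ∀ j, ∀ᵐ x ∂μ, ‖f j x‖ ≤ L * ‖g j x‖)
    (hg : Tendsto (fun j => eLpNorm (g j) q μ) atTop (𝓝 0)) :
    Tendsto (fun j => eLpNorm (f j) q μ) atTop (𝓝 0) := by
  have := ENNReal.Tendsto.const_mul (a := ENNReal.ofReal L) hg (Or.inr ENNReal.ofReal_ne_top)
  rw [mul_zero] at this
  exact tendsto_of_tendsto_of_tendsto_of_le_of_le tendsto_const_nhds this (fun _ => zero_le)
    fun j => eLpNorm_le_mul_eLpNorm_of_ae_le_mul (h j) q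

theorem tendsto_eLpNorm_add {q : ℝ≥0∞} (hq : 1 ≤ q) {f g : ℕ → α → F}
    (hf : ∀ j, AEStronglyMeasurable (f j) μ) (hg : ∀ j, AEStronglyMeasurable (g j) μ)
    (hf0 : Tendsto (fun j => eLpNorm (f j) q μ) atTop (𝓝 0))
    (hg0 : Tendsto (fun j => eLpNorm (g j) q μ) atTop (𝓝 0)) :
    Tendsto (fun j => eLpNorm (fun x => f j x + g j x) q μ) atTop (𝓝 0) := by
  have := hf0.add hg0
  rw [add_zero] at this
  exact tendsto_of_tendsto_of_tendsto_of_le_of_le tendsto_const_nhds this (fun _ => zero_le)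
    fun j => eLpNorm_add_le (hf j) (hg j) hq

/-- On a finite measure space, convergence in `L^q`, `q ≥ 1`, passes to the integral against a
bounded function. -/
theorem tendsto_integral_mul_of_tendsto_eLpNorm [IsFiniteMeasure μ] {q : ℝ≥0∞} (hq : 1 ≤ q)
    {f : ℕ → α → ℝ} {f₀ : α → ℝ} (hf : ∀ j, MemLp (f j) q μ) (hf₀ : MemLp f₀ q μ)
    (h : Tendsto (fun j => eLpNorm (fun x => f j x - f₀ x) q μ) atTop (𝓝 0))
    {g : α → ℝ} (hg : AEStronglyMeasurable g μ) {C : ℝ} (hC : ∀ x, |g x| ≤ C) :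
    Tendsto (fun j => ∫ x, f j x * g x ∂μ) atTop (𝓝 (∫ x, f₀ x * g x ∂μ)) := by
  have hi : ∀ {f : α → ℝ}, MemLp f q μ → Integrable (fun x => f x * g x) μ := fun hf =>
    (memLp_one_iff_integrable.1 (hf.mono_exponent hq)).mul_bdd hg (ae_of_all _ hC)
  refine tendsto_integral_of_L1' _ (hi hf₀).1 (Eventually.of_forall fun j => hi (hf j)) ?_
  have h1 : Tendsto (fun j => eLpNorm (fun x => f j x - f₀ x) 1 μ) atTop (𝓝 0) := by
    have := ENNReal.Tendsto.mul_const (b := μ Set.univ ^ (1 / (1 : ℝ≥0∞).toReal - 1 / q.toReal)) h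
      (Or.inr (ENNReal.rpow_ne_top_of_nonneg (by
        by_cases hq' : q = ⊤
        · simp [hq']
        · have : 1 ≤ q.toReal := by
            rw [← ENNReal.toReal_one]; exact ENNReal.toReal_mono hq' hq
          simp only [ENNReal.toReal_one, div_one, sub_nonneg, one_div]
          exact inv_le_one_of_one_le₀ this) (measure_ne_top _ _)))
    rw [zero_mul] at this
    exact tendsto_of_tendsto_of_tendsto_of_le_of_le tendsto_const_nhds this (fun _ => zero_le)
      fun j => eLpNorm_le_eLpNorm_mul_rpow_measure_univ hq ((hf j).1.sub hf₀.1)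
  refine tendsto_eLpNorm_of_le_mul (L := C) (fun j => ae_of_all _ fun x => ?_) h1
  simp only [Pi.sub_apply, ← sub_mul, norm_mul, Real.norm_eq_abs]
  rw [mul_comm]
  gcongr
  exact hC x

end Convergence

/-! ### Calculus of weak gradients: uniqueness, sums, chain rule -/

section Calculus

theorem _root_.MeasureTheory.LocallyIntegrableOn.mono_restrict {X F G : Type*} [MeasurableSpace X]
    [TopologicalSpace X] [OpensMeasurableSpace X] [NormedAddCommGroup F] [NormedAddCommGroup G]
    {μ : Measure X} {s : Set X} {f : X → F} {g : X → G} (hf : LocallyIntegrableOn f s μ)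
    (hg : AEStronglyMeasurable g (μ.restrict s)) (h : ∀ x, ‖g x‖ ≤ ‖f x‖) :
    LocallyIntegrableOn g s μ := by
  intro x hx
  obtain ⟨t, ht, hft⟩ := hf x hx
  exact ⟨t ∩ s, inter_mem ht self_mem_nhdsWithin,
    Integrable.mono (hft.mono_set Set.inter_subset_left)
      (hg.mono_measure (Measure.restrict_mono Set.inter_subset_right le_rfl)) (ae_of_all _ h)⟩

variable {n : ℕ} {Ω : Set (EuclideanSpace ℝ (Fin n))}

local notation "𝔼" => EuclideanSpace ℝ (Fin n)

theorem HasWeakGradient.integrable_mul_fderiv {u : 𝔼 → ℝ} {Du : 𝔼 → 𝔼}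
    (h : HasWeakGradient Ω u Du) {φ : 𝔼 → ℝ} (hφ : ContDiff ℝ ∞ φ)
    (hφc : HasCompactSupport φ) (hφΩ : tsupport φ ⊆ Ω) (e : 𝔼) :
    Integrable (fun x => u x * fderiv ℝ φ x e) := by
  refine (h.1.integrable_smul_of_tsupport_subset (χ := fun x => fderiv ℝ φ x e)
    ((hφ.continuous_fderiv (by simp)).clm_apply continuous_const) (hφc.fderiv_apply ℝ e)
    ((closure_minimal (fun x hx => ?_) (isClosed_tsupport φ)).trans hφΩ)).congr
    (ae_of_all _ fun x => by simp only [smul_eq_mul]; ring)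
  by_contra h'
  exact hx (by
    change fderiv ℝ φ x e = 0
    rw [← inner_gradient_left, gradient_eq_zero_of_notMem_tsupport h', inner_zero_left])

theorem HasWeakGradient.integrable_inner_mul {u : 𝔼 → ℝ} {Du : 𝔼 → 𝔼}
    (h : HasWeakGradient Ω u Du) {φ : 𝔼 → ℝ} (hφ : Continuous φ)
    (hφc : HasCompactSupport φ) (hφΩ : tsupport φ ⊆ Ω) (e : 𝔼) :
    Integrable (fun x => inner ℝ (Du x) e * φ x) := by
  refine ((h.2.1.integrable_smul_of_tsupport_subset hφ hφc hφΩ).inner_const (𝕜 := ℝ) e).congr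
    (ae_of_all _ fun x => ?_)
  simp only [inner_smul_left]; simp; ring

/-- Weak gradients are unique. -/
theorem HasWeakGradient.ae_eq (hΩ : IsOpen Ω) {u : 𝔼 → ℝ} {D₁ D₂ : 𝔼 → 𝔼}
    (h₁ : HasWeakGradient Ω u D₁) (h₂ : HasWeakGradient Ω u D₂) :
    D₁ =ᵐ[volume.restrict Ω] D₂ := by
  have := hΩ.ae_eq_zero_of_integral_contDiff_smul_eq_zero (μ := volume)
    (f := fun x => D₁ x - D₂ x) (h₁.2.1.sub h₂.2.1) (fun φ hφ hφc hφΩ => ?_)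
  · rw [EventuallyEq, ae_restrict_iff' hΩ.measurableSet]
    filter_upwards [this] with x hx hxΩ using sub_eq_zero.1 (hx hxΩ)
  · have i1 := h₁.2.1.integrable_smul_of_tsupport_subset hφ.continuous hφc hφΩ
    have i2 := h₂.2.1.integrable_smul_of_tsupport_subset hφ.continuous hφc hφΩ
    refine ext_inner_left ℝ fun e => ?_
    have e1 : ∀ {D : 𝔼 → 𝔼}, Integrable (fun x => φ x • D x) →
        inner ℝ e (∫ x, φ x • D x) = ∫ x in Ω, inner ℝ (D x) e * φ x := by
      intro D hD
      rw [← integral_inner hD, setIntegral_eq_integral_of_tsupport_subset hφΩ fun x hx => by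
        simp [image_eq_zero_of_notMem_tsupport hx]]
      congr 1; ext x
      rw [inner_smul_right, real_inner_comm, mul_comm]
    have e0 : ∫ x, φ x • (D₁ x - D₂ x) = ∫ x, (φ x • D₁ x - φ x • D₂ x) := by simp only [smul_sub]
    rw [e0, integral_sub i1 i2, inner_sub_right, e1 i1, e1 i2, inner_zero_right]
    linarith [h₁.2.2 φ hφ hφc hφΩ e, h₂.2.2 φ hφ hφc hφΩ e]

theorem HasWeakGradient.add {u v : 𝔼 → ℝ} {Du Dv : 𝔼 → 𝔼}
    (hu : HasWeakGradient Ω u Du) (hv : HasWeakGradient Ω v Dv) :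
    HasWeakGradient Ω (fun x => u x + v x) (fun x => Du x + Dv x) := by
  refine ⟨hu.1.add hv.1, hu.2.1.add hv.2.1, fun φ hφ hφc hφΩ e => ?_⟩
  simp only [inner_add_left, add_mul]
  rw [integral_add (hu.integrable_mul_fderiv hφ hφc hφΩ e).integrableOn
    (hv.integrable_mul_fderiv hφ hφc hφΩ e).integrableOn,
    integral_add (hu.integrable_inner_mul hφ.continuous hφc hφΩ e).integrableOn
    (hv.integrable_inner_mul hφ.continuous hφc hφΩ e).integrableOn, hu.2.2 φ hφ hφc hφΩ e,
    hv.2.2 φ hφ hφc hφΩ e, neg_add]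

theorem HasWeakGradient.congr_ae {u v : 𝔼 → ℝ} {Du Dv : 𝔼 → 𝔼}
    (hu : HasWeakGradient Ω u Du) (h : u =ᵐ[volume.restrict Ω] v)
    (hD : Du =ᵐ[volume.restrict Ω] Dv) : HasWeakGradient Ω v Dv := by
  refine ⟨hu.1.congr h, hu.2.1.congr hD, fun φ hφ hφc hφΩ e => ?_⟩
  have e1 : ∫ x in Ω, v x * fderiv ℝ φ x e = ∫ x in Ω, u x * fderiv ℝ φ x e :=
    integral_congr_ae (h.mono fun x hx => by simp only [hx])
  have e2 : ∫ x in Ω, inner ℝ (Dv x) e * φ x = ∫ x in Ω, inner ℝ (Du x) e * φ x :=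
    integral_congr_ae (hD.mono fun x hx => by simp only [hx])
  rw [e1, e2, hu.2.2 φ hφ hφc hφΩ e]

/-- `C^1` functions are integrated by parts against test functions. -/
theorem integral_mul_fderiv_of_contDiff {v : 𝔼 → ℝ} (hv : ContDiff ℝ 1 v) {φ : 𝔼 → ℝ}
    (hφ : ContDiff ℝ ∞ φ) (hφc : HasCompactSupport φ) (e : 𝔼) :
    ∫ x, v x * fderiv ℝ φ x e = - ∫ x, fderiv ℝ v x e * φ x := by
  have c1 : Continuous fun x => fderiv ℝ v x e :=
    (hv.continuous_fderiv one_ne_zero).clm_apply continuous_const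
  have c2 : Continuous fun x => fderiv ℝ φ x e :=
    (hφ.continuous_fderiv (by simp)).clm_apply continuous_const
  exact integral_mul_fderiv_eq_neg_fderiv_mul_of_integrable
    ((c1.mul hφ.continuous).integrable_of_hasCompactSupport hφc.mul_left)
    ((hv.continuous.mul c2).integrable_of_hasCompactSupport (hφc.fderiv_apply ℝ e).mul_left)
    ((hv.continuous.mul hφ.continuous).integrable_of_hasCompactSupport hφc.mul_left)
    (fun x _ => hv.differentiable one_ne_zero x) (fun x _ => hφ.differentiable (by simp) x)

theorem hasWeakGradient_of_contDiff {v : 𝔼 → ℝ} (hv : ContDiff ℝ 1 v) :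
    HasWeakGradient Ω v (gradient v) := by
  refine ⟨hv.continuous.locallyIntegrable.locallyIntegrableOn _,
    (continuous_gradient hv).locallyIntegrable.locallyIntegrableOn _, fun φ hφ hφc hφΩ e => ?_⟩
  rw [setIntegral_eq_integral_of_tsupport_subset hφΩ fun x hx => by
      rw [← inner_gradient_left, gradient_eq_zero_of_notMem_tsupport hx, inner_zero_left, mul_zero],
    setIntegral_eq_integral_of_tsupport_subset hφΩ fun x hx => by
      rw [image_eq_zero_of_notMem_tsupport hx, mul_zero]]
  simp only [inner_gradient_left]
  exact integral_mul_fderiv_of_contDiff hv hφ hφc e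

theorem abs_sub_le_of_hasDerivAt {G g : ℝ → ℝ} (hG : ∀ t, HasDerivAt G (g t) t) {L : ℝ}
    (hL : ∀ t, |g t| ≤ L) (s t : ℝ) : |G s - G t| ≤ L * |s - t| :=
  Convex.norm_image_sub_le_of_norm_hasDerivWithin_le (fun x _ => (hG x).hasDerivWithinAt)
    (fun x _ => hL x) convex_univ (Set.mem_univ t) (Set.mem_univ s)

/-- Chain rule for `C^1` functions with bounded derivative. -/
theorem HasWeakGradient.comp (hΩ : IsOpen Ω) {u : 𝔼 → ℝ} {Du : 𝔼 → 𝔼}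
    (h : HasWeakGradient Ω u Du) {G g : ℝ → ℝ} (hG : ∀ t, HasDerivAt G (g t) t)
    (hg : Continuous g) {L : ℝ} (hL : ∀ t, |g t| ≤ L) :
    HasWeakGradient Ω (fun x => G (u x)) (fun x => g (u x) • Du x) := by
  have hL0 : 0 ≤ L := (abs_nonneg _).trans (hL 0)
  have hGc : Continuous G := continuous_iff_continuousAt.2 fun t => (hG t).continuousAt
  have hGd : ContDiff ℝ 1 G := by
    rw [contDiff_one_iff_deriv]
    exact ⟨fun t => (hG t).differentiableAt, by rwa [show deriv G = g from funext fun t => (hG t).deriv]⟩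
  have hus := h.1.aestronglyMeasurable
  have hDus := h.2.1.aestronglyMeasurable
  refine ⟨?_, ?_, fun φ hφ hφc hφΩ e => ?_⟩
  · refine LocallyIntegrableOn.mono_restrict (f := fun x => |G 0| + L * ‖u x‖) ?_
      (hGc.comp_aestronglyMeasurable hus) fun x => ?_
    · exact (locallyIntegrable_const _).locallyIntegrableOn _ |>.add (h.1.norm.smul L)
    · have := abs_sub_le_of_hasDerivAt hG hL (u x) 0
      rw [sub_zero] at this
      rw [Real.norm_eq_abs, Real.norm_eq_abs, Real.norm_eq_abs, abs_of_nonneg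
        (add_nonneg (abs_nonneg _) (mul_nonneg hL0 (abs_nonneg _)))]
      have := abs_sub_abs_le_abs_sub (G (u x)) (G 0)
      linarith
  · refine LocallyIntegrableOn.mono_restrict (f := fun x => L • Du x) (h.2.1.smul L)
      ((hg.comp_aestronglyMeasurable hus).smul hDus) fun x => ?_
    rw [norm_smul, norm_smul]
    gcongr
    exact (hL _).trans (le_abs_self L)
  -- As χ = 1 near the support of φ, the localised pair (v, D) agrees there with (u, Du), and it
  -- suffices to prove the identity for v.
  obtain ⟨χ, hχ, hχc, hχΩ, hχ01, hχ1⟩ := exists_cutoff hΩ hφc hφΩ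
  set v : 𝔼 → ℝ := fun x => χ x * u x with hv
  set D : 𝔼 → 𝔼 := fun x => χ x • Du x + u x • gradient χ x with hD
  have hvi : Integrable v := h.1.integrable_smul_of_tsupport_subset hχ.continuous hχc hχΩ
  have hDi : Integrable D :=
    (h.2.1.integrable_smul_of_tsupport_subset hχ.continuous hχc hχΩ).add
    (h.1.integrable_smul_vector_of_tsupport_subset (continuous_gradient (hχ.of_le (by simp)))
      (hasCompactSupport_gradient hχc) (tsupport_gradient_subset.trans hχΩ))
  obtain ⟨ψ', hψ', hψv', hψD'⟩ := h.exists_smooth_approx hΩ hχ hχc hχΩ le_rfl ENNReal.one_ne_top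
    (memLp_one_iff_integrable.2 hvi) (memLp_one_iff_integrable.2 hDi)
  -- The derivative g is merely continuous, so convergence of g(ψ_j) needs pointwise convergence,
  -- available along a subsequence.
  obtain ⟨ns, hns, hae⟩ := exists_subseq_tendsto_ae one_ne_zero
    (fun j => (hψ' j).1.continuous.aestronglyMeasurable) hvi.1 hψv'
  set ψ := fun j => ψ' (ns j) with hψdef
  have hψ : ∀ j, ContDiff ℝ ∞ (ψ j) := fun j => (hψ' _).1
  have hψv := hψv'.comp hns.tendsto_atTop
  have hψD := hψD'.comp hns.tendsto_atTop
  have hdφ : Continuous fun x => fderiv ℝ φ x e :=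
    (hφ.continuous_fderiv (by simp)).clm_apply continuous_const
  obtain ⟨C₁, hC₁⟩ := hdφ.bounded_above_of_compact_support (hφc.fderiv_apply ℝ e)
  obtain ⟨C₂, hC₂⟩ := hφ.continuous.bounded_above_of_compact_support hφc
  have hC₂0 : 0 ≤ C₂ := (norm_nonneg _).trans (hC₂ 0)
  have hgψ : ∀ j, Continuous (gradient (ψ j)) := fun j => continuous_gradient ((hψ j).of_le (by simp))
  -- the identity for the approximations
  have hid : ∀ j, ∫ x, G (ψ j x) * fderiv ℝ φ x e
      = - ∫ x, g (ψ j x) * inner ℝ (gradient (ψ j) x) e * φ x := by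
    intro j
    refine (integral_mul_fderiv_of_contDiff (hGd.comp ((hψ j).of_le (by simp))) hφ hφc e).trans ?_
    congr 2; ext x
    have := (hG (ψ j x)).comp_hasFDerivAt x ((hψ j).differentiable (by simp) x).hasFDerivAt
    rw [this.fderiv, inner_gradient_left]
    simp
  have i0 : Integrable fun x => G (v x) * fderiv ℝ φ x e := by
    have hb : Integrable fun x => (|G 0| + L * |v x|) * fderiv ℝ φ x e := by
      simp only [add_mul]
      refine ((hdφ.integrable_of_hasCompactSupport (hφc.fderiv_apply ℝ e)).const_mul _).add ?_
      exact ((hvi.norm.const_mul L).mul_bdd hdφ.aestronglyMeasurable (ae_of_all _ hC₁))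
    refine hb.mono ((hGc.comp_aestronglyMeasurable hvi.1).mul hdφ.aestronglyMeasurable)
      (ae_of_all _ fun x => ?_)
    rw [norm_mul, norm_mul]
    gcongr
    have h1 := abs_sub_le_of_hasDerivAt hG hL (v x) 0
    have h2 := abs_sub_abs_le_abs_sub (G (v x)) (G 0)
    rw [sub_zero] at h1
    rw [Real.norm_eq_abs, Real.norm_eq_abs]
    exact (by linarith : |G (v x)| ≤ |G 0| + L * |v x|).trans (le_abs_self _)
  have l1 : Tendsto (fun j => ∫ x, G (ψ j x) * fderiv ℝ φ x e) atTop
      (𝓝 (∫ x, G (v x) * fderiv ℝ φ x e)) := by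
    refine tendsto_integral_of_L1' _ i0.1 (Eventually.of_forall fun j => ?_) ?_
    · exact ((hGc.comp (hψ j).continuous).mul hdφ).integrable_of_hasCompactSupport
        (hφc.fderiv_apply ℝ e).mul_left
    · refine tendsto_eLpNorm_of_le_mul (L := L * C₁) (fun j => ae_of_all _ fun x => ?_) hψv
      simp only [Pi.sub_apply, ← sub_mul, norm_mul, Real.norm_eq_abs]
      have h1 := abs_sub_le_of_hasDerivAt hG hL (ψ j x) (v x)
      calc _ ≤ (L * |ψ j x - v x|) * C₁ := by gcongr; exact hC₁ x
        _ = _ := by simp only [hv, hψdef]; ring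
  have i1 : ∀ {f : 𝔼 → ℝ} {W : 𝔼 → 𝔼}, AEStronglyMeasurable f → Integrable W →
      Integrable fun x => g (f x) * inner ℝ (W x) e * φ x := by
    intro f W hf hW
    refine Integrable.mul_bdd (c := C₂) ?_ hφ.continuous.aestronglyMeasurable (ae_of_all _ hC₂)
    exact (hW.inner_const (𝕜 := ℝ) e).bdd_mul (hg.comp_aestronglyMeasurable hf)
      (ae_of_all _ fun x => hL (f x))
  have l2 : Tendsto (fun j => ∫ x, g (ψ j x) * inner ℝ (gradient (ψ j) x) e * φ x) atTop
      (𝓝 (∫ x, g (v x) * inner ℝ (D x) e * φ x)) := by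
    refine tendsto_integral_of_L1' _ (i1 hvi.1 hDi).1 (Eventually.of_forall fun j => ?_) ?_
    · exact i1 (hψ j).continuous.aestronglyMeasurable ((hgψ j).integrable_of_hasCompactSupport
        (hasCompactSupport_gradient (hψ' _).2.1))
    have m1 : ∀ j, AEStronglyMeasurable (fun x => g (ψ j x)) volume :=
      fun j => (hg.comp (hψ j).continuous).aestronglyMeasurable
    have t1 : Tendsto (fun j => eLpNorm (fun x => (g (ψ j x) * φ x) •
        (gradient (ψ j) x - D x)) 1 volume) atTop (𝓝 0) := by
      refine tendsto_eLpNorm_of_le_mul (L := L * C₂) (fun j => ae_of_all _ fun x => ?_) hψD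
      rw [norm_smul, norm_mul]
      gcongr
      · exact hL _
      · exact hC₂ x
    have t2 : Tendsto (fun j => eLpNorm (fun x => (g (ψ j x) - g (v x)) • (φ x • D x)) 1 volume)
        atTop (𝓝 0) := by
      refine tendsto_eLpNorm_sub_smul one_ne_zero ENNReal.one_ne_top (L := L) m1
        (fun j => ae_of_all _ fun x => hL _) ?_ (memLp_one_iff_integrable.2
          (hDi.bdd_smul C₂ hφ.continuous.aestronglyMeasurable (ae_of_all _ hC₂)))
      filter_upwards [hae] with x hx
      exact (hg.tendsto _).comp hx
    -- Splitting: g(ψ_j)∇ψ_j - g(v)D = g(ψ_j)(∇ψ_j - D) + (g(ψ_j) - g(v))D. The first part tends to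
    -- zero because g is bounded, the second by dominated convergence.
    have t3 := tendsto_eLpNorm_add le_rfl
      (f := fun j x => (g (ψ j x) * φ x) • (gradient (ψ j) x - D x))
      (g := fun j x => (g (ψ j x) - g (v x)) • (φ x • D x))
      (fun j => ((m1 j).mul hφ.continuous.aestronglyMeasurable).smul
        ((hgψ j).aestronglyMeasurable.sub hDi.1))
      (fun j => ((m1 j).sub (hg.comp_aestronglyMeasurable hvi.1)).smul
        (hφ.continuous.aestronglyMeasurable.smul hDi.1)) t1 t2
    refine tendsto_eLpNorm_of_le_mul (L := ‖e‖) (fun j => ae_of_all _ fun x => ?_) t3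
    have : ((fun x => g (ψ j x) * inner ℝ (gradient (ψ j) x) e * φ x)
        - fun x => g (v x) * inner ℝ (D x) e * φ x) x
        = inner ℝ ((g (ψ j x) * φ x) • (gradient (ψ j) x - D x)
          + (g (ψ j x) - g (v x)) • (φ x • D x)) e := by
      simp only [Pi.sub_apply, inner_add_left, inner_smul_left, inner_sub_left]
      simp; ring
    rw [this, mul_comm ‖e‖]
    exact norm_inner_le_norm (𝕜 := ℝ) ((g (ψ j x) * φ x) • (gradient (ψ j) x - D x)
          + (g (ψ j x) - g (v x)) • (φ x • D x)) e
  have key := tendsto_nhds_unique (l1.congr hid) l2.neg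
  rw [setIntegral_eq_integral_of_tsupport_subset hφΩ fun x hx => by
      rw [← inner_gradient_left, gradient_eq_zero_of_notMem_tsupport hx, inner_zero_left, mul_zero],
    setIntegral_eq_integral_of_tsupport_subset hφΩ fun x hx => by
      rw [image_eq_zero_of_notMem_tsupport hx, mul_zero]]
  have hvx : ∀ x ∈ tsupport φ, v x = u x ∧ D x = Du x := by
    intro x hx
    have h1 : χ x = 1 := (hχ1 x hx).eq_of_nhds
    have h2 : gradient χ x = 0 := by
      rw [← norm_eq_zero, norm_gradient_eq_norm_fderiv, (hχ1 x hx).fderiv_eq]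
      simp
    simp [hv, hD, h1, h2]
  convert key using 2
  · ext x
    by_cases hx : x ∈ tsupport φ
    · rw [(hvx x hx).1]
    · rw [← inner_gradient_left, gradient_eq_zero_of_notMem_tsupport hx, inner_zero_left, mul_zero,
        mul_zero]
  · congr 1; ext x
    by_cases hx : x ∈ tsupport φ
    · rw [(hvx x hx).1, (hvx x hx).2, inner_smul_left]; simp
    · rw [image_eq_zero_of_notMem_tsupport hx, mul_zero, mul_zero]

end Calculus

theorem memLp_comp_of_hasDerivAt {α : Type*} [MeasurableSpace α] {μ : Measure α}
    [IsFiniteMeasure μ] {q : ℝ≥0∞} {G g : ℝ → ℝ} (hG : ∀ t, HasDerivAt G (g t) t) {L : ℝ}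
    (hL : ∀ t, |g t| ≤ L) {v : α → ℝ} (hv : MemLp v q μ) : MemLp (fun x => G (v x)) q μ := by
  have hGc : Continuous G := continuous_iff_continuousAt.2 fun t => (hG t).continuousAt
  have h0 : MemLp (fun _ : α => |G 0|) q μ := memLp_const _
  have hb : MemLp (fun x => |G 0| + L * |v x|) q μ := h0.add (hv.norm.const_mul L)
  refine hb.of_le (hGc.comp_aestronglyMeasurable hv.1) (ae_of_all _ fun x => ?_)
  have h1 := abs_sub_le_of_hasDerivAt hG hL (v x) 0
  have h2 := abs_sub_abs_le_abs_sub (G (v x)) (G 0)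
  rw [sub_zero] at h1
  rw [Real.norm_eq_abs, Real.norm_eq_abs]
  exact (by linarith : |G (v x)| ≤ |G 0| + L * |v x|).trans (le_abs_self _)

theorem memLp_bounded_smul {α F : Type*} [MeasurableSpace α] [NormedAddCommGroup F]
    [NormedSpace ℝ F] {μ : Measure α} {q : ℝ≥0∞} {g : α → ℝ} (hg : AEStronglyMeasurable g μ)
    {L : ℝ} (hL : ∀ x, |g x| ≤ L) {D : α → F} (hD : MemLp D q μ) :
    MemLp (fun x => g x • D x) q μ := by
  refine hD.of_le_mul (c := L) (hg.smul hD.1) (ae_of_all _ fun x => ?_)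
  rw [norm_smul]
  gcongr
  exact hL x

/-! ### Closedness of W_0^{1,p} and truncation at a level -/

section Truncation

variable {n : ℕ} {Ω : Set (EuclideanSpace ℝ (Fin n))}

local notation "𝔼" => EuclideanSpace ℝ (Fin n)

theorem isFiniteMeasure_restrict_of_isBounded (hb : Bornology.IsBounded Ω) :
    IsFiniteMeasure (volume.restrict Ω : Measure 𝔼) :=
  ⟨by rw [Measure.restrict_apply_univ]; exact hb.measure_lt_top⟩

/-- The closure of the test functions in `W^{1,p}(Ω)`: weak differentiability of the limit is
automatic. -/
theorem memW1Zero_of_tendsto [IsFiniteMeasure (volume.restrict Ω : Measure 𝔼)] {p : ℝ}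
    (hp : 1 ≤ p) {v : 𝔼 → ℝ} {Dv : 𝔼 → 𝔼}
    (hv : MemLp v (ENNReal.ofReal p) (volume.restrict Ω))
    (hDv : MemLp Dv (ENNReal.ofReal p) (volume.restrict Ω)) {φ : ℕ → 𝔼 → ℝ}
    (hφ : ∀ j, ContDiff ℝ ∞ (φ j) ∧ HasCompactSupport (φ j) ∧ tsupport (φ j) ⊆ Ω)
    (h1 : Tendsto (fun j => eLpNorm (fun x => φ j x - v x) (ENNReal.ofReal p)
      (volume.restrict Ω)) atTop (𝓝 0))
    (h2 : Tendsto (fun j => eLpNorm (fun x => gradient (φ j) x - Dv x) (ENNReal.ofReal p)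
      (volume.restrict Ω)) atTop (𝓝 0)) : MemW1Zero Ω p v Dv := by
  have hp' : 1 ≤ ENNReal.ofReal p := by rwa [ENNReal.one_le_ofReal]
  refine ⟨⟨⟨?_, ?_, fun ψ hψ hψc hψΩ e => ?_⟩, hv, hDv⟩, φ, hφ, ?_, ?_⟩
  · exact IntegrableOn.locallyIntegrableOn (memLp_one_iff_integrable.1 (hv.mono_exponent hp'))
  · exact IntegrableOn.locallyIntegrableOn (memLp_one_iff_integrable.1 (hDv.mono_exponent hp'))
  · have hdψ : Continuous fun x => fderiv ℝ ψ x e :=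
      (hψ.continuous_fderiv (by simp)).clm_apply continuous_const
    obtain ⟨C₁, hC₁⟩ := hdψ.bounded_above_of_compact_support (hψc.fderiv_apply ℝ e)
    obtain ⟨C₂, hC₂⟩ := hψ.continuous.bounded_above_of_compact_support hψc
    have hφm : ∀ j, MemLp (φ j) (ENNReal.ofReal p) (volume.restrict Ω) := fun j =>
      ((hφ j).1.continuous.memLp_of_hasCompactSupport (hφ j).2.1).restrict Ω
    have hGc : ∀ j, Continuous (gradient (φ j)) := fun j =>
      continuous_gradient ((hφ j).1.of_le (by simp))
    have hGm : ∀ j, MemLp (gradient (φ j)) (ENNReal.ofReal p) (volume.restrict Ω) := fun j =>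
      ((hGc j).memLp_of_hasCompactSupport (hasCompactSupport_gradient (hφ j).2.1)).restrict Ω
    have l1 := tendsto_integral_mul_of_tendsto_eLpNorm hp' hφm hv h1
      (g := fun x => fderiv ℝ ψ x e) hdψ.aestronglyMeasurable hC₁
    have l2 := tendsto_integral_mul_of_tendsto_eLpNorm hp'
      (f := fun j x => inner ℝ (gradient (φ j) x) e) (f₀ := fun x => inner ℝ (Dv x) e)
      (fun j => (hGm j).inner_const e) (hDv.inner_const e)
      (tendsto_eLpNorm_of_le_mul (L := ‖e‖) (fun j => ae_of_all _ fun x => by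
        rw [← inner_sub_left, mul_comm]; exact norm_inner_le_norm _ _) h2)
      hψ.continuous.aestronglyMeasurable hC₂
    refine tendsto_nhds_unique l1 (l2.neg.congr fun j => ?_)
    exact ((hasWeakGradient_of_contDiff ((hφ j).1.of_le (by simp))).2.2 ψ hψ hψc hψΩ e).symm
  · refine h1.congr fun j => ?_
    exact eLpNorm_sub_comm _ _ _ _
  · refine h2.congr fun j => ?_
    exact eLpNorm_sub_comm _ _ _ _

/-- `W_0^{1,p}(Ω)` is closed in `W^{1,p}(Ω)`. -/
theorem MemW1Zero.of_tendsto [IsFiniteMeasure (volume.restrict Ω : Measure 𝔼)] {p : ℝ}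
    (hp : 1 ≤ p) {v : 𝔼 → ℝ} {Dv : 𝔼 → 𝔼}
    (hv : MemLp v (ENNReal.ofReal p) (volume.restrict Ω))
    (hDv : MemLp Dv (ENNReal.ofReal p) (volume.restrict Ω)) {w : ℕ → 𝔼 → ℝ} {Dw : ℕ → 𝔼 → 𝔼}
    (hw : ∀ j, MemW1Zero Ω p (w j) (Dw j))
    (h1 : Tendsto (fun j => eLpNorm (fun x => w j x - v x) (ENNReal.ofReal p)
      (volume.restrict Ω)) atTop (𝓝 0))
    (h2 : Tendsto (fun j => eLpNorm (fun x => Dw j x - Dv x) (ENNReal.ofReal p)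
      (volume.restrict Ω)) atTop (𝓝 0)) : MemW1Zero Ω p v Dv := by
  have hp' : 1 ≤ ENNReal.ofReal p := by rwa [ENNReal.one_le_ofReal]
  -- Diagonal choice: one test function within 1/(j+1) of w_j, in both function and gradient.
  have hex : ∀ j : ℕ, ∃ φ : 𝔼 → ℝ, (ContDiff ℝ ∞ φ ∧ HasCompactSupport φ ∧ tsupport φ ⊆ Ω) ∧
      eLpNorm (fun x => w j x - φ x) (ENNReal.ofReal p) (volume.restrict Ω)
        ≤ ((j : ℝ≥0∞) + 1)⁻¹ ∧
      eLpNorm (fun x => Dw j x - gradient φ x) (ENNReal.ofReal p) (volume.restrict Ω)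
        ≤ ((j : ℝ≥0∞) + 1)⁻¹ := by
    intro j
    obtain ⟨-, φ, hφ, hφ1, hφ2⟩ := hw j
    have hpos : (0 : ℝ≥0∞) < ((j : ℝ≥0∞) + 1)⁻¹ :=
      ENNReal.inv_pos.2 (ENNReal.add_ne_top.2 ⟨ENNReal.natCast_ne_top j, ENNReal.one_ne_top⟩)
    obtain ⟨i, hi1, hi2⟩ := ((hφ1.eventually (gt_mem_nhds hpos)).and
      (hφ2.eventually (gt_mem_nhds hpos))).exists
    exact ⟨φ i, hφ i, hi1.le, hi2.le⟩
  choose φ hφ hφ1 hφ2 using hex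
  have hz : Tendsto (fun j : ℕ => ((j : ℝ≥0∞) + 1)⁻¹) atTop (𝓝 0) := by
    have := (ENNReal.tendsto_inv_nat_nhds_zero).comp (tendsto_add_atTop_nat 1)
    refine this.congr fun j => ?_
    simp
  have hs : ∀ {a b : ℕ → ℝ≥0∞}, Tendsto a atTop (𝓝 0) → (∀ j, b j ≤ ((j : ℝ≥0∞) + 1)⁻¹ + a j) →
      Tendsto b atTop (𝓝 0) := by
    intro a b ha hb
    have := hz.add ha
    rw [add_zero] at this
    exact tendsto_of_tendsto_of_tendsto_of_le_of_le tendsto_const_nhds this (fun _ => zero_le) hb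
  have hGc : ∀ j, Continuous (gradient (φ j)) := fun j =>
    continuous_gradient ((hφ j).1.of_le (by simp))
  refine memW1Zero_of_tendsto hp hv hDv hφ (hs h1 fun j => ?_) (hs h2 fun j => ?_)
  · rw [show (fun x => φ j x - v x) = (fun x => φ j x - w j x) + (fun x => w j x - v x) by
      ext x; simp]
    refine (eLpNorm_add_le ((hφ j).1.continuous.aestronglyMeasurable.sub (hw j).1.2.1.1)
      ((hw j).1.2.1.1.sub hv.1) hp').trans (add_le_add_left ?_ _)
    exact (eLpNorm_sub_comm _ _ _ _).trans_le (hφ1 j)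
  · rw [show (fun x => gradient (φ j) x - Dv x) = (fun x => gradient (φ j) x - Dw j x)
      + (fun x => Dw j x - Dv x) by ext x; simp]
    refine (eLpNorm_add_le ((hGc j).aestronglyMeasurable.sub (hw j).1.2.2.1)
      ((hw j).1.2.2.1.sub hDv.1) hp').trans (add_le_add_left ?_ _)
    exact (eLpNorm_sub_comm _ _ _ _).trans_le (hφ2 j)

/-- A `W^{1,p}` function vanishing off a compact subset of `Ω` lies in `W_0^{1,p}(Ω)`. -/
theorem HasWeakGradient.memW1Zero_of_isCompact (hΩ : IsOpen Ω)
    [IsFiniteMeasure (volume.restrict Ω : Measure 𝔼)] {p : ℝ} (hp : 1 ≤ p)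
    {v : 𝔼 → ℝ} {Dv : 𝔼 → 𝔼} (h : HasWeakGradient Ω v Dv)
    (hv : MemLp v (ENNReal.ofReal p) (volume.restrict Ω))
    (hDv : MemLp Dv (ENNReal.ofReal p) (volume.restrict Ω)) {K : Set 𝔼} (hK : IsCompact K)
    (hKΩ : K ⊆ Ω) (h0 : ∀ᵐ x ∂(volume.restrict Ω), x ∉ K → v x = 0 ∧ Dv x = 0) :
    MemW1Zero Ω p v Dv := by
  have hp' : 1 ≤ ENNReal.ofReal p := by rwa [ENNReal.one_le_ofReal]
  obtain ⟨χ, hχ, hχc, hχΩ, hχ01, hχ1⟩ := exists_cutoff hΩ hK hKΩ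
  have hae : ∀ᵐ x ∂(volume.restrict Ω), χ x * v x = v x ∧
      χ x • Dv x + v x • gradient χ x = Dv x := by
    filter_upwards [h0] with x hx
    by_cases hxK : x ∈ K
    · have h1 : χ x = 1 := (hχ1 x hxK).eq_of_nhds
      have h2 : gradient χ x = 0 := by
        rw [← norm_eq_zero, norm_gradient_eq_norm_fderiv, (hχ1 x hxK).fderiv_eq]
        simp
      simp [h1, h2]
    · simp [hx hxK]
  have hχ0 : ∀ x, x ∉ Ω → χ x = 0 ∧ gradient χ x = 0 := fun x hx =>
    ⟨image_eq_zero_of_notMem_tsupport fun h' => hx (hχΩ h'),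
      gradient_eq_zero_of_notMem_tsupport fun h' => hx (hχΩ h')⟩
  have m1 : MemLp (fun x => χ x * v x) (ENNReal.ofReal p) := by
    have h1 := (memLp_congr_ae (hae.mono fun x hx => hx.1)).2 hv
    have := (memLp_indicator_iff_restrict hΩ.measurableSet).2 h1
    rwa [Set.indicator_eq_self.2 fun x hx => ?_] at this
    by_contra h'
    exact hx (by simp [(hχ0 x h').1])
  have m2 : MemLp (fun x => χ x • Dv x + v x • gradient χ x) (ENNReal.ofReal p) := by
    have h1 := (memLp_congr_ae (hae.mono fun x hx => hx.2)).2 hDv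
    have := (memLp_indicator_iff_restrict hΩ.measurableSet).2 h1
    rwa [Set.indicator_eq_self.2 fun x hx => ?_] at this
    by_contra h'
    exact hx (by simp [hχ0 x h'])
  obtain ⟨ψ, hψ, hψ1, hψ2⟩ := h.exists_smooth_approx hΩ hχ hχc hχΩ hp' ENNReal.ofReal_ne_top m1 m2
  have hs : ∀ {a b : ℕ → ℝ≥0∞}, Tendsto a atTop (𝓝 0) → (∀ j, b j ≤ a j) →
      Tendsto b atTop (𝓝 0) := fun ha hb =>
    tendsto_of_tendsto_of_tendsto_of_le_of_le tendsto_const_nhds ha (fun _ => zero_le) hb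
  refine memW1Zero_of_tendsto hp hv hDv hψ (hs hψ1 fun j => ?_) (hs hψ2 fun j => ?_)
  · rw [eLpNorm_congr_ae (g := fun x => ψ j x - χ x * v x) (hae.mono fun x hx => by
      simp only [hx.1])]
    exact eLpNorm_mono_measure _ Measure.restrict_le_self
  · rw [eLpNorm_congr_ae (g := fun x => gradient (ψ j) x - (χ x • Dv x + v x • gradient χ x))
      (hae.mono fun x hx => by simp only [hx.2])]
    exact eLpNorm_mono_measure _ Measure.restrict_le_self

/-- If `|u₀| ≤ k` and `w ∈ W_0^{1,p}(Ω)`, then `G(u₀ + w) ∈ W_0^{1,p}(Ω)` for every `C^1` function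
`G` with bounded derivative which vanishes on `[-k, k]`. -/
theorem MemW1Zero.comp_add (hΩ : IsOpen Ω) [IsFiniteMeasure (volume.restrict Ω : Measure 𝔼)]
    {p : ℝ} (hp : 1 ≤ p) {u₀ w : 𝔼 → ℝ} {Du₀ Dw : 𝔼 → 𝔼} {k : ℝ}
    (hu₀ : MemW1 Ω p u₀ Du₀) (hk : ∀ᵐ x ∂(volume.restrict Ω), |u₀ x| ≤ k)
    (hw : MemW1Zero Ω p w Dw) {G g : ℝ → ℝ} (hG : ∀ t, HasDerivAt G (g t) t)
    (hg : Continuous g) {L : ℝ} (hL : ∀ t, |g t| ≤ L) (hG0 : ∀ t, |t| ≤ k → G t = 0 ∧ g t = 0) :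
    MemW1Zero Ω p (fun x => G (u₀ x + w x)) (fun x => g (u₀ x + w x) • (Du₀ x + Dw x)) := by
  have hp' : 1 ≤ ENNReal.ofReal p := by rwa [ENNReal.one_le_ofReal]
  have hp0 : ENNReal.ofReal p ≠ 0 := (one_pos.trans_le hp').ne'
  have hGc : Continuous G := continuous_iff_continuousAt.2 fun t => (hG t).continuousAt
  obtain ⟨hw1, φ', hφ', hφv', hφD'⟩ := hw
  replace hφv' := hφv'.congr fun j => eLpNorm_sub_comm w (φ' j) _ _
  replace hφD' := hφD'.congr fun j => eLpNorm_sub_comm Dw (gradient (φ' j)) _ _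
  obtain ⟨ns, hns, hae⟩ := exists_subseq_tendsto_ae hp0
    (fun j => (hφ' j).1.continuous.aestronglyMeasurable) hw1.2.1.1 hφv'
  set φ := fun j => φ' (ns j) with hφdef
  have hφv := hφv'.comp hns.tendsto_atTop
  have hφD := hφD'.comp hns.tendsto_atTop
  have hφ : ∀ j, ContDiff ℝ ∞ (φ j) := fun j => (hφ' _).1
  have hgφ : ∀ j, Continuous (gradient (φ j)) := fun j => continuous_gradient ((hφ j).of_le (by simp))
  have hφm : ∀ j, MemLp (φ j) (ENNReal.ofReal p) (volume.restrict Ω) := fun j =>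
    ((hφ j).continuous.memLp_of_hasCompactSupport (hφ' _).2.1).restrict Ω
  have hGm : ∀ j, MemLp (gradient (φ j)) (ENNReal.ofReal p) (volume.restrict Ω) := fun j =>
    ((hgφ j).memLp_of_hasCompactSupport (hasCompactSupport_gradient (hφ' _).2.1)).restrict Ω
  have hG1 : ∀ {v : 𝔼 → ℝ}, MemLp v (ENNReal.ofReal p) (volume.restrict Ω) →
      MemLp (fun x => G (v x)) (ENNReal.ofReal p) (volume.restrict Ω) :=
    fun hv => memLp_comp_of_hasDerivAt hG hL hv
  have hg1 : ∀ {v : 𝔼 → ℝ} {D : 𝔼 → 𝔼}, AEStronglyMeasurable v (volume.restrict Ω) →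
      MemLp D (ENNReal.ofReal p) (volume.restrict Ω) →
      MemLp (fun x => g (v x) • D x) (ENNReal.ofReal p) (volume.restrict Ω) :=
    fun hv hD => memLp_bounded_smul (hg.comp_aestronglyMeasurable hv) (fun x => hL _) hD
  have hum : ∀ j, MemLp (fun x => u₀ x + φ j x) (ENNReal.ofReal p) (volume.restrict Ω) :=
    fun j => hu₀.2.1.add (hφm j)
  have hDum : ∀ j, MemLp (fun x => Du₀ x + gradient (φ j) x) (ENNReal.ofReal p)
    (volume.restrict Ω) := fun j => hu₀.2.2.add (hGm j)
  -- Off the support of φ_j the argument is u₀, of absolute value at most k, where G vanishes. Hence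
  -- G(u₀ + φ_j) vanishes almost everywhere off a compact subset of Ω, and no regularity of ∂Ω is
  -- involved.
  have hstep : ∀ j, MemW1Zero Ω p (fun x => G (u₀ x + φ j x))
      (fun x => g (u₀ x + φ j x) • (Du₀ x + gradient (φ j) x)) := by
    intro j
    have h1 := (hu₀.1.add (hasWeakGradient_of_contDiff ((hφ j).of_le (by simp)))).comp hΩ hG hg hL
    refine h1.memW1Zero_of_isCompact hΩ hp (hG1 (hum j)) (hg1 (hum j).1 (hDum j))
      (hφ' (ns j)).2.1 (hφ' (ns j)).2.2 ?_
    filter_upwards [hk] with x hx hxK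
    have : φ j x = 0 := image_eq_zero_of_notMem_tsupport hxK
    rw [this, add_zero, (hG0 _ hx).1, (hG0 _ hx).2, zero_smul]
    exact ⟨rfl, rfl⟩
  have huw : MemLp (fun x => u₀ x + w x) (ENNReal.ofReal p) (volume.restrict Ω) :=
    hu₀.2.1.add hw1.2.1
  have hDuw : MemLp (fun x => Du₀ x + Dw x) (ENNReal.ofReal p) (volume.restrict Ω) :=
    hu₀.2.2.add hw1.2.2
  refine MemW1Zero.of_tendsto hp (hG1 huw) (hg1 huw.1 hDuw) hstep ?_ ?_
  · refine tendsto_eLpNorm_of_le_mul (L := L) (fun j => ae_of_all _ fun x => ?_) hφv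
    refine (abs_sub_le_of_hasDerivAt hG hL _ _).trans_eq ?_
    rw [add_sub_add_left_eq_sub]; rfl
  · have t1 : Tendsto (fun j => eLpNorm (fun x => g (u₀ x + φ j x) • (gradient (φ j) x - Dw x))
        (ENNReal.ofReal p) (volume.restrict Ω)) atTop (𝓝 0) := by
      refine tendsto_eLpNorm_of_le_mul (L := L) (fun j => ae_of_all _ fun x => ?_) hφD
      rw [norm_smul]
      exact mul_le_mul_of_nonneg_right (hL _) (norm_nonneg _)
    have t2 : Tendsto (fun j => eLpNorm (fun x => (g (u₀ x + φ j x) - g (u₀ x + w x)) •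
        (Du₀ x + Dw x)) (ENNReal.ofReal p) (volume.restrict Ω)) atTop (𝓝 0) := by
      refine tendsto_eLpNorm_sub_smul hp0 ENNReal.ofReal_ne_top (L := L)
        (fun j => hg.comp_aestronglyMeasurable (hum j).1) (fun j => ae_of_all _ fun x => hL _)
        ?_ hDuw
      filter_upwards [hae] with x hx
      exact (hg.tendsto _).comp (tendsto_const_nhds.add hx)
    have t3 := tendsto_eLpNorm_add hp'
      (f := fun j x => g (u₀ x + φ j x) • (gradient (φ j) x - Dw x))
      (g := fun j x => (g (u₀ x + φ j x) - g (u₀ x + w x)) • (Du₀ x + Dw x))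
      (fun j => (hg.comp_aestronglyMeasurable (hum j).1).smul ((hGm j).1.sub hw1.2.2.1))
      (fun j => ((hg.comp_aestronglyMeasurable (hum j).1).sub
        (hg.comp_aestronglyMeasurable huw.1)).smul hDuw.1) t1 t2
    refine t3.congr fun j => ?_
    congr 1; ext1 x
    simp only [smul_sub, smul_add, sub_smul]
    abel

/-- The part of `t` exceeding the level `k` in absolute value, with the sign of `t`. -/
def excess (k t : ℝ) : ℝ := Real.sign t * max (|t| - k) 0

/-- Continuous approximations of the indicator function of `{|t| > k}`. -/
def ramp (k : ℝ) (j : ℕ) (t : ℝ) : ℝ := min 1 (max 0 ((j : ℝ) * (|t| - k)))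

theorem continuous_ramp (k : ℝ) (j : ℕ) : Continuous (ramp k j) := by
  unfold ramp; fun_prop

theorem abs_ramp_le (k : ℝ) (j : ℕ) (t : ℝ) : |ramp k j t| ≤ 1 := by
  unfold ramp
  rw [abs_of_nonneg (le_min zero_le_one (le_max_left _ _))]
  exact min_le_left _ _

theorem ramp_eq_zero {k t : ℝ} (j : ℕ) (h : |t| ≤ k) : ramp k j t = 0 := by
  unfold ramp
  rw [max_eq_left (mul_nonpos_of_nonneg_of_nonpos (Nat.cast_nonneg j) (sub_nonpos.2 h))]
  simp

theorem tendsto_ramp (k t : ℝ) :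
    Tendsto (fun j => ramp k j t) atTop (𝓝 (if k < |t| then 1 else 0)) := by
  split_ifs with h
  · obtain ⟨N, hN⟩ := exists_nat_ge (1 / (|t| - k))
    refine tendsto_const_nhds.congr' ?_
    filter_upwards [eventually_ge_atTop N] with j hj
    have h0 : 0 < |t| - k := sub_pos.2 h
    have h1 : 1 ≤ (j : ℝ) * (|t| - k) := by
      rw [← div_le_iff₀ h0]
      exact hN.trans (by exact_mod_cast hj)
    rw [ramp, max_eq_right (by linarith), min_eq_left h1]
  · exact tendsto_const_nhds.congr fun j => (ramp_eq_zero j (not_lt.1 h)).symm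

/-- The indicator function of `{|t| > k}` integrates to `excess k`. -/
theorem integral_indicator_abs_gt {k : ℝ} (hk : 0 ≤ k) (t : ℝ) :
    ∫ s in (0 : ℝ)..t, (if k < |s| then (1 : ℝ) else 0) = excess k t := by
  have hpos : ∀ t, 0 ≤ t → ∫ s in (0 : ℝ)..t, (if k < |s| then (1 : ℝ) else 0) = max (t - k) 0 := by
    intro t ht
    rw [intervalIntegral.integral_of_le ht]
    have : ∀ s ∈ Set.Ioc 0 t, (if k < |s| then (1 : ℝ) else 0) = (Set.Ioi k).indicator 1 s := by
      intro s hs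
      simp [Set.indicator, abs_of_pos hs.1]
    rw [setIntegral_congr_fun measurableSet_Ioc this,
      setIntegral_indicator measurableSet_Ioi, Set.Ioc_inter_Ioi, max_eq_right hk]
    simp
  rcases lt_trichotomy t 0 with ht | rfl | ht
  · have h1 := intervalIntegral.integral_comp_neg (a := 0) (b := t)
      (fun s => if k < |s| then (1 : ℝ) else 0)
    simp only [abs_neg, neg_zero] at h1
    rw [h1, intervalIntegral.integral_symm, hpos (-t) (by linarith), excess, Real.sign_of_neg ht,
      abs_of_neg ht]
    ring
  · simp [excess]
  · rw [hpos t ht.le, excess, Real.sign_of_pos ht, abs_of_pos ht, one_mul]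

theorem abs_excess_le {k : ℝ} (hk : 0 ≤ k) (t : ℝ) : |excess k t| ≤ |t| := by
  rw [excess, abs_mul, abs_of_nonneg (le_max_right (|t| - k) 0)]
  have h1 : |Real.sign t| ≤ 1 := by
    rcases Real.sign_apply_eq t with h | h | h <;> simp [h]
  have h2 : max (|t| - k) 0 ≤ |t| := max_le (by linarith) (abs_nonneg t)
  calc _ ≤ 1 * max (|t| - k) 0 := by gcongr
    _ ≤ |t| := by rwa [one_mul]

theorem tendsto_integral_ramp {k : ℝ} (hk : 0 ≤ k) (t : ℝ) :
    Tendsto (fun j => ∫ s in (0 : ℝ)..t, ramp k j s) atTop (𝓝 (excess k t)) := by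
  rw [← integral_indicator_abs_gt hk]
  refine intervalIntegral.tendsto_integral_filter_of_dominated_convergence (fun _ => 1)
    (Eventually.of_forall fun j => (continuous_ramp k j).aestronglyMeasurable)
    (Eventually.of_forall fun j => ae_of_all _ fun s _ => abs_ramp_le k j s) (by simp)
    (ae_of_all _ fun s _ => tendsto_ramp k s)

theorem abs_integral_ramp_le (k : ℝ) (j : ℕ) (t : ℝ) : |∫ s in (0 : ℝ)..t, ramp k j s| ≤ |t| := by
  have := intervalIntegral.norm_integral_le_of_norm_le_const (a := 0) (b := t) (C := 1)
    (f := ramp k j) fun s _ => abs_ramp_le k j s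
  simpa using this

/-- Excess over a level `k ≥ ‖u₀‖_∞` of a function with boundary values `u₀`. -/
theorem MemW1Zero.excess_add (hΩ : IsOpen Ω) [IsFiniteMeasure (volume.restrict Ω : Measure 𝔼)]
    {p : ℝ} (hp : 1 ≤ p) {u₀ w : 𝔼 → ℝ} {Du₀ Dw : 𝔼 → 𝔼} {k : ℝ} (hk0 : 0 ≤ k)
    (hu₀ : MemW1 Ω p u₀ Du₀) (hk : ∀ᵐ x ∂(volume.restrict Ω), |u₀ x| ≤ k)
    (hw : MemW1Zero Ω p w Dw) :
    MemW1Zero Ω p (fun x => excess k (u₀ x + w x))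
      (fun x => (if k < |u₀ x + w x| then (1 : ℝ) else 0) • (Du₀ x + Dw x)) := by
  have hp' : 1 ≤ ENNReal.ofReal p := by rwa [ENNReal.one_le_ofReal]
  have hp0 : ENNReal.ofReal p ≠ 0 := (one_pos.trans_le hp').ne'
  have huw : MemLp (fun x => u₀ x + w x) (ENNReal.ofReal p) (volume.restrict Ω) :=
    hu₀.2.1.add hw.1.2.1
  have hDuw : MemLp (fun x => Du₀ x + Dw x) (ENNReal.ofReal p) (volume.restrict Ω) :=
    hu₀.2.2.add hw.1.2.2
  -- The excess is not C^1. The primitives of the ramps are, they vanish on [-k, k], and they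
  -- satisfy a Lipschitz bound independent of j.
  have hGd : ∀ j t, HasDerivAt (fun t => ∫ s in (0 : ℝ)..t, ramp k j s) (ramp k j t) t :=
    fun j t => ((continuous_ramp k j).integral_hasStrictDerivAt 0 t).hasDerivAt
  have hGc : ∀ j, Continuous fun t => ∫ s in (0 : ℝ)..t, ramp k j s := fun j =>
    continuous_iff_continuousAt.2 fun t => (hGd j t).continuousAt
  have hstep := fun j => MemW1Zero.comp_add hΩ hp hu₀ hk hw (hGd j) (continuous_ramp k j)
    (abs_ramp_le k j) fun t ht => ⟨by
      rw [intervalIntegral.integral_congr (g := fun _ => 0) fun s hs => ramp_eq_zero j ?_]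
      · simp
      · have := Set.abs_sub_left_of_mem_uIcc hs
        simp only [sub_zero] at this
        exact this.trans ht, ramp_eq_zero j ht⟩
  have hrm : ∀ j, AEStronglyMeasurable (fun x => ramp k j (u₀ x + w x)) (volume.restrict Ω) :=
    fun j => (continuous_ramp k j).comp_aestronglyMeasurable huw.1
  have hGm : ∀ j, AEStronglyMeasurable (fun x => ∫ s in (0 : ℝ)..(u₀ x + w x), ramp k j s)
      (volume.restrict Ω) := fun j => (hGc j).comp_aestronglyMeasurable huw.1
  have hEm : AEStronglyMeasurable (fun x => excess k (u₀ x + w x)) (volume.restrict Ω) :=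
    aestronglyMeasurable_of_tendsto_ae _ hGm
      (ae_of_all _ fun x => tendsto_integral_ramp hk0 (u₀ x + w x))
  have hIm : AEStronglyMeasurable (fun x => if k < |u₀ x + w x| then (1 : ℝ) else 0)
      (volume.restrict Ω) :=
    aestronglyMeasurable_of_tendsto_ae _ hrm (ae_of_all _ fun x => tendsto_ramp k (u₀ x + w x))
  refine MemW1Zero.of_tendsto hp ?_ ?_ hstep ?_ ?_
  · exact huw.of_le hEm (ae_of_all _ fun x => abs_excess_le hk0 _)
  · refine hDuw.of_le (hIm.smul hDuw.1) (ae_of_all _ fun x => ?_)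
    split_ifs <;> simp
  -- Each primitive is written as a multiplier of modulus at most 1 times u₀ + w. Where u₀ + w = 0
  -- the quotient is zero by convention, as are both functions.
  · have := tendsto_eLpNorm_sub_smul hp0 ENNReal.ofReal_ne_top (L := 1) (μ := volume.restrict Ω)
      (g := fun j x => (∫ s in (0 : ℝ)..(u₀ x + w x), ramp k j s) / (u₀ x + w x))
      (g₀ := fun x => excess k (u₀ x + w x) / (u₀ x + w x))
      (fun j => ((hGm j).aemeasurable.div huw.1.aemeasurable).aestronglyMeasurable)
      (fun j => ae_of_all _ fun x => by
        rw [abs_div]; exact div_le_one_of_le₀ (abs_integral_ramp_le _ _ _) (abs_nonneg _))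
      (ae_of_all _ fun x => (tendsto_integral_ramp hk0 _).div_const _) huw
    refine this.congr fun j => ?_
    congr 1; ext1 x
    by_cases h0 : u₀ x + w x = 0
    · simp [h0, excess]
    · rw [smul_eq_mul]; field_simp
  · have := tendsto_eLpNorm_sub_smul hp0 ENNReal.ofReal_ne_top (L := 1) (μ := volume.restrict Ω)
      hrm (fun j => ae_of_all _ fun x => abs_ramp_le k j _)
      (ae_of_all _ fun x => tendsto_ramp k (u₀ x + w x)) hDuw
    refine this.congr fun j => ?_
    congr 1; ext1 x
    rw [sub_smul]

end Truncation

/-! ### The Sobolev exponent exceeds p -/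

section Parameters

variable {n : ℕ} {P : Parameters}

theorem Parameters.Admissible.p_lt_pStar (hP : P.Admissible n) : P.p < P.pStar := by
  rcases lt_or_ge P.p n with h | h
  · have h1 := hP.one_lt_p
    rw [hP.pStar_of_lt h, lt_div_iff₀ (by linarith)]
    nlinarith
  · exact hP.pStar_of_ge h

end Parameters

/-! ### The Sobolev inequality on W_0^{1,p} -/

section Sobolev

variable {n : ℕ} {Ω : Set (EuclideanSpace ℝ (Fin n))} {P : Parameters}

local notation "𝔼" => EuclideanSpace ℝ (Fin n)

/-- An exponent below both `p` and `n` whose Sobolev conjugate is at least `pStar`. -/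
theorem Parameters.Admissible.exists_exponent (hn : 2 ≤ n) (hP : P.Admissible n) :
    ∃ p' : ℝ, 1 ≤ p' ∧ p' < n ∧ p' ≤ P.p ∧ p'⁻¹ - (n : ℝ)⁻¹ ≤ P.pStar⁻¹ := by
  have h1 := hP.one_lt_p
  have h2 := hP.p_lt_pStar
  have hn' : (2 : ℝ) ≤ n := by exact_mod_cast hn
  rcases lt_or_ge P.p n with h | h
  · refine ⟨P.p, h1.le, h, le_rfl, ?_⟩
    rw [hP.pStar_of_lt h]
    have : (n : ℝ) - P.p ≠ 0 := by linarith
    apply le_of_eq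
    field_simp
  · have h3 : 0 < P.pStar := by linarith
    have h4 : n * P.pStar / (n + P.pStar) < n := by
      rw [div_lt_iff₀ (by linarith)]; nlinarith
    -- The number nq/(n+q), q = `pStar`, has Sobolev conjugate exactly q and lies below n ≤ p. The
    -- maximum with 1 keeps it an admissible exponent and can only raise the conjugate.
    refine ⟨max 1 (n * P.pStar / (n + P.pStar)), le_max_left _ _, max_lt (by linarith) h4,
      max_le h1.le (h4.le.trans h), ?_⟩
    have h5 : 0 < n * P.pStar / (n + P.pStar) := by positivity
    have h6 : (max 1 (n * P.pStar / (n + P.pStar)))⁻¹ ≤ (n * P.pStar / (n + P.pStar))⁻¹ :=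
      inv_anti₀ h5 (le_max_right _ _)
    have h7 : (n * P.pStar / (n + P.pStar))⁻¹ = (n : ℝ)⁻¹ + P.pStar⁻¹ := by
      field_simp; ring
    linarith

/-- The Sobolev inequality for test functions. -/
theorem exists_sobolev_const_test (hn : 2 ≤ n) (hΩb : Bornology.IsBounded Ω)
    (hP : P.Admissible n) : ∃ C : ℝ≥0, ∀ φ : 𝔼 → ℝ, ContDiff ℝ ∞ φ → tsupport φ ⊆ Ω →
      eLpNorm φ (ENNReal.ofReal P.pStar) (volume.restrict Ω) ≤
        C * eLpNorm (gradient φ) (ENNReal.ofReal P.p) (volume.restrict Ω) := by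
  have := isFiniteMeasure_restrict_of_isBounded hΩb
  obtain ⟨p', h1, h2, h3, h4⟩ := hP.exists_exponent hn
  have hpp : ENNReal.ofReal p' ≤ ENNReal.ofReal P.p := ENNReal.ofReal_le_ofReal h3
  -- The Hölder constant of the embedding of L^p into L^{p'} on the bounded set Ω.
  set K : ℝ≥0∞ := (volume.restrict Ω : Measure 𝔼) Set.univ ^
    (1 / (ENNReal.ofReal p').toReal - 1 / (ENNReal.ofReal P.p).toReal) with hK
  have hKtop : K ≠ ⊤ := by
    refine ENNReal.rpow_ne_top_of_nonneg ?_ (measure_ne_top _ _)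
    rw [ENNReal.toReal_ofReal (by linarith), ENNReal.toReal_ofReal (by linarith), sub_nonneg]
    exact one_div_le_one_div_of_le (by linarith) h3
  refine ⟨eLpNormLESNormFDerivOfLeConst ℝ (volume : Measure 𝔼) Ω p'.toNNReal P.pStar.toNNReal
    * K.toNNReal, fun φ hφ hφΩ => ?_⟩
  have hps : 0 < P.pStar := by linarith [hP.one_lt_p, hP.p_lt_pStar]
  have hsob := eLpNorm_le_eLpNorm_fderiv_of_le (volume : Measure 𝔼) (u := φ) (s := Ω)
    (p := p'.toNNReal) (q := P.pStar.toNNReal) (hφ.of_le (by simp))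
    ((subset_tsupport φ).trans hφΩ) (by rwa [Real.one_le_toNNReal])
    (by rw [← NNReal.coe_lt_coe, Real.coe_toNNReal _ (by linarith)]; simpa using h2)
    (by
      rw [NNReal.coe_inv, Real.coe_toNNReal p' (by linarith), Real.coe_toNNReal _ hps.le]
      simpa using h4) hΩb
  have hsupp : Function.support (gradient φ) ⊆ Ω :=
    (subset_tsupport _).trans (tsupport_gradient_subset.trans hφΩ)
  have hnorm : eLpNorm (fderiv ℝ φ) (ENNReal.ofReal p') volume
      = eLpNorm (gradient φ) (ENNReal.ofReal p') (volume.restrict Ω) := by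
    rw [eLpNorm_restrict_eq_of_support_subset hsupp]
    exact eLpNorm_congr_norm_ae (ae_of_all _ fun x => (norm_gradient_eq_norm_fderiv x).symm)
  calc eLpNorm φ (ENNReal.ofReal P.pStar) (volume.restrict Ω)
      ≤ eLpNorm φ (ENNReal.ofReal P.pStar) volume := eLpNorm_mono_measure _ Measure.restrict_le_self
    _ ≤ _ := hsob
    _ ≤ _ := by
      change _ * eLpNorm (fderiv ℝ φ) (ENNReal.ofReal p') volume ≤ _
      rw [hnorm, ENNReal.coe_mul, mul_assoc, ENNReal.coe_toNNReal hKtop, mul_comm K]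
      gcongr
      exact eLpNorm_le_eLpNorm_mul_rpow_measure_univ hpp
        (continuous_gradient (hφ.of_le (by simp))).aestronglyMeasurable

/-- The Sobolev inequality on `W_0^{1,p}(Ω)`. -/
theorem exists_sobolev_const (hn : 2 ≤ n) (hΩb : Bornology.IsBounded Ω)
    (hP : P.Admissible n) : ∃ C : ℝ≥0, ∀ (v : 𝔼 → ℝ) (Dv : 𝔼 → 𝔼), MemW1Zero Ω P.p v Dv →
      eLpNorm v (ENNReal.ofReal P.pStar) (volume.restrict Ω) ≤
        C * eLpNorm Dv (ENNReal.ofReal P.p) (volume.restrict Ω) := by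
  obtain ⟨C, hC⟩ := exists_sobolev_const_test hn hΩb hP
  refine ⟨C, fun v Dv ⟨hv, φ', hφ', hφ1', hφ2'⟩ => ?_⟩
  have hp' : 1 ≤ ENNReal.ofReal P.p := by rw [ENNReal.one_le_ofReal]; exact hP.one_lt_p.le
  have hp0 : ENNReal.ofReal P.p ≠ 0 := (one_pos.trans_le hp').ne'
  replace hφ1' := hφ1'.congr fun j => eLpNorm_sub_comm v (φ' j) _ _
  replace hφ2' := hφ2'.congr fun j => eLpNorm_sub_comm Dv (gradient (φ' j)) _ _
  obtain ⟨ns, hns, hae⟩ := exists_subseq_tendsto_ae hp0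
    (fun j => (hφ' j).1.continuous.aestronglyMeasurable) hv.2.1.1 hφ1'
  have hlim := hφ2'.comp hns.tendsto_atTop
  have hgc : ∀ j, Continuous (gradient (φ' j)) := fun j =>
    continuous_gradient ((hφ' j).1.of_le (by simp))
  have hb : ∀ j, eLpNorm (φ' (ns j)) (ENNReal.ofReal P.pStar) (volume.restrict Ω) ≤
      C * (eLpNorm (gradient (φ' (ns j)) - Dv) (ENNReal.ofReal P.p) (volume.restrict Ω)
        + eLpNorm Dv (ENNReal.ofReal P.p) (volume.restrict Ω)) := by
    intro j
    refine (hC _ (hφ' _).1 (hφ' _).2.2).trans ?_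
    gcongr
    have := eLpNorm_add_le (p := ENNReal.ofReal P.p) ((hgc (ns j)).aestronglyMeasurable.sub
      hv.2.2.1) hv.2.2.1 hp'
    rwa [sub_add_cancel] at this
  -- The approximating test functions converge only in L^p; Fatou's lemma along an almost everywhere
  -- convergent subsequence reaches the higher exponent.
  refine (Lp.eLpNorm_lim_le_liminf_eLpNorm
    (fun j => (hφ' (ns j)).1.continuous.aestronglyMeasurable) v hae).trans ?_
  refine (liminf_le_liminf (Eventually.of_forall hb)).trans_eq ?_
  refine Tendsto.liminf_eq ?_
  have := ENNReal.Tendsto.const_mul (a := (C : ℝ≥0∞))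
    (hlim.add_const (eLpNorm Dv (ENNReal.ofReal P.p) (volume.restrict Ω)))
    (Or.inr ENNReal.coe_ne_top)
  rw [zero_add] at this
  exact this

end Sobolev

/-! ### The critical exponent and its subcriticality -/

section Parameters

variable {n : ℕ} {P : Parameters}

/-- The largest of the critical exponents of the lower order terms. -/
def Parameters.critical (P : Parameters) : ℝ :=
  max (1 / (1 - P.α)) (max (P.p / (P.p - P.r + 1)) (max P.θ (max P.s
      (max (P.pStar / P.s₁) (P.pStar / P.s₃ + 1)))))

theorem Parameters.gamma_eq (P : Parameters) :
    P.gamma = (P.pStar - P.p) / (P.pStar - P.critical) := rfl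

namespace Parameters.Admissible

theorem pStar_pos (hP : P.Admissible n) : 0 < P.pStar := by linarith [hP.one_lt_p, hP.p_lt_pStar]

theorem α_lt_one (hP : P.Admissible n) : P.α < 1 := by
  have := hP.α_lt
  have : 0 < 1 / P.pStar := one_div_pos.2 hP.pStar_pos
  linarith

theorem r_sub_div_nonneg (hP : P.Admissible n) : 0 ≤ (P.r - 1) / P.p :=
  div_nonneg (by linarith [hP.one_le_r]) (by linarith [hP.one_lt_p])

theorem r_sub_div_lt (hP : P.Admissible n) : (P.r - 1) / P.p < 1 - 1 / P.pStar := by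
  rw [div_lt_iff₀ (by linarith [hP.one_lt_p])]
  linarith [hP.r_lt]

theorem r_sub_div_lt_one (hP : P.Admissible n) : (P.r - 1) / P.p < 1 := by
  have := hP.r_sub_div_lt
  have : 0 < 1 / P.pStar := one_div_pos.2 hP.pStar_pos
  linarith

/-- By coercivity |ξ|^(r-1) is controlled by f^((r-1)/p), so the gradient term acts like the energy
term with α replaced by (r-1)/p. This identifies the corresponding Young exponent. -/
theorem one_div_one_sub_r (hP : P.Admissible n) : 1 / (1 - (P.r - 1) / P.p) = P.p / (P.p - P.r + 1) := by
  have h1 : P.p ≠ 0 := by linarith [hP.one_lt_p]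
  have h2 := hP.r_sub_div_lt_one
  rw [div_lt_one (by linarith [hP.one_lt_p])] at h2
  have h3 : P.p - P.r + 1 ≠ 0 := by linarith
  have h4 : 1 - (P.r - 1) / P.p = (P.p - P.r + 1) / P.p := by field_simp; ring
  rw [h4, one_div_div]

theorem s_pos (hP : P.Admissible n) {s : ℝ} (hs : P.pStar / (P.pStar - P.p) < s) : 1 < s := by
  refine lt_of_le_of_lt ?_ hs
  rw [le_div_iff₀ (by linarith [hP.p_lt_pStar])]
  linarith [hP.one_lt_p]

/-- The threshold on s, rearranged: it amounts to p/`pStar` < 1 - 1/s, the superlinearity that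
drives the De Giorgi recursion. -/
theorem pStar_div_lt (hP : P.Admissible n) {s : ℝ} (hs : P.pStar / (P.pStar - P.p) < s) :
    P.pStar / s < P.pStar - P.p := by
  have h1 := hP.p_lt_pStar
  rw [div_lt_iff₀ (by linarith)] at hs
  rw [div_lt_iff₀ (by nlinarith [hP.pStar_pos])]
  linarith

/-- Each growth hypothesis says that one entry of the maximum is subcritical: 1/(1-β) < q is the
same as β < 1 - 1/q, used for β = α and β = (r-1)/p. For the last entry, q/s₃ + 1 < q - p + 1 < q
because p > 1. -/
theorem critical_lt (hP : P.Admissible n) : P.critical < P.pStar := by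
  have h0 := hP.pStar_pos
  have key : ∀ {β : ℝ}, β < 1 - 1 / P.pStar → 1 / (1 - β) < P.pStar := by
    intro β hβ
    have h1 : 1 / P.pStar < 1 - β := by linarith
    have h2 := one_div_lt_one_div_of_lt (one_div_pos.2 h0) h1
    rwa [one_div_one_div] at h2
  have h1 := hP.pStar_div_lt hP.s₁_gt
  have h3 := hP.pStar_div_lt hP.s₃_gt
  have := hP.one_lt_p
  refine max_lt (key hP.α_lt) (max_lt ?_ (max_lt hP.θ_lt (max_lt hP.s_lt (max_lt ?_ ?_))))
  · rw [← hP.one_div_one_sub_r]; exact key hP.r_sub_div_lt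
  · linarith
  · linarith

theorem gamma_pos (hP : P.Admissible n) : 0 < P.gamma := by
  rw [P.gamma_eq]
  exact div_pos (by linarith [hP.p_lt_pStar]) (by linarith [hP.critical_lt])

end Parameters.Admissible

theorem Parameters.α_le_critical (P : Parameters) : 1 / (1 - P.α) ≤ P.critical := le_max_left _ _

theorem Parameters.r_le_critical (P : Parameters) : P.p / (P.p - P.r + 1) ≤ P.critical :=
  (le_max_left _ _).trans (le_max_right _ _)

theorem Parameters.θ_le_critical (P : Parameters) : P.θ ≤ P.critical :=
  (le_max_left _ _).trans ((le_max_right _ _).trans (le_max_right _ _))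

theorem Parameters.s_le_critical (P : Parameters) : P.s ≤ P.critical :=
  (le_max_left _ _).trans ((le_max_right _ _).trans ((le_max_right _ _).trans (le_max_right _ _)))

theorem Parameters.s₁_le_critical (P : Parameters) : P.pStar / P.s₁ ≤ P.critical :=
  (le_max_left _ _).trans ((le_max_right _ _).trans ((le_max_right _ _).trans
    ((le_max_right _ _).trans (le_max_right _ _))))

theorem Parameters.s₃_le_critical (P : Parameters) : P.pStar / P.s₃ + 1 ≤ P.critical :=
  (le_max_right _ _).trans ((le_max_right _ _).trans ((le_max_right _ _).trans
    ((le_max_right _ _).trans (le_max_right _ _))))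

end Parameters

/-- Young's inequality in the form needed for absorption. -/
theorem exists_young {β ε : ℝ} (hβ : 0 ≤ β) (hβ1 : β < 1) (hε : 0 < ε) :
    ∃ K : ℝ, 0 ≤ K ∧ ∀ t y : ℝ, 0 ≤ t → 0 ≤ y →
      t ^ β * y ≤ ε * t + K * y ^ (1 / (1 - β)) := by
  have h1 : 0 < 1 - β := by linarith
  refine ⟨ε⁻¹ ^ (β / (1 - β)), by positivity, fun t y ht hy => ?_⟩
  have hK : 0 ≤ ε⁻¹ ^ (β / (1 - β)) * y ^ (1 / (1 - β)) := by positivity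
  -- Either the product is already at most εt, or t^(1-β) < y/ε, which bounds t^β by a power of y.
  rcases le_or_gt y (ε * t ^ (1 - β)) with h | h
  · have : t ^ β * y ≤ ε * t := by
      rcases ht.eq_or_lt with rfl | ht
      · rw [Real.zero_rpow h1.ne', mul_zero] at h
        simp [le_antisymm h hy]
      · calc t ^ β * y ≤ t ^ β * (ε * t ^ (1 - β)) := by gcongr
          _ = ε * (t ^ β * t ^ (1 - β)) := by ring
          _ = ε * t := by rw [← Real.rpow_add ht]; simp
    linarith
  · have hy0 : 0 < y := lt_of_le_of_lt (by positivity) h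
    have h2 : t ^ (1 - β) ≤ ε⁻¹ * y := by
      rw [le_inv_mul_iff₀ hε]; exact h.le
    have h3 : t ^ β ≤ (ε⁻¹ * y) ^ (β / (1 - β)) := by
      calc t ^ β = (t ^ (1 - β)) ^ (β / (1 - β)) := by
            rw [← Real.rpow_mul ht, mul_div_cancel₀ _ h1.ne']
        _ ≤ _ := by gcongr
    have h4 : t ^ β * y ≤ ε⁻¹ ^ (β / (1 - β)) * y ^ (1 / (1 - β)) := by
      calc t ^ β * y ≤ (ε⁻¹ * y) ^ (β / (1 - β)) * y := by gcongr
        _ = ε⁻¹ ^ (β / (1 - β)) * (y ^ (β / (1 - β)) * y ^ (1 : ℝ)) := by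
            rw [Real.mul_rpow (by positivity) hy, Real.rpow_one]; ring
        _ = _ := by
            rw [← Real.rpow_add hy0]
            congr 2
            field_simp; ring
    have : 0 ≤ ε * t := by positivity
    linarith

/-! ### Consequences of the structure of the energy integrand -/

section Structure

variable {n : ℕ} {Ω : Set (EuclideanSpace ℝ (Fin n))} {P : Parameters}

local notation "𝔼" => EuclideanSpace ℝ (Fin n)

/-- Superposition with a Carathéodory map preserves measurability. -/
theorem IsCaratheodory.aestronglyMeasurable {Y : Type*} [TopologicalSpace Y]
    [TopologicalSpace.PseudoMetrizableSpace Y] {g : 𝔼 → ℝ → 𝔼 → Y}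
    (hg : IsCaratheodory Ω g) {u : 𝔼 → ℝ} {ξ : 𝔼 → 𝔼}
    (hu : AEStronglyMeasurable u (volume.restrict Ω))
    (hξ : AEStronglyMeasurable ξ (volume.restrict Ω)) :
    AEStronglyMeasurable (fun x => g x (u x) (ξ x)) (volume.restrict Ω) := by
  have hz := hu.prodMk hξ
  set z := hz.mk _ with hzdef
  have hzm : StronglyMeasurable z := hz.stronglyMeasurable_mk
  -- On each of the finitely many level sets of a simple approximation the arguments of g are
  -- constant; continuity of g(x,·,·) then gives the limit.
  have h1 : AEStronglyMeasurable (fun x => g x (z x).1 (z x).2) (volume.restrict Ω) := by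
    refine aestronglyMeasurable_of_tendsto_ae atTop
      (f := fun j x => g x (hzm.approx j x).1 (hzm.approx j x).2) (fun j => ?_) ?_
    · set s := hzm.approx j
      have hU : (⋃ y : s.range, s ⁻¹' {(y : ℝ × 𝔼)}) = Set.univ := by
        ext x; simp
      rw [← Measure.restrict_univ (μ := volume.restrict Ω), ← hU, aestronglyMeasurable_iUnion_iff]
      rintro ⟨y, hy⟩
      refine (((hg.1 y.1 y.2).restrict (s := s ⁻¹' {y}))).congr ?_
      filter_upwards [ae_restrict_mem (s.measurableSet_preimage {y})] with x hx
      rw [show s x = y from hx]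
    · filter_upwards [hg.2] with x hx
      exact (hx.tendsto _).comp (hzm.tendsto_approx x)
  refine h1.congr ?_
  filter_upwards [hz.ae_eq_mk] with x hx
  rw [hzdef, ← hx]

/-- Differentiable convex functions: the derivative in direction `ξ` lies between difference
quotients. -/
theorem ConvexOn.inner_gradient_bounds {h : 𝔼 → ℝ} (hc : ConvexOn ℝ Set.univ h)
    (hd : Differentiable ℝ h) (ξ : 𝔼) :
    h ξ - h 0 ≤ inner ℝ (gradient h ξ) ξ ∧
      inner ℝ (gradient h ξ) ξ ≤ h ((2 : ℝ) • ξ) - h ξ := by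
  have hl : ConvexOn ℝ Set.univ (fun t : ℝ => h (t • ξ)) := by
    have := hc.comp_linearMap (LinearMap.toSpanSingleton ℝ 𝔼 ξ)
    simpa [Function.comp_def] using this
  have hder : HasDerivAt (fun t : ℝ => h (t • ξ)) (inner ℝ (gradient h ξ) ξ) 1 := by
    rw [inner_gradient_left]
    have h1 : HasDerivAt (fun t : ℝ => t • ξ) ξ 1 := by
      simpa using (hasDerivAt_id (1 : ℝ)).smul_const ξ
    have h2 : HasFDerivAt h (fderiv ℝ h ξ) ((1 : ℝ) • ξ) := by
      rw [one_smul]; exact (hd ξ).hasFDerivAt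
    exact h2.comp_hasDerivAt 1 h1
  have l1 := hl.slope_le_of_hasDerivAt (Set.mem_univ 0) (Set.mem_univ 1) one_pos hder
  have l2 := hl.le_slope_of_hasDerivAt (Set.mem_univ 1) (Set.mem_univ 2) one_lt_two hder
  rw [slope_def_field] at l1 l2
  norm_num at l1 l2
  rw [inner_gradient_left]
  exact ⟨by linarith, l2⟩

/-- Doubling leaves ξ = 0 fixed, so m f ≤ f there with m > 1 and f ≥ 0. Consequently truncated
functions carry no energy where their gradient is cut to zero. -/
theorem IsEnergyIntegrand.apply_zero {f : 𝔼 → ℝ → 𝔼 → ℝ} (hP : P.Admissible n)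
    (hf : IsEnergyIntegrand Ω P f) : ∀ᵐ x ∂(volume.restrict Ω), ∀ u, f x u 0 = 0 := by
  filter_upwards [hf.nonneg, hf.delta_two] with x h1 h2 u
  have h3 := (h2 u 0).1
  rw [smul_zero] at h3
  have := h1 u 0
  have := hP.one_lt_m
  nlinarith

/-- Slopes over [0, ξ] and [ξ, 2ξ] bracket the radial derivative, the value at 0 vanishes, and
doubling controls the outer slope. The lower bound supplies coercivity of a, the upper one
integrability of its pairing with Du. -/
theorem IsEnergyIntegrand.inner_gradient_bounds {f : 𝔼 → ℝ → 𝔼 → ℝ} (hP : P.Admissible n)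
    (hf : IsEnergyIntegrand Ω P f) : ∀ᵐ x ∂(volume.restrict Ω), ∀ u ξ,
      f x u ξ ≤ inner ℝ (gradient (f x u) ξ) ξ ∧
      inner ℝ (gradient (f x u) ξ) ξ ≤ (P.M - 1) * f x u ξ := by
  filter_upwards [hf.apply_zero hP, hf.convex, hf.differentiable, hf.delta_two]
    with x h0 hc hd h2 u ξ
  have := ConvexOn.inner_gradient_bounds (hc u) (hd u) ξ
  have := (h2 u ξ).2
  have := h0 u
  exact ⟨by linarith, by linarith⟩

theorem MemW1Zero.congr_ae {p : ℝ} {v w : 𝔼 → ℝ} {Dv Dw : 𝔼 → 𝔼} (h : MemW1Zero Ω p v Dv)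
    (hv : v =ᵐ[volume.restrict Ω] w) (hD : Dv =ᵐ[volume.restrict Ω] Dw) : MemW1Zero Ω p w Dw := by
  obtain ⟨⟨h1, h2, h3⟩, φ, hφ, l1, l2⟩ := h
  refine ⟨⟨h1.congr_ae hv hD, (memLp_congr_ae hv).1 h2, (memLp_congr_ae hD).1 h3⟩, φ, hφ,
    l1.congr fun j => ?_, l2.congr fun j => ?_⟩
  · exact eLpNorm_congr_ae (hv.mono fun x hx => by simp only [hx])
  · exact eLpNorm_congr_ae (hD.mono fun x hx => by simp only [hx])

theorem memLp_of_integrable_rpow {α F : Type*} [MeasurableSpace α] {μ : Measure α}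
    [NormedAddCommGroup F] {p : ℝ} (hp : 0 < p) {D : α → F} (hD : AEStronglyMeasurable D μ)
    (h : Integrable (fun x => ‖D x‖ ^ p) μ) : MemLp D (ENNReal.ofReal p) μ := by
  rw [← integrable_norm_rpow_iff hD (by simpa using hp) ENNReal.ofReal_ne_top,
    ENNReal.toReal_ofReal hp.le]
  exact h

/-- Functions of finite energy have gradient in `L^p`. -/
theorem MemW1F.memLp_gradient {f : 𝔼 → ℝ → 𝔼 → ℝ} (hP : P.Admissible n)
    (hf : IsEnergyIntegrand Ω P f) {u : 𝔼 → ℝ} {Du : 𝔼 → 𝔼} (h : MemW1F Ω f u Du) :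
    MemLp Du (ENNReal.ofReal P.p) (volume.restrict Ω) := by
  have hp : 0 < P.p := by linarith [hP.one_lt_p]
  have hm : AEStronglyMeasurable Du (volume.restrict Ω) := h.1.2.2.1
  refine memLp_of_integrable_rpow hp hm ((h.2.const_mul P.c₅⁻¹).mono
    ((Real.continuous_rpow_const hp.le).comp_aestronglyMeasurable hm.norm) ?_)
  filter_upwards [hf.coercive] with x hx
  have h1 := hx (u x) (Du x)
  rw [Real.norm_of_nonneg (by positivity)]
  refine le_trans ?_ (le_abs_self _)
  rwa [le_inv_mul_iff₀ hP.c₅_pos]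

/-- The excess over a level is an admissible test function. -/
theorem memW1FZero_excess (hΩ : IsOpen Ω) (hΩb : Bornology.IsBounded Ω) (hP : P.Admissible n)
    {f : 𝔼 → ℝ → 𝔼 → ℝ} (hf : IsEnergyIntegrand Ω P f) {u₀ u : 𝔼 → ℝ} {Du₀ Du Dw : 𝔼 → 𝔼}
    (hu₀ : MemLp u₀ ⊤ (volume.restrict Ω)) (hDu₀ : MemW1F Ω f u₀ Du₀) (hu : MemW1F Ω f u Du)
    (hw : MemW1Zero Ω P.p (fun x => u x - u₀ x) Dw) {k : ℝ} (hk0 : 0 ≤ k)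
    (hk : ∀ᵐ x ∂(volume.restrict Ω), |u₀ x| ≤ k) :
    MemW1FZero Ω P.p f (fun x => excess k (u x))
      (fun x => (if k < |u x| then (1 : ℝ) else 0) • Du x) := by
  have := isFiniteMeasure_restrict_of_isBounded hΩb
  have hp := hP.one_lt_p.le
  have hp' : 1 ≤ ENNReal.ofReal P.p := by rwa [ENNReal.one_le_ofReal]
  have hu₀p : MemW1 Ω P.p u₀ Du₀ :=
    ⟨hDu₀.1.1, hu₀.mono_exponent le_top, hDu₀.memLp_gradient hP hf⟩
  -- The three gradients come from separate existence statements; uniqueness of weak gradients links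
  -- them.
  have hadd : Du =ᵐ[volume.restrict Ω] fun x => Du₀ x + Dw x := by
    refine hu.1.1.ae_eq hΩ ?_
    refine (hDu₀.1.1.add hw.1.1).congr_ae (ae_of_all _ fun x => ?_) (ae_of_all _ fun x => rfl)
    simp
  have h1 : MemW1Zero Ω P.p (fun x => excess k (u x))
      (fun x => (if k < |u x| then (1 : ℝ) else 0) • Du x) := by
    refine (MemW1Zero.excess_add hΩ hp hk0 hu₀p hk hw).congr_ae (ae_of_all _ fun x => by simp) ?_
    filter_upwards [hadd] with x hx
    simp [hx]
  refine ⟨⟨⟨h1.1.1, ?_, ?_⟩, ?_⟩, h1⟩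
  · rw [ENNReal.ofReal_one]; exact h1.1.2.1.mono_exponent hp'
  · rw [ENNReal.ofReal_one]; exact h1.1.2.2.mono_exponent hp'
  · refine (hu.2.const_mul P.c₆).mono
      (hf.caratheodory.aestronglyMeasurable h1.1.2.1.1 h1.1.2.2.1) ?_
    filter_upwards [hf.nonneg, hf.u_dependence, hf.apply_zero hP] with x h2 h3 h4
    have h5 := mul_nonneg hP.c₆_pos.le (h2 (u x) (Du x))
    rw [Real.norm_of_nonneg (h2 _ _), Real.norm_of_nonneg h5]
    split_ifs
    · rw [one_smul]
      exact h3 _ _ _ (abs_excess_le hk0 _)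
    · rw [zero_smul, h4]
      exact h5

end Structure

/-! ### Absorption of the lower order terms -/

section Pointwise

variable {n : ℕ} {P : Parameters}

theorem rpow_le_one_add_rpow {y e q : ℝ} (hy : 0 ≤ y) (he : 0 ≤ e) (heq : e ≤ q) :
    y ^ e ≤ 1 + y ^ q := by
  rcases le_total y 1 with h | h
  · have := Real.rpow_le_one hy h he
    have : 0 ≤ y ^ q := by positivity
    linarith
  · have := Real.rpow_le_rpow_of_exponent_le h heq
    linarith

/-- Absorption of the energy and gradient terms of the source into the energy. -/
theorem Parameters.Admissible.exists_absorption (hP : P.Admissible n) {ε : ℝ} (hε : 0 < ε) :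
    ∃ K : ℝ, 0 ≤ K ∧ ∀ F d y : ℝ, 0 ≤ F → 0 ≤ d → 0 ≤ y → P.c₅ * d ^ P.p ≤ F →
      (F ^ P.α + d ^ (P.r - 1)) * y ≤
        ε * F + K * (y ^ (1 / (1 - P.α)) + y ^ (P.p / (P.p - P.r + 1))) := by
  have hp : 0 < P.p := by linarith [hP.one_lt_p]
  have hc := hP.c₅_pos
  have hr := hP.r_sub_div_nonneg
  obtain ⟨K₁, hK₁, h₁⟩ := exists_young hP.α_nonneg hP.α_lt_one (half_pos hε)
  obtain ⟨K₂, hK₂, h₂⟩ := exists_young hr hP.r_sub_div_lt_one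
    -- The weight contains c₅^((r-1)/p), the factor lost when |ξ|^(r-1) is replaced by f^((r-1)/p);
    -- dividing it out leaves ε/2.
    (mul_pos (half_pos hε) (Real.rpow_pos_of_pos hc ((P.r - 1) / P.p)))
  rw [hP.one_div_one_sub_r] at h₂
  set κ := P.c₅ ^ ((P.r - 1) / P.p) with hκ
  have hκ0 : 0 < κ := Real.rpow_pos_of_pos hc _
  refine ⟨max K₁ (κ⁻¹ * K₂), le_max_of_le_left hK₁, fun F d y hF hd hy hdF => ?_⟩
  have e1 : κ * d ^ (P.r - 1) ≤ F ^ ((P.r - 1) / P.p) := by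
    calc κ * d ^ (P.r - 1) = (P.c₅ * d ^ P.p) ^ ((P.r - 1) / P.p) := by
          rw [Real.mul_rpow hc.le (by positivity), ← Real.rpow_mul hd, mul_div_cancel₀ _ hp.ne']
      _ ≤ _ := by gcongr
  have e2 : d ^ (P.r - 1) * y ≤ ε / 2 * F + κ⁻¹ * K₂ * y ^ (P.p / (P.p - P.r + 1)) := by
    have e3 := h₂ F y hF hy
    have e4 : κ * (d ^ (P.r - 1) * y) ≤ F ^ ((P.r - 1) / P.p) * y := by
      rw [← mul_assoc]; gcongr
    have e5 := e4.trans e3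
    rw [← le_inv_mul_iff₀ hκ0] at e5
    refine e5.trans_eq ?_
    field_simp
  have m1 := le_max_left K₁ (κ⁻¹ * K₂)
  have m2 := le_max_right K₁ (κ⁻¹ * K₂)
  have y1 : 0 ≤ y ^ (1 / (1 - P.α)) := by positivity
  have y2 : 0 ≤ y ^ (P.p / (P.p - P.r + 1)) := by positivity
  have := mul_le_mul_of_nonneg_right m1 y1
  have := mul_le_mul_of_nonneg_right m2 y2
  have := h₁ F y hF hy
  rw [add_mul, mul_add]
  linarith

theorem Parameters.Admissible.exponents_nonneg (hP : P.Admissible n) :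
    0 ≤ 1 / (1 - P.α) ∧ 0 ≤ P.p / (P.p - P.r + 1) := by
  refine ⟨one_div_nonneg.2 (by linarith [hP.α_lt_one]), ?_⟩
  rw [← hP.one_div_one_sub_r]
  exact one_div_nonneg.2 (by linarith [hP.r_sub_div_lt_one])

/-- The constant in the growth conditions for `b`. -/
def Parameters.growthConst (P : Parameters) : ℝ := max P.c₇ P.c₉

/-- Pointwise bound of the lower order terms by integrable quantities. -/
theorem Parameters.Admissible.exists_source_bound (hP : P.Admissible n) :
    ∃ K : ℝ, 0 ≤ K ∧ ∀ F d y : ℝ, 0 ≤ F → 0 ≤ d → 0 ≤ y → P.c₅ * d ^ P.p ≤ F →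
      P.growthConst * (F ^ P.α + d ^ (P.r - 1) + y ^ (P.s - 1)) * y ≤
        K * (F + 1 + y ^ P.pStar) := by
  obtain ⟨K, hK, h⟩ := hP.exists_absorption one_pos
  have hg : 0 ≤ P.growthConst := le_max_of_le_left hP.c₇_pos.le
  refine ⟨P.growthConst * (2 * K + 1), by positivity, fun F d y hF hd hy hdF => ?_⟩
  have h1 := h F d y hF hd hy hdF
  have h2 := rpow_le_one_add_rpow hy hP.exponents_nonneg.1
    (P.α_le_critical.trans hP.critical_lt.le)
  have h3 := rpow_le_one_add_rpow hy hP.exponents_nonneg.2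
    (P.r_le_critical.trans hP.critical_lt.le)
  have h4 : y ^ (P.s - 1) * y ≤ 1 + y ^ P.pStar := by
    rcases hy.eq_or_lt with rfl | hy
    · rw [mul_zero]
      have : (0 : ℝ) ≤ 0 ^ P.pStar := by positivity
      linarith
    · rw [← Real.rpow_add_one hy.ne', sub_add_cancel]
      exact rpow_le_one_add_rpow hy.le (by linarith [hP.one_le_s]) hP.s_lt.le
  rw [mul_assoc, mul_assoc]
  refine mul_le_mul_of_nonneg_left ?_ hg
  have hY : 0 ≤ y ^ P.pStar := by positivity
  have h5 := mul_le_mul_of_nonneg_left (add_le_add h2 h3) hK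
  rw [add_mul]
  nlinarith [mul_nonneg hK hF]

/-- The pointwise inequality behind the energy estimate on super-level sets. -/
theorem Parameters.Admissible.exists_pointwise_bound (hP : P.Admissible n) :
    ∃ K₁ K₂ : ℝ, 0 ≤ K₁ ∧ 0 ≤ K₂ ∧ ∀ F d y z A S β₁ β₃ : ℝ, 0 ≤ F → 0 ≤ d → 1 ≤ y → 0 ≤ z →
      z ≤ y → 0 ≤ β₁ → 0 ≤ β₃ → P.c₅ * d ^ P.p ≤ F →
      P.c₁ * F - P.c₂ * y ^ P.θ - β₁ ≤ A →
      -(P.growthConst * (F ^ P.α + d ^ (P.r - 1) + y ^ (P.s - 1))) - β₃ ≤ S →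
      d ^ P.p ≤ K₁ * (A + S * z) + K₂ * (y ^ P.critical + β₁ + β₃ * y) := by
  have hc₁ := hP.c₁_pos
  have hc₅ := hP.c₅_pos
  have hc₂ := hP.c₂_nonneg
  have hg : 0 < P.growthConst := lt_max_of_lt_left hP.c₇_pos
  -- After multiplication by the growth constant this ε uses up exactly half of c₁F.
  obtain ⟨K, hK, h⟩ := hP.exists_absorption (ε := P.c₁ / (2 * P.growthConst)) (by positivity)
  set g := P.growthConst
  -- The summands account for β₁ and β₃y, the θ-term, the two Young powers (2K) and the s-term. Each
  -- power is dominated by y^`critical` because y ≥ 1.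
  set K' := 1 + P.c₂ + g * (2 * K + 1) with hK'
  have hK'1 : 1 ≤ K' := by
    have : 0 ≤ g * (2 * K + 1) := by positivity
    linarith
  refine ⟨2 / (P.c₁ * P.c₅), 2 / (P.c₁ * P.c₅) * K', by positivity, by positivity, ?_⟩
  intro F d y z A S β₁ β₃ hF hd hy hz hzy hβ₁ hβ₃ hdF hA hS
  have hy0 : 0 < y := by linarith
  have y1 := Real.rpow_le_rpow_of_exponent_le hy P.α_le_critical
  have y2 := Real.rpow_le_rpow_of_exponent_le hy P.r_le_critical
  have y3 := Real.rpow_le_rpow_of_exponent_le hy P.θ_le_critical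
  have y4 : y ^ (P.s - 1) * y ≤ y ^ P.critical := by
    rw [← Real.rpow_add_one hy0.ne', sub_add_cancel]
    exact Real.rpow_le_rpow_of_exponent_le hy P.s_le_critical
  set Y := y ^ P.critical
  have hY : 0 ≤ Y := by positivity
  have e1 := h F d y hF hd hy0.le hdF
  have e2 : g * ((F ^ P.α + d ^ (P.r - 1)) * y) ≤ P.c₁ / 2 * F + g * (2 * K) * Y := by
    calc _ ≤ g * (P.c₁ / (2 * g) * F + K * (Y + Y)) := by
          gcongr
          exact e1.trans (by gcongr)
      _ = _ := by field_simp; ring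
  have e3 : g * (y ^ (P.s - 1) * y) ≤ g * Y := by gcongr
  set T := g * (F ^ P.α + d ^ (P.r - 1) + y ^ (P.s - 1)) + β₃ with hT
  have hT0 : 0 ≤ T := by positivity
  -- A one-sided bound on S suffices because 0 ≤ z ≤ y.
  have e4 : -(T * y) ≤ S * z := by
    have : -T * z ≤ S * z := mul_le_mul_of_nonneg_right (by linarith) hz
    nlinarith
  have e5 : T * y = g * ((F ^ P.α + d ^ (P.r - 1)) * y) + g * (y ^ (P.s - 1) * y) + β₃ * y := by
    rw [hT]; ring
  have e6 : P.c₂ * y ^ P.θ ≤ P.c₂ * Y := by gcongr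
  have hβy : 0 ≤ β₃ * y := by positivity
  have e7 : P.c₁ / 2 * F ≤ A + S * z + K' * (Y + β₁ + β₃ * y) := by
    have f1 : K' * (Y + β₁ + β₃ * y) = Y + P.c₂ * Y + g * (2 * K) * Y + g * Y
        + K' * (β₁ + β₃ * y) := by rw [hK']; ring
    have f2 : β₁ + β₃ * y ≤ K' * (β₁ + β₃ * y) := le_mul_of_one_le_left (by positivity) hK'1
    linarith
  calc d ^ P.p ≤ P.c₅⁻¹ * F := by rwa [le_inv_mul_iff₀ hc₅]
    _ = 2 / (P.c₁ * P.c₅) * (P.c₁ / 2 * F) := by field_simp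
    _ ≤ 2 / (P.c₁ * P.c₅) * (A + S * z + K' * (Y + β₁ + β₃ * y)) := by gcongr
    _ = _ := by ring

end Pointwise

/-! ### Integrability of powers on a finite measure space -/

section Integrability

variable {α : Type*} [MeasurableSpace α] {μ : Measure α} [IsFiniteMeasure μ]

theorem integrable_abs_rpow {u : α → ℝ} {q e : ℝ} (he : 0 ≤ e) (heq : e ≤ q) (hq : 0 < q)
    (hu : MemLp u (ENNReal.ofReal q) μ) : Integrable (fun x => |u x| ^ e) μ := by
  have h1 : Integrable (fun x => |u x| ^ q) μ := by
    have := hu.integrable_norm_rpow (by simpa using hq) ENNReal.ofReal_ne_top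
    rwa [ENNReal.toReal_ofReal hq.le] at this
  refine ((integrable_const (1 : ℝ)).add h1).mono
    ((Real.continuous_rpow_const he).comp_aestronglyMeasurable hu.1.norm) (ae_of_all _ fun x => ?_)
  rw [Real.norm_of_nonneg (by positivity)]
  exact (rpow_le_one_add_rpow (abs_nonneg _) he heq).trans (le_abs_self _)

theorem memLp_abs_rpow {u : α → ℝ} {q τ e : ℝ} (hτ : 0 ≤ τ) (he : 0 < e) (heq : τ * e ≤ q)
    (hq : 0 < q) (hu : MemLp u (ENNReal.ofReal q) μ) :
    MemLp (fun x => |u x| ^ τ) (ENNReal.ofReal e) μ := by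
  refine memLp_of_integrable_rpow he
    ((Real.continuous_rpow_const hτ).comp_aestronglyMeasurable hu.1.norm) ?_
  refine (integrable_abs_rpow (by positivity) heq hq hu).congr (ae_of_all _ fun x => ?_)
  dsimp only
  rw [Real.norm_of_nonneg (by positivity), Real.rpow_mul (abs_nonneg _)]

theorem integrable_mul_abs_rpow {u β : α → ℝ} {q τ s s' : ℝ} (hs : s.HolderConjugate s')
    (hτ : 0 ≤ τ) (hτq : τ * s' ≤ q) (hq : 0 < q) (hu : MemLp u (ENNReal.ofReal q) μ)
    (hβ : MemLp β (ENNReal.ofReal s) μ) : Integrable (fun x => β x * |u x| ^ τ) μ := by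
  have := hs.ennrealOfReal
  exact hβ.integrable_mul (memLp_abs_rpow hτ hs.symm.pos hτq hq hu)

end Integrability

/-! ### Testing with the excess: the energy estimate -/

section Energy

variable {n : ℕ} {Ω : Set (EuclideanSpace ℝ (Fin n))} {P : Parameters}

local notation "𝔼" => EuclideanSpace ℝ (Fin n)

/-- Both growth conditions for `b` yield the same lower bound, and an upper bound for `u b` by
integrable quantities. -/
theorem exists_growth_bounds (hP : P.Admissible n) {f b : 𝔼 → ℝ → 𝔼 → ℝ}
    (hf : IsEnergyIntegrand Ω P f)
    (h : UnilateralGrowth Ω P f b ∨ AbsoluteGrowth Ω P f b) :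
    ∃ b₃ b₄ : 𝔼 → ℝ, (∀ᵐ x ∂(volume.restrict Ω), 0 ≤ b₃ x ∧ 0 ≤ b₄ x) ∧
      MemLp b₃ (ENNReal.ofReal P.s₃) (volume.restrict Ω) ∧
      (eLpNorm b₃ (ENNReal.ofReal P.s₃) (volume.restrict Ω)).toReal ≤ P.B₃ ∧
      IntegrableOn b₄ Ω ∧
      ∀ᵐ x ∂(volume.restrict Ω), ∀ (u : ℝ) (ξ : 𝔼),
        -(P.growthConst * (f x u ξ ^ P.α + ‖ξ‖ ^ (P.r - 1) + |u| ^ (P.s - 1))) - b₃ x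
          ≤ Real.sign u * b x u ξ ∧
        u * b x u ξ ≤ P.c₈ * (f x u ξ + |u| ^ P.pStar) + b₄ x +
          (P.growthConst * (f x u ξ ^ P.α + ‖ξ‖ ^ (P.r - 1) + |u| ^ (P.s - 1)) + b₃ x) * |u| := by
  have hg7 : P.c₇ ≤ P.growthConst := le_max_left _ _
  have hg9 : P.c₉ ≤ P.growthConst := le_max_right _ _
  have hg : 0 ≤ P.growthConst := hP.c₇_pos.le.trans hg7
  rcases h with ⟨b₃, b₄, h0, h1, h2, h3, h4⟩ | ⟨b₃, h0, h1, h2, h4⟩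
  · refine ⟨b₃, b₄, h0, h1, h2, h3, ?_⟩
    filter_upwards [h0, h4, hf.nonneg] with x hx0 hx hx2 u ξ
    have hF := hx2 u ξ
    have hX : 0 ≤ f x u ξ ^ P.α + ‖ξ‖ ^ (P.r - 1) + |u| ^ (P.s - 1) := by positivity
    have := mul_le_mul_of_nonneg_right hg7 hX
    obtain ⟨hl, hu⟩ := hx u ξ
    have : 0 ≤ (P.growthConst * (f x u ξ ^ P.α + ‖ξ‖ ^ (P.r - 1) + |u| ^ (P.s - 1)) + b₃ x)
        * |u| := mul_nonneg (add_nonneg (mul_nonneg hg hX) hx0.1) (abs_nonneg _)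
    exact ⟨by linarith, by linarith⟩
  · refine ⟨b₃, 0, ?_, h1, h2, integrable_zero _ _ _, ?_⟩
    · filter_upwards [h0] with x hx using ⟨hx, le_rfl⟩
    filter_upwards [h0, h4, hf.nonneg] with x hx0 hx hx2 u ξ
    have hF := hx2 u ξ
    have hd : 0 ≤ ‖ξ‖ ^ (P.r - 1) := by positivity
    have hY : 0 ≤ f x u ξ ^ P.α + |u| ^ (P.s - 1) := by positivity
    have hb : |b x u ξ| ≤
        P.growthConst * (f x u ξ ^ P.α + ‖ξ‖ ^ (P.r - 1) + |u| ^ (P.s - 1)) + b₃ x := by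
      have := hx u ξ
      have := mul_le_mul_of_nonneg_right hg9 hY
      have := mul_nonneg hg hd
      linarith
    refine ⟨?_, ?_⟩
    · have h5 : |Real.sign u * b x u ξ| ≤ |b x u ξ| := by
        rw [abs_mul]
        refine mul_le_of_le_one_left (abs_nonneg _) ?_
        rcases Real.sign_apply_eq u with h | h | h <;> simp [h]
      have := neg_abs_le (Real.sign u * b x u ξ)
      linarith
    · have h5 : u * b x u ξ ≤ |b x u ξ| * |u| := by
        rw [mul_comm |b x u ξ|, ← abs_mul]; exact le_abs_self _
      have h6 := mul_le_mul_of_nonneg_right hb (abs_nonneg u)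
      have h7 : 0 ≤ P.c₈ * (f x u ξ + |u| ^ P.pStar) :=
        mul_nonneg hP.c₈_pos.le (by positivity)
      simp only [Pi.zero_apply]
      linarith

theorem measurable_ite_lt_abs (k : ℝ) :
    Measurable fun t : ℝ => if k < |t| then (1 : ℝ) else 0 :=
  Measurable.ite (measurableSet_lt measurable_const measurable_norm) measurable_const
    measurable_const

theorem excess_eq_zero {k t : ℝ} (h : ¬ k < |t|) : excess k t = 0 := by
  rw [excess, max_eq_right (by linarith [not_lt.1 h]), mul_zero]

theorem excess_eq {k t : ℝ} (h : k < |t|) : excess k t = Real.sign t * (|t| - k) := by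
  rw [excess, max_eq_left (by linarith)]

theorem mul_sign_eq_abs (t : ℝ) : t * Real.sign t = |t| := by
  rcases lt_trichotomy t 0 with h | rfl | h
  · rw [Real.sign_of_neg h, abs_of_neg h]; ring
  · simp
  · rw [Real.sign_of_pos h, abs_of_pos h, mul_one]

theorem abs_sign_of_ne_zero {t : ℝ} (h : t ≠ 0) : |Real.sign t| = 1 := by
  rcases h.lt_or_gt with h | h
  · rw [Real.sign_of_neg h]; simp
  · rw [Real.sign_of_pos h]; simp

theorem abs_excess {k t : ℝ} (hk : 0 ≤ k) : |excess k t| = max (|t| - k) 0 := by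
  by_cases h : k < |t|
  · have ht : t ≠ 0 := by rintro rfl; simp at h; linarith
    rw [excess, abs_mul, abs_sign_of_ne_zero ht, one_mul, abs_of_nonneg (le_max_right _ _)]
  · rw [excess_eq_zero h, max_eq_right (by linarith [not_lt.1 h]), abs_zero]

/-- Two-sided control of `b(x,u,Du)` tested with the excess. -/
theorem abs_mul_excess_le {k t B T H : ℝ} (hk : 0 ≤ k) (hT : 0 ≤ T) (hH : 0 ≤ H)
    (h1 : -T ≤ Real.sign t * B) (h2 : t * B ≤ H) : |B * excess k t| ≤ T * |t| + H := by
  by_cases h : k < |t|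
  · have ht : 0 < |t| := lt_of_le_of_lt hk h
    have hz : 0 ≤ |t| - k := by linarith
    have e : B * excess k t = (Real.sign t * B) * (|t| - k) := by rw [excess_eq h]; ring
    have e2 : t * B = (Real.sign t * B) * |t| := by
      have h3 : |t| * Real.sign t = t := by
        rw [← mul_sign_eq_abs, mul_assoc]
        have : Real.sign t * Real.sign t = 1 := by
          rw [← sq, ← sq_abs, abs_sign_of_ne_zero (abs_pos.1 ht), one_pow]
        rw [this, mul_one]
      rw [mul_comm _ |t|, ← mul_assoc, h3]
    rw [e, abs_le]
    set S := Real.sign t * B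
    constructor
    · have := mul_le_mul_of_nonneg_right h1 hz
      nlinarith
    -- For S > 0, shrinking |t| - k up to |t| only increases the product, and S|t| = tB is what the
    -- upper bound controls.
    · rcases le_or_gt S 0 with hS | hS
      · have := mul_nonpos_of_nonpos_of_nonneg hS hz
        have : 0 ≤ T * |t| := by positivity
        linarith
      · have : S * (|t| - k) ≤ S * |t| := by gcongr; linarith
        have : 0 ≤ T * |t| := by positivity
        linarith
  · rw [excess_eq_zero h, mul_zero, abs_zero]
    positivity

/-- The exponents dual to `s₁`, `s₃` are subcritical. -/
theorem Parameters.Admissible.conj_le (hP : P.Admissible n) {s : ℝ}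
    (hs : P.pStar / (P.pStar - P.p) < s) : s / (s - 1) ≤ P.pStar := by
  have h1 := hP.s_pos hs
  have h2 := hP.pStar_div_lt hs
  have h3 := hP.one_lt_p
  rw [div_lt_iff₀ (by linarith)] at h2
  rw [div_le_iff₀ (by linarith)]
  nlinarith

/-- The energy estimate on super-level sets. -/
theorem exists_energy_estimate (hn : 2 ≤ n) (hΩ : IsOpen Ω) (hΩb : Bornology.IsBounded Ω)
    (hP : P.Admissible n) :
    ∃ K : ℝ, 0 ≤ K ∧ ∀ (f : 𝔼 → ℝ → 𝔼 → ℝ) (a : 𝔼 → ℝ → 𝔼 → 𝔼) (b : 𝔼 → ℝ → 𝔼 → ℝ)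
      (u₀ u : 𝔼 → ℝ) (Du₀ : 𝔼 → 𝔼), IsEnergyIntegrand Ω P f → IsCaratheodory Ω a →
      ComparisonInequalities Ω P f a → IsCaratheodory Ω b →
      (UnilateralGrowth Ω P f b ∨ AbsoluteGrowth Ω P f b) → MemLp u₀ ⊤ (volume.restrict Ω) →
      MemW1F Ω f u₀ Du₀ → IsWeakSolution Ω P.p f a b u₀ u →
      MemLp u (ENNReal.ofReal P.pStar) (volume.restrict Ω) ∧
      ∃ (Du : 𝔼 → 𝔼) (β₁ β₃ : 𝔼 → ℝ),
        (∀ᵐ x ∂(volume.restrict Ω), 0 ≤ β₁ x ∧ 0 ≤ β₃ x) ∧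
        MemLp β₁ (ENNReal.ofReal P.s₁) (volume.restrict Ω) ∧
        (eLpNorm β₁ (ENNReal.ofReal P.s₁) (volume.restrict Ω)).toReal ≤ P.B₁ ∧
        MemLp β₃ (ENNReal.ofReal P.s₃) (volume.restrict Ω) ∧
        (eLpNorm β₃ (ENNReal.ofReal P.s₃) (volume.restrict Ω)).toReal ≤ P.B₃ ∧
        ∀ k : ℝ, 1 ≤ k → (∀ᵐ x ∂(volume.restrict Ω), |u₀ x| ≤ k) →
          MemW1Zero Ω P.p (fun x => excess k (u x))
            (fun x => (if k < |u x| then (1 : ℝ) else 0) • Du x) ∧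
          ∫ x in Ω, (if k < |u x| then (1 : ℝ) else 0) * ‖Du x‖ ^ P.p ≤
            K * ∫ x in Ω, (if k < |u x| then (1 : ℝ) else 0) *
              (|u x| ^ P.critical + β₁ x + β₃ x * |u x|) := by
  obtain ⟨K₁, K₂, hK₁, hK₂, hpt⟩ := hP.exists_pointwise_bound
  obtain ⟨K₀, hK₀, hsrc⟩ := hP.exists_source_bound
  obtain ⟨CS, hCS⟩ := exists_sobolev_const hn hΩb hP
  have := isFiniteMeasure_restrict_of_isBounded hΩb
  refine ⟨K₂, hK₂, ?_⟩
  intro f a b u₀ u Du₀ hf ha hcomp hb hgrowth hu₀ hDu₀ ⟨Du, hu, ⟨Dw, hw⟩, hsol⟩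
  obtain ⟨b₁, b₂, hb₁, hb₁B, hb₂, hab⟩ := hcomp
  obtain ⟨b₃, b₄, hb0, hb₃, hb₃B, hb₄, hbb⟩ := exists_growth_bounds hP hf hgrowth
  have hps := hP.pStar_pos
  have hp : 0 < P.p := by linarith [hP.one_lt_p]
  -- The Sobolev inequality handles u - u₀; u₀ is bounded.
  have huP : MemLp u (ENNReal.ofReal P.pStar) (volume.restrict Ω) := by
    have h1 : MemLp (fun x => u x - u₀ x) (ENNReal.ofReal P.pStar) (volume.restrict Ω) :=
      ⟨hw.1.1.2.1.1, (hCS _ _ hw.2).trans_lt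
        (ENNReal.mul_lt_top ENNReal.coe_lt_top hw.2.1.2.2.2)⟩
    have h2 := h1.add (hu₀.mono_exponent (q := ⊤) (p := ENNReal.ofReal P.pStar) le_top)
    refine (memLp_congr_ae (ae_of_all _ fun x => ?_)).1 h2
    simp
  -- No sign is imposed on b₁, so its absolute value serves as β₁, with the same norm.
  refine ⟨huP, Du, fun x => |b₁ x|, b₃, ?_, hb₁.norm, ?_, hb₃, hb₃B, ?_⟩
  · filter_upwards [hb0] with x hx using ⟨abs_nonneg _, hx.1⟩
  · rw [show (fun x => |b₁ x|) = fun x => ‖b₁ x‖ from rfl, eLpNorm_norm]; exact hb₁B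
  intro k hk1 hk
  have hk0 : 0 ≤ k := by linarith
  have htest := memW1FZero_excess hΩ hΩb hP hf hu₀ hDu₀ hu hw.2 hk0 hk
  refine ⟨htest.2, ?_⟩
  have hum : AEStronglyMeasurable u (volume.restrict Ω) := huP.1
  have hDum : AEStronglyMeasurable Du (volume.restrict Ω) := hu.1.2.2.1
  set μ : Measure 𝔼 := volume.restrict Ω with hμ
  set F : 𝔼 → ℝ := fun x => f x (u x) (Du x) with hF
  set A : 𝔼 → ℝ := fun x => inner ℝ (a x (u x) (Du x)) (Du x) with hA
  set B : 𝔼 → ℝ := fun x => b x (u x) (Du x) with hB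
  set χ : 𝔼 → ℝ := fun x => if k < |u x| then (1 : ℝ) else 0 with hχ
  have hχm : AEStronglyMeasurable χ μ :=
    ((measurable_ite_lt_abs k).comp_aemeasurable hum.aemeasurable).aestronglyMeasurable
  have hχ1 : ∀ x, ‖χ x‖ ≤ 1 := fun x => by
    simp only [hχ]; split_ifs <;> simp
  have hFi : Integrable F μ := hu.2
  have hAm : AEStronglyMeasurable A μ := (ha.aestronglyMeasurable hum hDum).inner hDum
  have hBm : AEStronglyMeasurable B μ := hb.aestronglyMeasurable hum hDum
  have hup : ∀ {e : ℝ}, 0 ≤ e → e ≤ P.pStar → Integrable (fun x => |u x| ^ e) μ :=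
    fun h0 h1 => integrable_abs_rpow h0 h1 hps huP
  have hs1 := hP.s_pos hP.s₁_gt
  have hs3 := hP.s_pos hP.s₃_gt
  have hb₁i : Integrable b₁ μ :=
    memLp_one_iff_integrable.1 (hb₁.mono_exponent (by rw [ENNReal.one_le_ofReal]; exact hs1.le))
  have hb₃u : Integrable (fun x => b₃ x * |u x|) μ := by
    have := integrable_mul_abs_rpow (Real.HolderConjugate.conjExponent hs3) zero_le_one
      (by rw [one_mul]; exact hP.conj_le hP.s₃_gt) hps huP hb₃
    simpa using this
  -- integrability of the principal part
  have hAi : Integrable A μ := by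
    refine Integrable.mono' (g := fun x => (P.c₃ * (P.M - 1) * F x + P.c₄ * |u x| ^ P.pStar + |b₂ x|)
      + (P.c₂ * |u x| ^ P.θ + |b₁ x|)) ?_ hAm ?_
    · exact (((hFi.const_mul _).add ((hup hps.le le_rfl).const_mul _)).add hb₂.norm).add
        (((hup hP.θ_nonneg hP.θ_lt.le).const_mul _).add hb₁i.norm)
    · filter_upwards [hab, hf.inner_gradient_bounds hP, hf.nonneg] with x h1 h2 h3
      obtain ⟨l1, l2⟩ := h1 (u x) (Du x)
      obtain ⟨m1, m2⟩ := h2 (u x) (Du x)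
      have hF0 := h3 (u x) (Du x)
      have q1 := mul_nonneg hP.c₁_pos.le (hF0.trans m1)
      have q2 := mul_le_mul_of_nonneg_left m2 hP.c₃_pos.le
      have q3 := mul_nonneg hP.c₃_pos.le (hF0.trans (m1.trans m2))
      have q4 : 0 ≤ P.c₄ * |u x| ^ P.pStar := mul_nonneg hP.c₄_nonneg (by positivity)
      have q5 : 0 ≤ P.c₂ * |u x| ^ P.θ := mul_nonneg hP.c₂_nonneg (by positivity)
      have q6 := le_abs_self (b₁ x)
      have q7 := le_abs_self (b₂ x)
      have q8 := abs_nonneg (b₁ x)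
      have q9 := abs_nonneg (b₂ x)
      rw [Real.norm_eq_abs, abs_le]
      simp only [hA, hF]
      constructor <;> linarith
  have hsrc' : ∀ᵐ x ∂μ, P.growthConst * (F x ^ P.α + ‖Du x‖ ^ (P.r - 1) + |u x| ^ (P.s - 1)) * |u x|
      ≤ K₀ * (F x + 1 + |u x| ^ P.pStar) := by
    filter_upwards [hf.nonneg, hf.coercive] with x h1 h2
    exact hsrc _ _ _ (h1 _ _) (norm_nonneg _) (abs_nonneg _) (h2 _ _)
  have hg : 0 ≤ P.growthConst := le_max_of_le_left hP.c₇_pos.le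
  -- integrability of the lower order part
  have hBi : Integrable (fun x => B x * excess k (u x)) μ := by
    refine Integrable.mono' (g := fun x => 2 * (K₀ * (F x + 1 + |u x| ^ P.pStar) + b₃ x * |u x|)
      + (P.c₈ * (F x + |u x| ^ P.pStar) + b₄ x)) ?_ (hBm.mul htest.2.1.2.1.1) ?_
    · exact ((((((hFi.add (integrable_const _)).add (hup hps.le le_rfl)).const_mul K₀).add
        hb₃u).const_mul 2).add (((hFi.add (hup hps.le le_rfl)).const_mul _).add hb₄))
    · filter_upwards [hbb, hf.nonneg, hsrc', hb0] with x h1 h2 h3 h4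
      obtain ⟨l1, l2⟩ := h1 (u x) (Du x)
      have hF0 : 0 ≤ F x := h2 (u x) (Du x)
      have hX : 0 ≤ P.growthConst * (F x ^ P.α + ‖Du x‖ ^ (P.r - 1) + |u x| ^ (P.s - 1)) :=
        mul_nonneg hg (by positivity)
      have h8 : 0 ≤ P.c₈ * (F x + |u x| ^ P.pStar) := mul_nonneg hP.c₈_pos.le (by positivity)
      have hT := add_nonneg hX h4.1
      have := abs_mul_excess_le (k := k) hk0 hT
        (add_nonneg (add_nonneg h8 h4.2) (mul_nonneg hT (abs_nonneg (u x))))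
        (by rw [neg_add']; exact l1) l2
      rw [Real.norm_eq_abs]
      refine this.trans ?_
      rw [add_mul]
      linarith
  have hχA : Integrable (fun x => χ x * A x) μ := hAi.bdd_mul hχm (ae_of_all _ hχ1)
  have hz := hsol _ _ htest (hχA.congr (ae_of_all _ fun x => by
    simp only [hχ, hA, inner_smul_right])) hBi
  have hz' : ∫ x, (χ x * A x + B x * excess k (u x)) ∂μ = 0 := by
    rw [← hz]
    refine integral_congr_ae (ae_of_all _ fun x => ?_)
    simp only [hχ, hA, hB, inner_smul_right]
  have hR : Integrable (fun x => χ x * (|u x| ^ P.critical + |b₁ x| + b₃ x * |u x|)) μ := by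
    refine Integrable.bdd_mul (c := 1) ?_ hχm (ae_of_all _ hχ1)
    refine ((hup ?_ hP.critical_lt.le).add hb₁i.norm).add hb₃u
    exact (hP.exponents_nonneg.1).trans P.α_le_critical
  have hDp : Integrable (fun x => χ x * ‖Du x‖ ^ P.p) μ := by
    refine Integrable.bdd_mul (c := 1) ?_ hχm (ae_of_all _ hχ1)
    have := (hu.memLp_gradient hP hf).integrable_norm_rpow (by simpa using hp)
      ENNReal.ofReal_ne_top
    rwa [ENNReal.toReal_ofReal hp.le] at this
  -- The K₁-term is the integrand of the weak equation tested with the excess, so it integrates to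
  -- zero. The pointwise bound applies on {|u| > k} because k ≥ 1.
  have hfin : ∫ x, χ x * ‖Du x‖ ^ P.p ∂μ ≤ ∫ x, (K₁ * (χ x * A x + B x * excess k (u x)) +
      K₂ * (χ x * (|u x| ^ P.critical + |b₁ x| + b₃ x * |u x|))) ∂μ := by
    refine integral_mono_ae hDp (((hχA.add hBi).const_mul K₁).add (hR.const_mul K₂)) ?_
    filter_upwards [hab, hf.inner_gradient_bounds hP, hf.nonneg, hf.coercive, hbb, hb0]
      with x h1 h2 h3 h4 h5 h6
    by_cases hx : k < |u x|
    · have hχx : χ x = 1 := if_pos hx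
      have q1 := mul_le_mul_of_nonneg_left (h2 (u x) (Du x)).1 hP.c₁_pos.le
      have := hpt (F x) ‖Du x‖ |u x| (|u x| - k) (A x) (Real.sign (u x) * B x) |b₁ x| (b₃ x)
        (h3 _ _) (norm_nonneg _) (by linarith) (by linarith) (by linarith) (abs_nonneg _) h6.1
        (h4 _ _) (by linarith [(h1 (u x) (Du x)).1, le_abs_self (b₁ x)]) (h5 (u x) (Du x)).1
      simp only [hχx, one_mul]
      rw [excess_eq hx, ← mul_assoc, mul_comm (B x)]
      exact this
    · have hχx : χ x = 0 := if_neg hx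
      simp [hχx, excess_eq_zero hx]
  have hχAB : Integrable (fun x => χ x * A x + B x * excess k (u x)) μ := hχA.add hBi
  rw [integral_add (hχAB.const_mul K₁) (hR.const_mul K₂), integral_const_mul,
    integral_const_mul, hz', mul_zero, zero_add] at hfin
  exact hfin

end Energy

/-! ### Superlinear recursions -/

/-- By induction Z_i ≤ σ^i for σ = D^(-1/δ): since σ^δ = 1/D, the extra power δ cancels the growth
D^i exactly, and C ≤ σ gives one further factor. Smallness is demanded of C; the initial value need
only be at most 1. -/
theorem tendsto_zero_of_fast_recursion {Z : ℕ → ℝ} {C D δ : ℝ} (hδ : 0 < δ) (hD : 1 < D)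
    (hC : C ≤ D ^ (-1 / δ)) (hZ : ∀ i, 0 ≤ Z i) (hZ0 : Z 0 ≤ 1)
    (hstep : ∀ i, Z (i + 1) ≤ C * D ^ i * Z i ^ (1 + δ)) : Tendsto Z atTop (𝓝 0) := by
  have hD0 : 0 < D := by linarith
  set σ := D ^ (-1 / δ) with hσ
  have hσ0 : 0 < σ := Real.rpow_pos_of_pos hD0 _
  have hσ1 : σ < 1 := Real.rpow_lt_one_of_one_lt_of_neg hD (by
    rw [neg_div]; exact neg_neg_of_pos (by positivity))
  have hσδ : σ ^ δ = D⁻¹ := by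
    rw [hσ, ← Real.rpow_mul hD0.le, div_mul_cancel₀ _ hδ.ne', Real.rpow_neg_one]
  have key : ∀ i, Z i ≤ σ ^ i := by
    intro i
    induction i with
    | zero => simpa using hZ0
    | succ i ih =>
      have h1 : Z i ^ (1 + δ) ≤ (σ ^ i) ^ (1 + δ) := Real.rpow_le_rpow (hZ i) ih (by linarith)
      have h2 : (σ ^ i) ^ (1 + δ) = σ ^ i * (D⁻¹) ^ i := by
        rw [Real.rpow_add (by positivity), Real.rpow_one, ← hσδ, ← Real.rpow_natCast_mul hσ0.le,
          ← Real.rpow_mul_natCast hσ0.le, mul_comm (i : ℝ)]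
      calc Z (i + 1) ≤ C * D ^ i * Z i ^ (1 + δ) := hstep i
        _ ≤ σ * D ^ i * Z i ^ (1 + δ) := by
          have := Real.rpow_nonneg (hZ i) (1 + δ)
          gcongr
        _ ≤ σ * D ^ i * (σ ^ i * (D⁻¹) ^ i) := by rw [← h2]; gcongr
        _ = σ ^ (i + 1) * (D * D⁻¹) ^ i := by rw [mul_pow]; ring
        _ = σ ^ (i + 1) := by rw [mul_inv_cancel₀ hD0.ne', one_pow, mul_one]
  exact squeeze_zero hZ key (tendsto_pow_atTop_nhds_zero_of_lt_one hσ0.le hσ1)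

/-! ### Integrals over superlevel sets -/

section Level

variable {α : Type*} [MeasurableSpace α] {μ : Measure α} [IsFiniteMeasure μ]

theorem integrable_abs_excess_rpow {u : α → ℝ} {q k : ℝ} (hq : 0 < q) (hk : 0 ≤ k)
    (hu : MemLp u (ENNReal.ofReal q) μ) : Integrable (fun x => |excess k (u x)| ^ q) μ := by
  refine (integrable_abs_rpow hq.le le_rfl hq hu).mono' ?_ (ae_of_all _ fun x => ?_)
  · have h1 : (fun x => |excess k (u x)| ^ q) = fun x => (max (|u x| - k) 0) ^ q := by
      funext x; rw [abs_excess hk]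
    rw [h1]
    have hm : Measurable fun t : ℝ => (max (|t| - k) 0) ^ q := by fun_prop
    exact (hm.comp_aemeasurable hu.1.aemeasurable).aestronglyMeasurable
  · rw [Real.norm_of_nonneg (by positivity), abs_excess hk]
    refine Real.rpow_le_rpow (le_max_right _ _) (max_le (by linarith) (abs_nonneg _)) hq.le

/-- Above the level, |u|^e = |u|^q |u|^(e-q), where the first factor is at most (w · excess)^q and
the second at most K^(e-q). The missing powers thus become a negative power of the level, the source
of smallness for large K. -/
theorem integral_ite_abs_rpow_le {u : α → ℝ} {q e k k' K w : ℝ} (hq : 0 < q) (hk : 0 ≤ k)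
    (hu : MemLp u (ENNReal.ofReal q) μ) (heq : e ≤ q) (hK : 0 < K) (hKk : K ≤ k')
    (hw : 0 ≤ w) (hwk : ∀ t : ℝ, k' < |t| → |t| ≤ w * |excess k t|) :
    ∫ x, (if k' < |u x| then (1 : ℝ) else 0) * |u x| ^ e ∂μ ≤
      w ^ q * K ^ (e - q) * ∫ x, |excess k (u x)| ^ q ∂μ := by
  rw [← integral_const_mul]
  refine integral_mono_of_nonneg (ae_of_all _ fun x => ?_)
    ((integrable_abs_excess_rpow hq hk hu).const_mul _) (ae_of_all _ fun x => ?_)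
  · show (0 : ℝ) ≤ (if k' < |u x| then (1 : ℝ) else 0) * |u x| ^ e
    split_ifs <;> positivity
  · show (if k' < |u x| then (1 : ℝ) else 0) * |u x| ^ e ≤ w ^ q * K ^ (e - q) * |excess k (u x)| ^ q
    split_ifs with h
    · have hu0 : 0 < |u x| := by linarith
      calc 1 * |u x| ^ e = |u x| ^ q * |u x| ^ (e - q) := by
            rw [← Real.rpow_add hu0]; ring_nf
        _ ≤ (w * |excess k (u x)|) ^ q * K ^ (e - q) := by
            gcongr ?_ * ?_
            · exact Real.rpow_le_rpow hu0.le (hwk _ h) hq.le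
            · exact Real.rpow_le_rpow_of_nonpos hK (by linarith) (by linarith)
        _ = _ := by rw [Real.mul_rpow hw (abs_nonneg _)]; ring
    · rw [zero_mul]; positivity

/-- Hölder's inequality with exponents s, s', then the preceding bound with e = τs'. The resulting
power of K is (τs' - q)/s' = τ + q/s - q ≤ c - q. The cases τ = 0 and τ = 1 serve β₁ and β₃|u|. -/
theorem integral_ite_mul_abs_rpow_le {u β : α → ℝ} {q τ s c k k' K w B : ℝ} (hq : 0 < q)
    (hk : 0 ≤ k) (hu : MemLp u (ENNReal.ofReal q) μ) (hs : 1 < s) (hτ : 0 ≤ τ)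
    (hτs : τ + q / s ≤ c) (hcq : c ≤ q)
    (hβ : MemLp β (ENNReal.ofReal s) μ) (hβ0 : ∀ᵐ x ∂μ, 0 ≤ β x)
    (hβB : (eLpNorm β (ENNReal.ofReal s) μ).toReal ≤ B) (hK : 1 ≤ K) (hKk : K ≤ k')
    (hw : 1 ≤ w) (hwk : ∀ t : ℝ, k' < |t| → |t| ≤ w * |excess k t|) :
    ∫ x, (if k' < |u x| then (1 : ℝ) else 0) * (β x * |u x| ^ τ) ∂μ ≤
      B * (w ^ q * K ^ (c - q) * (∫ x, |excess k (u x)| ^ q ∂μ) ^ (1 - 1 / s)) := by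
  have hs0 : 0 < s := by linarith
  set s' := s.conjExponent with hs'
  have hc : s.HolderConjugate s' := Real.HolderConjugate.conjExponent hs
  have hs'0 : 0 < s' := hc.symm.pos
  have hinv : 1 / s' = 1 - 1 / s := by
    have := hc.inv_add_inv_eq_one
    rw [one_div, one_div]; linarith
  have hτq : τ * s' ≤ q := by
    have h1 : τ ≤ q * (1 / s') := by rw [hinv]; have : q / s = q * (1 / s) := by ring
                                     linarith
    calc τ * s' ≤ q * (1 / s') * s' := by gcongr
      _ = q := by field_simp
  have hB : 0 ≤ B := ENNReal.toReal_nonneg.trans hβB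
  set g : α → ℝ := fun x => (if k' < |u x| then (1 : ℝ) else 0) * |u x| ^ τ with hg
  have hg0 : ∀ x, 0 ≤ g x := fun x => by simp only [hg]; split_ifs <;> positivity
  have hgs : ∀ x, g x ^ s' = (if k' < |u x| then (1 : ℝ) else 0) * |u x| ^ (τ * s') := fun x => by
    simp only [hg]
    split_ifs
    · rw [one_mul, one_mul, Real.rpow_mul (abs_nonneg _)]
    · rw [zero_mul, zero_mul, Real.zero_rpow hs'0.ne']
  have hgm : MemLp g (ENNReal.ofReal s') μ := by
    refine (memLp_abs_rpow hτ hs'0 hτq hq hu).mono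
      (((measurable_ite_lt_abs k').comp_aemeasurable hu.1.aemeasurable).aestronglyMeasurable.mul
        (memLp_abs_rpow hτ hs'0 hτq hq hu).1) (ae_of_all _ fun x => ?_)
    rw [Real.norm_of_nonneg (hg0 x), Real.norm_of_nonneg (by positivity)]
    simp only [hg]
    split_ifs
    · rw [one_mul]
    · rw [zero_mul]; positivity
  set E := ∫ x, |excess k (u x)| ^ q ∂μ with hE
  have hE0 : 0 ≤ E := integral_nonneg fun x => by positivity
  have hβn : (∫ x, β x ^ s ∂μ) ^ (1 / s) ≤ B := by
    refine le_trans (le_of_eq ?_) hβB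
    rw [hβ.eLpNorm_eq_integral_rpow_norm (by simpa using hs0) ENNReal.ofReal_ne_top,
      ENNReal.toReal_ofReal (by positivity), ENNReal.toReal_ofReal hs0.le, one_div]
    congr 1
    refine integral_congr_ae ?_
    filter_upwards [hβ0] with x hx
    rw [Real.norm_of_nonneg hx]
  calc ∫ x, (if k' < |u x| then (1 : ℝ) else 0) * (β x * |u x| ^ τ) ∂μ
      = ∫ x, β x * g x ∂μ := by
        congr 1; funext x; simp only [hg]; ring
    _ ≤ (∫ x, β x ^ s ∂μ) ^ (1 / s) * (∫ x, g x ^ s' ∂μ) ^ (1 / s') :=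
        integral_mul_le_Lp_mul_Lq_of_nonneg hc hβ0 (ae_of_all _ hg0) hβ hgm
    _ ≤ B * (w ^ q * K ^ (τ * s' - q) * E) ^ (1 / s') := by
        gcongr
        · simp only [hgs]
          exact integral_ite_abs_rpow_le hq hk hu hτq (by linarith) hKk
            (by linarith) hwk
    _ ≤ _ := by
        gcongr
        rw [Real.mul_rpow (by positivity) hE0, Real.mul_rpow (by positivity) (by positivity), hinv,
          ← Real.rpow_mul (by linarith), ← Real.rpow_mul (by linarith)]
        have h1 : (0 : ℝ) < 1 / s := by positivity
        have h2 : (τ * s' - q) * (1 - 1 / s) = τ - q * (1 - 1 / s) := by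
          rw [← hinv]; field_simp
        have h3 : q / s = q * (1 / s) := by ring
        gcongr
        · nlinarith
        · rw [h2]; linarith

end Level

/-- Normalisation makes X ≤ 1, so exponents may be lowered to κ, while T ≥ 1 lets the power of T be
raised to 1. All source terms then share one power of X. -/
theorem mul_rpow_le_mul_rpow {T X a κ : ℝ} (hT : 1 ≤ T) (hX : 0 ≤ X) (hX1 : X ≤ 1) (hκ : 0 ≤ κ)
    (hκa : κ ≤ a) (ha : a ≤ 1) : (T * X) ^ a ≤ T * X ^ κ := by
  rw [Real.mul_rpow (by linarith) hX]
  have h1 : T ^ a ≤ T ^ (1 : ℝ) := Real.rpow_le_rpow_of_exponent_le hT ha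
  rw [Real.rpow_one] at h1
  have h2 : X ^ a ≤ X ^ κ := Real.rpow_le_rpow_of_exponent_ge' hX hX1 hκ hκa
  gcongr

/-- Consecutive levels differ by K/2^(i+1), so the excess y over the lower one satisfies K ≤ 2^(i+1)
y. Hence |t| ≤ y + 2K ≤ (1 + 2^(i+2)) y ≤ 2^(i+3) y. -/
theorem abs_le_two_pow_mul_abs_excess {K t : ℝ} (hK : 0 ≤ K) (i : ℕ)
    (ht : K * (2 - (1 / 2) ^ (i + 1)) < |t|) :
    |t| ≤ 2 ^ (i + 3) * |excess (K * (2 - (1 / 2) ^ i)) t| := by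
  have h0 : (0 : ℝ) < (1 / 2) ^ i := by positivity
  have h1 : ((1 : ℝ) / 2) ^ i ≤ 1 := pow_le_one₀ (by norm_num) (by norm_num)
  have h2 : (2 : ℝ) ^ i * (1 / 2) ^ i = 1 := by rw [← mul_pow]; norm_num
  rw [pow_succ] at ht
  rw [abs_excess (mul_nonneg hK (by linarith)), pow_add]
  have h3 : (1 : ℝ) ≤ 2 ^ i := one_le_pow₀ (by norm_num)
  set h : ℝ := (1 / 2) ^ i with hh
  set W : ℝ := 2 ^ i with hW
  have h4 : |t| - K * (2 - h) ≤ max (|t| - K * (2 - h)) 0 := le_max_left _ _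
  set y := max (|t| - K * (2 - h)) 0 with hy
  have h5 : K * h ≤ 2 * y := by linarith
  have h6 : K ≤ 2 * (W * y) := by
    have := mul_le_mul_of_nonneg_left h5 (by linarith : 0 ≤ W)
    have h7 : W * (K * h) = K * (W * h) := by ring
    rw [h7, h2, mul_one] at this
    linarith
  have h8 : y ≤ W * y := le_mul_of_one_le_left (le_max_right _ _) h3
  have h9 : 0 ≤ K * h := by positivity
  have h10 : 0 ≤ y := le_max_right _ _
  norm_num
  nlinarith

theorem toReal_eLpNorm_rpow {α F : Type*} [MeasurableSpace α] {μ : Measure α}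
    [NormedAddCommGroup F] {v : α → F} {q r : ℝ} (hq : 0 < q)
    (hv : MemLp v (ENNReal.ofReal q) μ) :
    (eLpNorm v (ENNReal.ofReal q) μ).toReal ^ r = (∫ x, ‖v x‖ ^ q ∂μ) ^ (r / q) := by
  have h1 : 0 ≤ ∫ x, ‖v x‖ ^ q ∂μ := integral_nonneg fun x => by positivity
  rw [hv.eLpNorm_eq_integral_rpow_norm (by simpa using hq) ENNReal.ofReal_ne_top,
    ENNReal.toReal_ofReal hq.le, ENNReal.toReal_ofReal (by positivity), ← Real.rpow_mul h1]
  congr 1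
  ring

/-! ### De Giorgi iteration -/

section Level

variable {α : Type*} [MeasurableSpace α] {μ : Measure α}

theorem integrable_ite_lt_abs_mul {u g : α → ℝ} (hg : Integrable g μ)
    (hu : AEMeasurable u μ) (k : ℝ) :
    Integrable (fun x => (if k < |u x| then (1 : ℝ) else 0) * g x) μ := by
  refine hg.bdd_mul (c := 1) ((measurable_ite_lt_abs k).comp_aemeasurable hu).aestronglyMeasurable
    (ae_of_all _ fun x => ?_)
  show ‖(if k < |u x| then (1 : ℝ) else 0)‖ ≤ 1
  split_ifs <;> simp

theorem integral_abs_excess_rpow_mono [IsFiniteMeasure μ] {u : α → ℝ} {q k k' : ℝ} (hq : 0 < q)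
    (hk : 0 ≤ k) (hkk : k ≤ k') (hu : MemLp u (ENNReal.ofReal q) μ) :
    ∫ x, |excess k' (u x)| ^ q ∂μ ≤ ∫ x, |excess k (u x)| ^ q ∂μ := by
  refine integral_mono (integrable_abs_excess_rpow hq (hk.trans hkk) hu)
    (integrable_abs_excess_rpow hq hk hu) fun x => ?_
  show |excess k' (u x)| ^ q ≤ |excess k (u x)| ^ q
  rw [abs_excess hk, abs_excess (hk.trans hkk)]
  gcongr

theorem integral_abs_excess_rpow_le [IsFiniteMeasure μ] {u : α → ℝ} {q k : ℝ} (hq : 0 < q)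
    (hk : 0 ≤ k) (hu : MemLp u (ENNReal.ofReal q) μ) :
    ∫ x, |excess k (u x)| ^ q ∂μ ≤ (eLpNorm u (ENNReal.ofReal q) μ).toReal ^ q := by
  rw [toReal_eLpNorm_rpow hq hu, div_self hq.ne', Real.rpow_one]
  refine integral_mono (integrable_abs_excess_rpow hq hk hu)
    (integrable_abs_rpow hq.le le_rfl hq hu) fun x => ?_
  show |excess k (u x)| ^ q ≤ ‖u x‖ ^ q
  rw [Real.norm_eq_abs]
  rw [abs_excess hk]
  exact Real.rpow_le_rpow (le_max_right _ _) (max_le (by linarith) (abs_nonneg _)) hq.le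

/-- The source terms on a superlevel set, estimated by the excess above a lower level. -/
theorem integral_source_le [IsFiniteMeasure μ] {u β₁ β₃ : α → ℝ}
    {q c s₁ s₃ B₁ B₃ k k' K w κ T : ℝ} (hq : 0 < q) (hcq : c ≤ q) (hs₁ : 1 < s₁) (hs₃ : 1 < s₃)
    (hc₁ : q / s₁ ≤ c) (hc₃ : q / s₃ + 1 ≤ c) (hκ : 0 ≤ κ) (hκ₁ : κ ≤ 1 - 1 / s₁)
    (hκ₃ : κ ≤ 1 - 1 / s₃) (hk : 0 ≤ k) (hu : MemLp u (ENNReal.ofReal q) μ)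
    (h₁ : MemLp β₁ (ENNReal.ofReal s₁) μ) (h₁0 : ∀ᵐ x ∂μ, 0 ≤ β₁ x)
    (h₁B : (eLpNorm β₁ (ENNReal.ofReal s₁) μ).toReal ≤ B₁)
    (h₃ : MemLp β₃ (ENNReal.ofReal s₃) μ) (h₃0 : ∀ᵐ x ∂μ, 0 ≤ β₃ x)
    (h₃B : (eLpNorm β₃ (ENNReal.ofReal s₃) μ).toReal ≤ B₃) (hK : 1 ≤ K) (hKk : K ≤ k')
    (hw : 1 ≤ w) (hwk : ∀ t : ℝ, k' < |t| → |t| ≤ w * |excess k t|) (hT : 1 ≤ T)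
    (hJT : ∫ x, |excess k (u x)| ^ q ∂μ ≤ T) :
    ∫ x, (if k' < |u x| then (1 : ℝ) else 0) * (|u x| ^ c + β₁ x + β₃ x * |u x|) ∂μ ≤
      (1 + B₁ + B₃) * (w ^ q * K ^ (c - q) *
        (T * ((∫ x, |excess k (u x)| ^ q ∂μ) / T) ^ κ)) := by
  have hum := hu.1.aemeasurable
  have hT0 : 0 < T := by linarith
  have hc0 : 0 ≤ c := le_trans (by positivity) hc₁
  set J := ∫ x, |excess k (u x)| ^ q ∂μ with hJ
  have hJ0 : 0 ≤ J := integral_nonneg fun x => by positivity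
  have hX0 : 0 ≤ J / T := by positivity
  have hX1 : J / T ≤ 1 := (div_le_one hT0).2 hJT
  have hJe : J = T * (J / T) := by field_simp
  have hpow : ∀ a, κ ≤ a → a ≤ 1 → J ^ a ≤ T * (J / T) ^ κ := fun a h1 h2 => by
    conv_lhs => rw [hJe]
    exact mul_rpow_le_mul_rpow hT hX0 hX1 hκ h1 h2
  have hs₁0 : 0 < 1 / s₁ := by positivity
  have hs₃0 : 0 < 1 / s₃ := by positivity
  have hB₁ : 0 ≤ B₁ := ENNReal.toReal_nonneg.trans h₁B
  have hB₃ : 0 ≤ B₃ := ENNReal.toReal_nonneg.trans h₃B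
  have i₀ : Integrable (fun x => |u x| ^ c) μ := integrable_abs_rpow hc0 hcq hq hu
  have i₁ : Integrable β₁ μ :=
    memLp_one_iff_integrable.1 (h₁.mono_exponent (by rw [ENNReal.one_le_ofReal]; exact hs₁.le))
  have i₃ : Integrable (fun x => β₃ x * |u x|) μ := by
    have hconj := Real.HolderConjugate.conjExponent hs₃
    have h1 : 1 / s₃.conjExponent = 1 - 1 / s₃ := by
      have := hconj.inv_add_inv_eq_one
      rw [one_div, one_div]; linarith
    have h2 : s₃.conjExponent ≤ q := by
      have h3 : 1 ≤ q * (1 / s₃.conjExponent) := by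
        rw [h1]; have : q / s₃ = q * (1 / s₃) := by ring
        linarith
      have h4 := hconj.symm.pos
      rwa [mul_one_div, one_le_div h4] at h3
    have := integrable_mul_abs_rpow hconj zero_le_one (by rwa [one_mul]) hq hu h₃
    simpa using this
  have t₀ := integral_ite_abs_rpow_le (μ := μ) (e := c) hq hk hu hcq (by linarith) hKk
    (by linarith) hwk
  have t₁ := integral_ite_mul_abs_rpow_le (τ := 0) hq hk hu hs₁ le_rfl (by rwa [zero_add]) hcq h₁
    h₁0 h₁B hK hKk hw hwk
  have t₃ := integral_ite_mul_abs_rpow_le (τ := 1) hq hk hu hs₃ zero_le_one (by rwa [add_comm]) hcq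
    h₃ h₃0 h₃B hK hKk hw hwk
  simp only [Real.rpow_zero, mul_one, Real.rpow_one] at t₁ t₃
  have j₀₁ : Integrable (fun x => (if k' < |u x| then (1 : ℝ) else 0) * |u x| ^ c +
      (if k' < |u x| then (1 : ℝ) else 0) * β₁ x) μ :=
    (integrable_ite_lt_abs_mul i₀ hum k').add (integrable_ite_lt_abs_mul i₁ hum k')
  simp only [mul_add]
  rw [integral_add j₀₁ (integrable_ite_lt_abs_mul i₃ hum k'),
    integral_add (integrable_ite_lt_abs_mul i₀ hum k') (integrable_ite_lt_abs_mul i₁ hum k')]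
  set Q := w ^ q * K ^ (c - q) with hQ
  have hQ0 : 0 ≤ Q := by positivity
  have e₀ : Q * J ≤ Q * (T * (J / T) ^ κ) := by
    have := hpow 1 (by linarith) le_rfl
    rw [Real.rpow_one] at this
    gcongr
  have e₁ : B₁ * (Q * J ^ (1 - 1 / s₁)) ≤ B₁ * (Q * (T * (J / T) ^ κ)) := by
    have := hpow _ hκ₁ (by linarith)
    gcongr
  have e₃ : B₃ * (Q * J ^ (1 - 1 / s₃)) ≤ B₃ * (Q * (T * (J / T) ^ κ)) := by
    have := hpow _ hκ₃ (by linarith)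
    gcongr
  have : (1 + B₁ + B₃) * (Q * (T * (J / T) ^ κ)) = Q * (T * (J / T) ^ κ) +
    B₁ * (Q * (T * (J / T) ^ κ)) + B₃ * (Q * (T * (J / T) ^ κ)) := by ring
  rw [this]
  linarith

/-- De Giorgi's iteration: decay of the excess over superlevel sets gives a bound. -/
theorem exists_const_ae_abs_le [IsFiniteMeasure μ] {p q c s₁ s₃ A B₁ B₃ : ℝ} (hp : 0 < p)
    (hpq : p < q) (hcq : c < q) (hs₁ : 1 < s₁) (hs₃ : 1 < s₃) (hd₁ : q / s₁ < q - p)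
    (hd₃ : q / s₃ < q - p) (hc₁ : q / s₁ ≤ c) (hc₃ : q / s₃ + 1 ≤ c) (hA : 0 ≤ A) :
    ∃ L : ℝ, 1 ≤ L ∧ ∀ u β₁ β₃ : α → ℝ, MemLp u (ENNReal.ofReal q) μ →
      MemLp β₁ (ENNReal.ofReal s₁) μ → (∀ᵐ x ∂μ, 0 ≤ β₁ x) →
      (eLpNorm β₁ (ENNReal.ofReal s₁) μ).toReal ≤ B₁ →
      MemLp β₃ (ENNReal.ofReal s₃) μ → (∀ᵐ x ∂μ, 0 ≤ β₃ x) →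
      (eLpNorm β₃ (ENNReal.ofReal s₃) μ).toReal ≤ B₃ →
      ∀ K : ℝ, L * (1 + (eLpNorm u (ENNReal.ofReal q) μ).toReal) ^ ((q - p) / (q - c)) ≤ K →
      (∀ k : ℝ, K ≤ k → (∫ x, |excess k (u x)| ^ q ∂μ) ^ (p / q) ≤
        A * ∫ x, (if k < |u x| then (1 : ℝ) else 0) *
          (|u x| ^ c + β₁ x + β₃ x * |u x|) ∂μ) →
      ∀ᵐ x ∂μ, |u x| ≤ 2 * K := by
  have hq : 0 < q := hp.trans hpq
  set κ := min (1 - 1 / s₁) (1 - 1 / s₃) with hκ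
  have hκp : p < κ * q := by
    have e₁ : q / s₁ = q * (1 / s₁) := by ring
    have e₃ : q / s₃ = q * (1 / s₃) := by ring
    rcases min_choice (1 - 1 / s₁) (1 - 1 / s₃) with h | h <;> rw [hκ, h] <;> linarith
  have hκ0 : 0 < κ := by
    by_contra h
    nlinarith
  -- For Z = (J/T)^(p/q) this gives Z^(1+δ) = (J/T)^κ; positivity of δ is the condition κ > p/q.
  set δ := κ * q / p - 1 with hδ
  have hδ0 : 0 < δ := by rw [hδ, sub_pos, one_lt_div hp]; exact hκp
  set D : ℝ := 2 ^ q with hD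
  have hD1 : 1 < D := Real.one_lt_rpow (by norm_num) hq
  set σ := D ^ (-1 / δ) with hσ
  have hσ0 : 0 < σ := Real.rpow_pos_of_pos (by linarith) _
  -- The weights w = 2^(i+3) satisfy w^q = 8^q D^i, whence the factor 8^q. Absolute values keep A'
  -- nonnegative before any data bound B₁, B₃ from below.
  set A' := A * (1 + |B₁| + |B₃|) * 8 ^ q with hA'
  have hA'0 : 0 ≤ A' := by positivity
  have hqc : 0 < q - c := by linarith
  set L := max 1 ((A' / σ) ^ (1 / (q - c))) with hL
  have hL1 : 1 ≤ L := le_max_left _ _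
  have hLσ : A' * L ^ (c - q) ≤ σ := by
    have h1 : A' / σ ≤ L ^ (q - c) := by
      calc A' / σ = ((A' / σ) ^ (1 / (q - c))) ^ (q - c) := by
            rw [← Real.rpow_mul (by positivity), one_div_mul_cancel hqc.ne', Real.rpow_one]
        _ ≤ L ^ (q - c) := Real.rpow_le_rpow (by positivity) (le_max_right _ _) hqc.le
    rw [div_le_iff₀ hσ0] at h1
    rw [show c - q = -(q - c) by ring, Real.rpow_neg (by linarith), ← div_eq_mul_inv,
      div_le_iff₀ (Real.rpow_pos_of_pos (by linarith) _)]
    linarith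
  refine ⟨L, hL1, ?_⟩
  intro u β₁ β₃ hu h₁ h₁0 h₁B h₃ h₃0 h₃B K hK hlevel
  set U := (eLpNorm u (ENNReal.ofReal q) μ).toReal with hU
  have hU0 : 0 ≤ U := ENNReal.toReal_nonneg
  have hU1 : 1 ≤ 1 + U := by linarith
  have hUpos : 0 < 1 + U := by linarith
  have hV1 : 1 ≤ (1 + U) ^ ((q - p) / (q - c)) :=
    Real.one_le_rpow hU1 (div_nonneg (by linarith) hqc.le)
  have hK1 : 1 ≤ K := le_trans (by nlinarith) hK
  have hK0 : 0 < K := by linarith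
  -- The exponent (q-p)/(q-c) in the lower bound for K is the one for which the powers of 1 + U
  -- cancel, so L depends only on the data.
  have hΛ : A' * (K ^ (c - q) * (1 + U) ^ (q - p)) ≤ σ := by
    have h1 : K ^ (c - q) ≤ L ^ (c - q) * (1 + U) ^ (-(q - p)) := by
      calc K ^ (c - q) ≤ (L * (1 + U) ^ ((q - p) / (q - c))) ^ (c - q) :=
            Real.rpow_le_rpow_of_nonpos (by positivity) hK (by linarith)
        _ = _ := by
          rw [Real.mul_rpow (by linarith) (by positivity), ← Real.rpow_mul hUpos.le]
          congr 2
          field_simp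
          ring
    calc A' * (K ^ (c - q) * (1 + U) ^ (q - p))
        ≤ A' * (L ^ (c - q) * (1 + U) ^ (-(q - p)) * (1 + U) ^ (q - p)) := by gcongr
      _ = A' * L ^ (c - q) := by
        rw [mul_assoc (L ^ (c - q)), ← Real.rpow_add hUpos, neg_add_cancel, Real.rpow_zero, mul_one]
      _ ≤ σ := hLσ
  set T := (1 + U) ^ q with hT
  have hT1 : 1 ≤ T := Real.one_le_rpow hU1 hq.le
  have hT0 : 0 < T := by linarith
  set k : ℕ → ℝ := fun i => K * (2 - (1 / 2) ^ i) with hk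
  have hkK : ∀ i, K ≤ k i := fun i => by
    have : ((1 : ℝ) / 2) ^ i ≤ 1 := pow_le_one₀ (by norm_num) (by norm_num)
    simp only [hk]; nlinarith
  have hk2 : ∀ i, k i ≤ 2 * K := fun i => by
    have : (0 : ℝ) < (1 / 2) ^ i := by positivity
    simp only [hk]; nlinarith
  have hk0 : ∀ i, 0 ≤ k i := fun i => hK0.le.trans (hkK i)
  set J : ℝ → ℝ := fun k => ∫ x, |excess k (u x)| ^ q ∂μ with hJ
  have hJ0 : ∀ k, 0 ≤ J k := fun k => integral_nonneg fun x => by positivity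
  have hJT : ∀ i, J (k i) ≤ T := fun i =>
    (integral_abs_excess_rpow_le hq (hk0 i) hu).trans
      (Real.rpow_le_rpow hU0 (by linarith) hq.le)
  have hlim : Tendsto (fun i => (J (k i) / T) ^ (p / q)) atTop (𝓝 0) := by
    refine tendsto_zero_of_fast_recursion (C := A' * (K ^ (c - q) * (1 + U) ^ (q - p)))
      hδ0 hD1 hΛ (fun i => Real.rpow_nonneg (div_nonneg (hJ0 _) hT0.le) _) ?_ ?_
    · exact Real.rpow_le_one (div_nonneg (hJ0 _) hT0.le) ((div_le_one hT0).2 (hJT 0))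
        (by positivity)
    · intro i
      have hX0 : 0 ≤ J (k i) / T := div_nonneg (hJ0 _) hT0.le
      have hsrc := integral_source_le (w := 2 ^ (i + 3)) (κ := κ) hq hcq.le hs₁ hs₃ hc₁ hc₃ hκ0.le
        (min_le_left _ _) (min_le_right _ _) (hk0 i) hu h₁ h₁0 (h₁B.trans (le_abs_self _)) h₃ h₃0
        (h₃B.trans (le_abs_self _)) hK1 (hkK (i + 1)) (one_le_pow₀ (by norm_num))
        (fun t ht => abs_le_two_pow_mul_abs_excess hK0.le i ht) hT1 (hJT i)
      have hw : ((2 : ℝ) ^ (i + 3)) ^ q = 8 ^ q * D ^ i := by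
        rw [pow_add, Real.mul_rpow (by positivity) (by positivity), hD, ← Real.rpow_natCast_mul
          (by norm_num), ← Real.rpow_mul_natCast (by norm_num), mul_comm (i : ℝ), mul_comm]
        norm_num
      have hZ : ((J (k i) / T) ^ (p / q)) ^ (1 + δ) = (J (k i) / T) ^ κ := by
        rw [← Real.rpow_mul hX0]
        congr 1
        rw [hδ]; field_simp; ring
      have hTp : T ^ (p / q) = (1 + U) ^ p := by
        rw [hT, ← Real.rpow_mul hUpos.le]; congr 1; field_simp
      have hTU : T = (1 + U) ^ (q - p) * (1 + U) ^ p := by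
        rw [← Real.rpow_add hUpos, hT]; congr 1; ring
      rw [hZ, Real.div_rpow (hJ0 _) hT0.le, hTp, div_le_iff₀ (by positivity)]
      calc J (k (i + 1)) ^ (p / q) ≤ A * _ := hlevel _ (hkK _)
        _ ≤ A * _ := mul_le_mul_of_nonneg_left hsrc hA
        _ = A' * K ^ (c - q) * D ^ i * (J (k i) / T) ^ κ * T := by
          rw [hw, hA']; ring
        _ = _ := by generalize (J (k i) / T) ^ κ = Y
                    rw [hTU]; ring
  -- All levels k_i lie below 2K, so the excess integral at 2K is bounded by every term of a null
  -- sequence.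
  have hJ2 : J (2 * K) = 0 := by
    have h1 : (J (2 * K) / T) ^ (p / q) ≤ 0 := by
      refine ge_of_tendsto' hlim fun i => ?_
      have := integral_abs_excess_rpow_mono hq (hk0 i) (hk2 i) hu
      exact Real.rpow_le_rpow (div_nonneg (hJ0 _) hT0.le) (by gcongr) (by positivity)
    by_contra h
    have h2 : 0 < J (2 * K) := lt_of_le_of_ne (hJ0 _) (Ne.symm h)
    exact absurd h1 (not_le.2 (by positivity))
  have h2K : 0 ≤ 2 * K := by linarith
  have hz := (integral_eq_zero_iff_of_nonneg (fun x => by positivity)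
    (integrable_abs_excess_rpow hq h2K hu)).1 hJ2
  filter_upwards [hz] with x hx
  have h1 : |excess (2 * K) (u x)| = 0 := by
    have : |excess (2 * K) (u x)| ^ q = 0 := hx
    exact ((Real.rpow_eq_zero (abs_nonneg _) hq.ne').1 this)
  rw [abs_excess h2K] at h1
  linarith [le_max_left (|u x| - 2 * K) 0]

end Level

/-! ### From the Sobolev inequality to the level inequality -/

section Bound

variable {n : ℕ} {Ω : Set (EuclideanSpace ℝ (Fin n))} {P : Parameters}

local notation "𝔼" => EuclideanSpace ℝ (Fin n)

theorem ae_abs_le_toReal_eLpNorm_top {α : Type*} [MeasurableSpace α] {μ : Measure α}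
    {v : α → ℝ} (hv : MemLp v ⊤ μ) : ∀ᵐ x ∂μ, |v x| ≤ (eLpNorm v ⊤ μ).toReal := by
  rw [eLpNorm_exponent_top]
  have hfin : eLpNormEssSup v μ ≠ ⊤ := by
    have := hv.2.ne; rwa [eLpNorm_exponent_top] at this
  filter_upwards [ae_le_eLpNormEssSup (f := v) (μ := μ)] with x hx
  have := ENNReal.toReal_mono hfin hx
  rwa [toReal_enorm] at this

/-- The Sobolev inequality for truncations. -/
theorem rpow_integral_excess_le {C : ℝ≥0} (hP : P.Admissible n) {u : 𝔼 → ℝ} {Du : 𝔼 → 𝔼} {k : ℝ}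
    (hv : MemW1Zero Ω P.p (fun x => excess k (u x))
      (fun x => (if k < |u x| then (1 : ℝ) else 0) • Du x))
    (hS : eLpNorm (fun x => excess k (u x)) (ENNReal.ofReal P.pStar) (volume.restrict Ω) ≤
      C * eLpNorm (fun x => (if k < |u x| then (1 : ℝ) else 0) • Du x) (ENNReal.ofReal P.p)
        (volume.restrict Ω)) :
    (∫ x in Ω, |excess k (u x)| ^ P.pStar) ^ (P.p / P.pStar) ≤
      (C : ℝ) ^ P.p * ∫ x in Ω, (if k < |u x| then (1 : ℝ) else 0) * ‖Du x‖ ^ P.p := by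
  have hp : 0 < P.p := by linarith [hP.one_lt_p]
  have hD := hv.1.2.2
  have hCD := ENNReal.mul_lt_top (ENNReal.coe_lt_top (r := C)) hD.2
  have hE : MemLp (fun x => excess k (u x)) (ENNReal.ofReal P.pStar) (volume.restrict Ω) :=
    ⟨hv.1.2.1.1, hS.trans_lt hCD⟩
  have h1 := ENNReal.toReal_mono hCD.ne hS
  rw [ENNReal.toReal_mul, ENNReal.coe_toReal] at h1
  have h2 := Real.rpow_le_rpow ENNReal.toReal_nonneg h1 hp.le
  rw [Real.mul_rpow C.coe_nonneg ENNReal.toReal_nonneg, toReal_eLpNorm_rpow hP.pStar_pos hE,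
    toReal_eLpNorm_rpow hp hD, div_self hp.ne', Real.rpow_one] at h2
  have h3 : ∀ x, ‖(if k < |u x| then (1 : ℝ) else 0) • Du x‖ ^ P.p =
      (if k < |u x| then (1 : ℝ) else 0) * ‖Du x‖ ^ P.p := fun x => by
    split_ifs
    · rw [one_smul, one_mul]
    · rw [zero_smul, norm_zero, Real.zero_rpow hp.ne', zero_mul]
  simp only [h3] at h2
  exact h2

end Bound

end DirichletBoundedness

end

/-! ### The quantitative bound -/

theorem mainTheorem2 (n : ℕ) (hn : 2 ≤ n)
    (Ω : Set (EuclideanSpace ℝ (Fin n))) (hΩ : IsOpen Ω) (hΩb : Bornology.IsBounded Ω)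
    (P : DirichletBoundedness.Parameters) (hP : P.Admissible n) :
    0 < P.gamma ∧
    ∃ c : ℝ, 0 < c ∧
      ∀ (f : EuclideanSpace ℝ (Fin n) → ℝ → EuclideanSpace ℝ (Fin n) → ℝ)
        (a : EuclideanSpace ℝ (Fin n) → ℝ → EuclideanSpace ℝ (Fin n) →
          EuclideanSpace ℝ (Fin n))
        (b : EuclideanSpace ℝ (Fin n) → ℝ → EuclideanSpace ℝ (Fin n) → ℝ)
        (u₀ u : EuclideanSpace ℝ (Fin n) → ℝ),
        DirichletBoundedness.IsEnergyIntegrand Ω P f →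
        DirichletBoundedness.IsCaratheodory Ω a →
        DirichletBoundedness.ComparisonInequalities Ω P f a →
        DirichletBoundedness.IsCaratheodory Ω b →
        (DirichletBoundedness.UnilateralGrowth Ω P f b ∨
          DirichletBoundedness.AbsoluteGrowth Ω P f b) →
        MemLp u₀ ⊤ (volume.restrict Ω) →
        (∃ Du₀, DirichletBoundedness.MemW1F Ω f u₀ Du₀) →
        DirichletBoundedness.IsWeakSolution Ω P.p f a b u₀ u →
        MemLp u ⊤ (volume.restrict Ω) ∧
        MemLp u (ENNReal.ofReal P.pStar) (volume.restrict Ω) ∧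
        (eLpNorm u ⊤ (volume.restrict Ω)).toReal ≤
          c * (1 + (eLpNorm u₀ ⊤ (volume.restrict Ω)).toReal) *
            (1 + (eLpNorm u (ENNReal.ofReal P.pStar) (volume.restrict Ω)).toReal) ^ P.gamma ∧
        (eLpNorm u ⊤ (volume.restrict Ω)).toReal ≤
          c * (1 + (eLpNorm u₀ ⊤ (volume.restrict Ω)).toReal) *
            (1 + (eLpNorm u (ENNReal.ofReal P.pStar) (volume.restrict Ω)).toReal) ^
              max 1 P.gamma := by
  have hp : 0 < P.p := by linarith [hP.one_lt_p]
  have hγ := hP.gamma_pos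
  refine ⟨hγ, ?_⟩
  have := DirichletBoundedness.isFiniteMeasure_restrict_of_isBounded hΩb
  obtain ⟨C, hC⟩ := DirichletBoundedness.exists_sobolev_const hn hΩb hP
  obtain ⟨A, hA, henergy⟩ := DirichletBoundedness.exists_energy_estimate hn hΩ hΩb hP
  obtain ⟨L, hL1, hbound⟩ := DirichletBoundedness.exists_const_ae_abs_le
    (μ := volume.restrict Ω) (A := (C : ℝ) ^ P.p * A) (B₁ := P.B₁) (B₃ := P.B₃) hp hP.p_lt_pStar
    hP.critical_lt (hP.s_pos hP.s₁_gt) (hP.s_pos hP.s₃_gt) (hP.pStar_div_lt hP.s₁_gt)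
    (hP.pStar_div_lt hP.s₃_gt) P.s₁_le_critical P.s₃_le_critical (by positivity)
  rw [← P.gamma_eq] at hbound
  refine ⟨2 * L, by linarith, ?_⟩
  intro f a b u₀ u hf ha hcomp hb hgrowth hu₀ ⟨Du₀, hDu₀⟩ hsol
  obtain ⟨hu, Du, β₁, β₃, hβ, h₁, h₁B, h₃, h₃B, hlev⟩ :=
    henergy f a b u₀ u Du₀ hf ha hcomp hb hgrowth hu₀ hDu₀ hsol
  have hu₀le := DirichletBoundedness.ae_abs_le_toReal_eLpNorm_top hu₀
  set U₀ := (eLpNorm u₀ ⊤ (volume.restrict Ω)).toReal with hU₀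
  have hU₀0 : 0 ≤ U₀ := ENNReal.toReal_nonneg
  have hb' := hbound u β₁ β₃ hu h₁ (hβ.mono fun x hx => hx.1) h₁B h₃
    (hβ.mono fun x hx => hx.2) h₃B
  set U := (eLpNorm u (ENNReal.ofReal P.pStar) (volume.restrict Ω)).toReal with hU
  have hU1 : 1 ≤ 1 + U := le_add_of_nonneg_right ENNReal.toReal_nonneg
  have hV : 1 ≤ L * (1 + U) ^ P.gamma :=
    one_le_mul_of_one_le_of_one_le hL1 (Real.one_le_rpow hU1 hγ.le)
  -- Both factors are at least 1, so the product exceeds each of them: the first makes every higher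
  -- level admissible for truncation, the second starts the iteration. The bound 2K accounts for the
  -- constant 2L.
  have hle := hb' ((1 + U₀) * (L * (1 + U) ^ P.gamma))
    (le_mul_of_one_le_left (by linarith) (by linarith)) (fun k hk => by
      have hk' : 1 + U₀ ≤ k := (le_mul_of_one_le_right (by linarith) hV).trans hk
      obtain ⟨hW, hE⟩ := hlev k (by linarith) (hu₀le.mono fun x hx => by linarith)
      refine (DirichletBoundedness.rpow_integral_excess_le hP hW (hC _ _ hW)).trans ?_
      rw [mul_assoc]
      exact mul_le_mul_of_nonneg_left hE (by positivity))
  have hsup := eLpNorm_le_of_ae_bound (p := ⊤) (f := u) hle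
  rw [ENNReal.toReal_top, inv_zero, ENNReal.rpow_zero, one_mul] at hsup
  have hreal := ENNReal.toReal_mono ENNReal.ofReal_ne_top hsup
  rw [ENNReal.toReal_ofReal (by positivity)] at hreal
  have hmain : (eLpNorm u ⊤ (volume.restrict Ω)).toReal ≤
      2 * L * (1 + U₀) * (1 + U) ^ P.gamma := hreal.trans_eq (by ring)
  refine ⟨⟨hu.1, hsup.trans_lt ENNReal.ofReal_lt_top⟩, hu, hmain, hmain.trans ?_⟩
  exact mul_le_mul_of_nonneg_left
    (Real.rpow_le_rpow_of_exponent_le hU1 (le_max_right _ _)) (by positivity)
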